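/- **Setting.** Let $S$ be a scheme, $S_0\subset S$ an effective Cartier divisor (a closed subscheme locally defined by one nonzerodivisor), $G\to S$ a group scheme, $G_0:=G\times_S S_0$, and $H\subset G_0$ a closed subgroup scheme over $S_0$. Let $\mathcal I\supset\mathcal J$ be the ideal sheaves of $H$ and $G_0$ in $\mathcal O_G$. The *Néron blowup* $\mathcal G\to G$ of $G$ in $H$ along $S_0$ is the relative spectrum of the affine blowup algebra $\mathcal O_G[\mathcal I/\mathcal J]$: over an affine open $\operatorname{Spec} B\subset G$ on which $\mathcal J$ is generated by one element $b$, and with $I=\Gamma(\operatorname{Spec} B,\mathcal I)$, it is the spectrum of the subring $B[I/b]=\{x/b^n : n\ge 0,\ x\in I^n\}$ of $B[1/b]$. An $S$-scheme $T$ is called *$S_0$-regular* if $T\times_S S_0$ is an effective Cartier divisor on $T$ (every flat $S$-scheme is). A closed immersion is *regular* if its ideal is generated by a regular sequence locally around each point of the closed subscheme. **Theorem.** (a) $\mathcal G$ is $S_0$-regular, and for every $S_0$-regular $S$-scheme $T$ and every $S$-morphism $t:T\to G$, the restriction $T\times_S S_0\to G_0$ factors through $H$ if and only if $t$ lifts to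 a morphism $T\to\mathcal G$; the lift is then unique. (b) The morphism $\mathcal G\to G$ is affine and an isomorphism over $S\setminus S_0$, and its restriction over $S_0$ factors through $H\subset G_0$. (1) If $G\to S$ is affine (resp. quasi-affine), then so is $\mathcal G\to S$. (2) If $G$ is $S_0$-regular, $G\to S$ is locally of finite presentation (resp. of finite presentation) and $H\subset G_0$ is regular, then $\mathcal G\to S$ is locally of finite presentation (resp. of finite presentation). (3) If $G$ is $S_0$-regular, $H\subset G_0$ is regular and $H\to S_0$ has connected fibres, then $\mathcal G\times_S S_0\to S_0$ has connected fibres. (4) Assume that $G\to S$ is flat and that one of the following holds: (i) $H\subset G_0$ is regular, $H\to S_0$ is flat, and $S$ and $G$ are locally noetherian; (ii) $H\subset G_0$ is regular, $H\to S_0$ is flat, and $G\to S$ is locally of finite presentation; (iii) all local rings of $S$ are valuation rings. Then $\mathcal G\to S$ is flat. (5) If $G\to S$ and $H\to S_0$ are smooth, then $\mathcal G\to S$ is smooth. (6) Assume that $\mathcal G\to S$ is flat, and let $S'\to S$ be a scheme such that $S_0':=S'\times_S S_0$ is an effective Cartier divisor on $S'$. Then the base change $\mathcal G\times_S S'\to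 G\times_S S'$ is isomorphic, over $G\times_S S'$, to the Néron blowup of $G\times_S S'$ in $H\times_{S_0}S_0'$ along $S_0'$. (7) If $\mathcal G\to S$ is flat (in particular in cases (4) and (5)), then $\mathcal G$ carries a structure of group scheme over $S$ such that $\mathcal G\to G$ is a homomorphism of $S$-group schemes. -/

import Mathlib

open CategoryTheory Limits AlgebraicGeometry
open scoped Obj

universe u

namespace NeronBlowup

section Ring

variable {A R A' R' : Type*} [CommRing A] [CommRing R] [CommRing A'] [CommRing R']

/-- Let `J ≤ I` be ideals of `A` and `φ : A → R` a ring map. This is the subring of all `f` in `R`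
such that, for some `n`, every `a ∈ J ^ n` satisfies `a * f ∈ I ^ n` (in `R`).
If `J` is generated by `b` and `R = A[1/b]`, it consists of the fractions `x / b ^ n` with
`x ∈ I ^ n` (see `mem_affineBlowupSubring_span`), that is, it is the affine blowup algebra
`A[I/b]`. The formulation through all elements of `J ^ n` does not depend on a generator, and it
also applies when `J` is only locally principal. -/
def affineBlowupSubring (φ : A →+* R) (I J : Ideal A) (h : J ≤ I) : Subring R where
  carrier := {f | ∃ n : ℕ, ∀ a ∈ J ^ n, ∃ c ∈ I ^ n, φ c = φ a * f}
  zero_mem' := ⟨0, fun _ _ ↦ ⟨0, by simp, by simp⟩⟩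
  one_mem' := ⟨0, fun a _ ↦ ⟨a, by simp, by simp⟩⟩
  neg_mem' := by
    rintro f ⟨n, hn⟩
    refine ⟨n, fun a ha ↦ ?_⟩
    obtain ⟨c, hc, e⟩ := hn a ha
    exact ⟨-c, neg_mem hc, by simp [e]⟩
  add_mem' := by
    rintro f g ⟨n, hn⟩ ⟨m, hm⟩
    refine ⟨n + m, fun a ha ↦ ?_⟩
    rw [pow_add] at ha
    refine Submodule.mul_induction_on ha (fun x hx y hy ↦ ?_) ?_
    · obtain ⟨c, hc, ec⟩ := hn x hx
      obtain ⟨d, hd, ed⟩ := hm y hy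
      refine ⟨c * y + x * d, ?_, by simp [ec, ed]; ring⟩
      rw [pow_add]
      exact add_mem (Ideal.mul_mem_mul hc (Ideal.pow_right_mono h m hy))
        (Ideal.mul_mem_mul (Ideal.pow_right_mono h n hx) hd)
    · rintro x y ⟨c, hc, ec⟩ ⟨d, hd, ed⟩
      exact ⟨c + d, add_mem hc hd, by simp only [map_add, ec, ed]; ring⟩
  mul_mem' := by
    rintro f g ⟨n, hn⟩ ⟨m, hm⟩
    refine ⟨n + m, fun a ha ↦ ?_⟩
    rw [pow_add] at ha
    refine Submodule.mul_induction_on ha (fun x hx y hy ↦ ?_) ?_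
    · obtain ⟨c, hc, ec⟩ := hn x hx
      obtain ⟨d, hd, ed⟩ := hm y hy
      refine ⟨c * d, ?_, by simp [ec, ed]; ring⟩
      rw [pow_add]
      exact Ideal.mul_mem_mul hc hd
    · rintro x y ⟨c, hc, ec⟩ ⟨d, hd, ed⟩
      exact ⟨c + d, add_mem hc hd, by simp only [map_add, ec, ed]; ring⟩

lemma map_mem_affineBlowupSubring (φ : A →+* R) (I J : Ideal A) (h : J ≤ I) (a : A) :
    φ a ∈ affineBlowupSubring φ I J h :=
  ⟨0, fun b _ ↦ ⟨b * a, by simp, by simp⟩⟩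

/-- For `J = (b)` the elements of the affine blowup algebra are the fractions `x / b ^ n` with
`x ∈ I ^ n`. -/
lemma mem_affineBlowupSubring_span {φ : A →+* R} {I : Ideal A} {b : A} (h : Ideal.span {b} ≤ I)
    {f : R} : f ∈ affineBlowupSubring φ I (Ideal.span {b}) h ↔
      ∃ n : ℕ, ∃ x ∈ I ^ n, φ x = φ b ^ n * f := by
  refine exists_congr fun n ↦ ⟨fun H ↦ ?_, ?_⟩
  · obtain ⟨c, hc, e⟩ := H (b ^ n) (Ideal.pow_mem_pow (Ideal.mem_span_singleton_self b) n)
    exact ⟨c, hc, by simpa using e⟩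
  · rintro ⟨x, hx, e⟩ a ha
    rw [Ideal.span_singleton_pow, Ideal.mem_span_singleton] at ha
    obtain ⟨a, rfl⟩ := ha
    exact ⟨x * a, Ideal.mul_mem_right _ _ hx, by simp only [map_mul, map_pow, e]; ring⟩

lemma map_mem_affineBlowupSubring_of_comp {φ : A →+* R} {φ' : A' →+* R'} {α : A →+* A'}
    {β : R →+* R'} (comm : φ'.comp α = β.comp φ) {I J : Ideal A} (h : J ≤ I)
    {I' J' : Ideal A'} (h' : J' ≤ I') (hI : I.map α ≤ I') (hJ : J' ≤ J.map α) {f : R}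
    (hf : f ∈ affineBlowupSubring φ I J h) : β f ∈ affineBlowupSubring φ' I' J' h' := by
  obtain ⟨n, hn⟩ := hf
  refine ⟨n, fun a ha ↦ ?_⟩
  have comm' (x) : φ' (α x) = β (φ x) := DFunLike.congr_fun comm x
  replace ha := Ideal.pow_right_mono hJ n ha
  rw [← Ideal.map_pow, Ideal.map] at ha
  refine Submodule.span_induction ?_ ⟨0, by simp, by simp⟩ ?_ ?_ ha
  · rintro _ ⟨x, hx, rfl⟩
    obtain ⟨c, hc, e⟩ := hn x hx
    refine ⟨α c, Ideal.pow_right_mono hI n ?_, by simp [comm', e]⟩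
    rw [← Ideal.map_pow]
    exact Ideal.mem_map_of_mem α hc
  · rintro x y - - ⟨c, hc, ec⟩ ⟨d, hd, ed⟩
    exact ⟨c + d, add_mem hc hd, by simp only [map_add, ec, ed]; ring⟩
  · rintro s x - ⟨c, hc, ec⟩
    exact ⟨s * c, Ideal.mul_mem_left _ _ hc, by simp only [smul_eq_mul, map_mul, ec]; ring⟩

lemma exists_mem_affineBlowupSubring [Algebra A A'] [Algebra R R'] {φ : A →+* R} {φ' : A' →+* R'}
    (r : A) [IsLocalization.Away r A'] [IsLocalization.Away (φ r) R']
    (comm : φ'.comp (algebraMap A A') = (algebraMap R R').comp φ) {I J : Ideal A} (h : J ≤ I)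
    (hJ : J.FG)
    {I' J' : Ideal A'} (h' : J' ≤ I') (hI' : I' = I.map (algebraMap A A'))
    (hJ' : J' = J.map (algebraMap A A')) {f' : R'}
    (hf : f' ∈ affineBlowupSubring φ' I' J' h') :
    ∃ k : ℕ, ∃ f ∈ affineBlowupSubring φ I J h,
      f' * algebraMap R R' (φ r) ^ k = algebraMap R R' f := by
  have comm' (x) : φ' (algebraMap A A' x) = algebraMap R R' (φ x) := DFunLike.congr_fun comm x
  obtain ⟨n, hn⟩ := hf
  obtain ⟨⟨g, _, k, rfl⟩, hg⟩ := IsLocalization.surj (Submonoid.powers (φ r)) f'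
  simp only [map_pow] at hg
  -- it suffices to multiply by a further power of `r`, chosen for finitely many generators
  obtain ⟨s, hs⟩ := hJ.pow (n := n)
  have key : ∀ a ∈ s, ∃ N : ℕ, ∃ c ∈ I ^ n, φ c = φ a * (φ r ^ N * g) := by
    intro a ha
    have haJ : a ∈ J ^ n := hs ▸ Ideal.subset_span ha
    obtain ⟨c', hc', e⟩ := hn (algebraMap A A' a) (by
      rw [hJ', ← Ideal.map_pow]; exact Ideal.mem_map_of_mem _ haJ)
    rw [hI', ← Ideal.map_pow, IsLocalization.mem_map_algebraMap_iff (Submonoid.powers r)] at hc'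
    obtain ⟨⟨⟨c, hc⟩, ⟨_, m, rfl⟩⟩, hcm⟩ := hc'
    simp only [map_pow] at hcm
    have : algebraMap R R' (φ r ^ k * φ c) = algebraMap R R' (φ r ^ m * (φ a * g)) := by
      simp only [map_mul, map_pow, ← comm', ← hcm, e, ← hg]
      ring
    obtain ⟨⟨_, l, rfl⟩, hl⟩ := (IsLocalization.eq_iff_exists (Submonoid.powers (φ r)) R').mp this
    refine ⟨l + m, r ^ (l + k) * c, Ideal.mul_mem_left _ _ hc, ?_⟩
    simp only [map_mul, map_pow] at hl ⊢
    linear_combination hl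
  choose! N hN using key
  refine ⟨k + s.sup N, φ r ^ s.sup N * g, ⟨n, fun a ha ↦ ?_⟩, ?_⟩
  · rw [← hs] at ha
    refine Submodule.span_induction ?_ ⟨0, by simp, by simp⟩ ?_ ?_ ha
    · intro a ha
      obtain ⟨c, hc, e⟩ := hN a ha
      refine ⟨r ^ (s.sup N - N a) * c, Ideal.mul_mem_left _ _ hc, ?_⟩
      conv_rhs => rw [← Nat.sub_add_cancel (Finset.le_sup ha : N a ≤ s.sup N)]
      simp only [map_mul, map_pow, e]
      ring
    · rintro x y - - ⟨c, hc, ec⟩ ⟨d, hd, ed⟩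
      exact ⟨c + d, add_mem hc hd, by simp only [map_add, ec, ed]; ring⟩
    · rintro s x - ⟨c, hc, ec⟩
      exact ⟨s * c, Ideal.mul_mem_left _ _ hc, by simp only [smul_eq_mul, map_mul, ec]; ring⟩
  · simp only [map_mul, map_pow, ← hg]
    ring



lemma isLocalization_affineBlowupSubring [Algebra A A'] [Algebra R R'] {φ : A →+* R}
    {φ' : A' →+* R'} (r : A) [IsLocalization.Away r A'] [IsLocalization.Away (φ r) R']
    (comm : φ'.comp (algebraMap A A') = (algebraMap R R').comp φ) {I J : Ideal A} (h : J ≤ I)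
    (hJ : J.FG) {I' J' : Ideal A'} (h' : J' ≤ I') (hI' : I' = I.map (algebraMap A A'))
    (hJ' : J' = J.map (algebraMap A A'))
    (ψ : affineBlowupSubring φ I J h →+* affineBlowupSubring φ' I' J' h')
    (hψ : ∀ f, (ψ f : R') = algebraMap R R' f) :
    letI := ψ.toAlgebra
    IsLocalization.Away (⟨φ r, map_mem_affineBlowupSubring φ I J h r⟩ :
      affineBlowupSubring φ I J h) (affineBlowupSubring φ' I' J' h') := by
  let := ψ.toAlgebra
  have comm' (x) : φ' (algebraMap A A' x) = algebraMap R R' (φ x) := DFunLike.congr_fun comm x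
  refine ⟨⟨?_, ?_, ?_⟩⟩
  · rintro ⟨_, n, rfl⟩
    rw [map_pow]
    refine IsUnit.pow n ?_
    obtain ⟨u, hu⟩ := isUnit_iff_exists_inv.mp
      (IsLocalization.Away.algebraMap_isUnit (S := A') r)
    refine isUnit_iff_exists_inv.mpr
      ⟨⟨φ' u, map_mem_affineBlowupSubring φ' I' J' h' u⟩, Subtype.ext ?_⟩
    change (ψ _ : R') * φ' u = 1
    rw [hψ]
    change algebraMap R R' (φ r) * φ' u = 1
    rw [← comm', ← map_mul, hu, map_one]
  · rintro ⟨f', hf'⟩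
    obtain ⟨k, f, hf, e⟩ := exists_mem_affineBlowupSubring r comm h hJ h' hI' hJ' hf'
    refine ⟨⟨⟨f, hf⟩, ⟨_, k, rfl⟩⟩, Subtype.ext ?_⟩
    change f' * (ψ _ : R') = (ψ _ : R')
    rw [hψ, hψ, ← e]
    simp
  · rintro ⟨f, hf⟩ ⟨g, hg⟩ e
    replace e : (ψ ⟨f, hf⟩ : R') = ψ ⟨g, hg⟩ := congr_arg Subtype.val e
    rw [hψ, hψ] at e
    obtain ⟨⟨_, n, rfl⟩, hn⟩ := (IsLocalization.eq_iff_exists (Submonoid.powers (φ r)) R').mp e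
    exact ⟨⟨_, n, rfl⟩, Subtype.ext (by simpa using hn)⟩

lemma map_localizationAway_fg [Algebra A A'] (r : A) [IsLocalization.Away r A'] {I : Ideal A}
    (h : (I.map (algebraMap A A')).FG) : (I.map (algebraMap A (Localization.Away r))).FG := by
  let e := IsLocalization.algEquiv (Submonoid.powers r) A' (Localization.Away r)
  have h1 : I.map (algebraMap A (Localization.Away r)) =
      (I.map (algebraMap A A')).map e.toAlgHom.toRingHom := by
    rw [Ideal.map_map]
    congr 1
    exact e.toAlgHom.comp_algebraMap.symm
  rw [h1]
  exact h.map _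

end Ring

section Schemes

variable {X Y : Scheme.{u}}

/-- An ideal sheaf is locally principal: every point has an affine open neighbourhood on which the
ideal is generated by one section. -/
def IsLocallyPrincipal (J : X.IdealSheafData) : Prop :=
  ∀ x : X, ∃ U : X.affineOpens, x ∈ U.1 ∧ ∃ b : Γ(X, U.1), J.ideal U = Ideal.span {b}

/-- A closed immersion `i : Z ⟶ X` is (the inclusion of) an effective Cartier divisor: locally on
`X`, the ideal of `Z` is generated by one nonzerodivisor. The divisor may be empty. -/
def IsEffectiveCartierDivisor {Z : Scheme.{u}} (i : Z ⟶ X) [IsClosedImmersion i] : Prop :=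
  ∀ x : X, ∃ U : X.affineOpens, x ∈ U.1 ∧
    ∃ b ∈ nonZeroDivisors Γ(X, U.1), i.ker.ideal U = Ideal.span {b}

lemma IsEffectiveCartierDivisor.isLocallyPrincipal {Z : Scheme.{u}} {i : Z ⟶ X} [IsClosedImmersion i]
    (h : IsEffectiveCartierDivisor i) : IsLocallyPrincipal i.ker := fun x ↦
  let ⟨U, hx, b, _, hb⟩ := h x
  ⟨U, hx, b, hb⟩

lemma IsLocallyPrincipal.fg {J : X.IdealSheafData} (hJ : IsLocallyPrincipal J)
    (U : X.affineOpens) : (J.ideal U).FG := by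
  have key : ∀ x : U.1, ∃ r : Γ(X, U.1), x.1 ∈ X.basicOpen r ∧
      (J.ideal (X.affineBasicOpen r)).FG := by
    rintro ⟨x, hx⟩
    obtain ⟨V, hxV, b, hb⟩ := hJ x
    obtain ⟨r, g, e, hxr⟩ := exists_basicOpen_le_affine_inter U.2 V.2 x ⟨hx, hxV⟩
    refine ⟨r, hxr, ?_⟩
    have hle : X.affineBasicOpen r ≤ V := e.trans_le (X.basicOpen_le g)
    rw [← J.map_ideal hle, hb]
    exact Ideal.FG.map ⟨{b}, by simp⟩ _
  choose r hr hfg using key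
  have hspan : Ideal.span (Set.range r) = ⊤ := by
    rw [← U.2.self_le_iSup_basicOpen_iff]
    exact fun x hx ↦ TopologicalSpace.Opens.mem_iSup.mpr ⟨⟨_, _, rfl⟩, hr ⟨x, hx⟩⟩
  refine Ideal.fg_of_localizationSpan _ hspan ?_
  rintro ⟨_, x, rfl⟩
  have := U.2.isLocalization_basicOpen (r x)
  refine map_localizationAway_fg (A' := Γ(X, X.basicOpen (r x))) (r x) ?_
  have h := hfg x
  rwa [← J.map_ideal_basicOpen] at h

/-- The open complement of a closed subscheme. -/
def complement (J : X.IdealSheafData) : X.Opens := J.support.compl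

lemma inf_complement_eq_iUnion {J : X.IdealSheafData} (U : X.affineOpens)
    {s : Finset Γ(X, U.1)} (hs : Ideal.span (s : Set Γ(X, U.1)) = J.ideal U) :
    ((U.1 ⊓ complement J : X.Opens) : Set X) = ⋃ a ∈ s, (X.basicOpen a : Set X) := by
  ext x
  by_cases hx : x ∈ U.1
  · have h1 : x ∈ J.support ↔ x ∈ X.zeroLocus (U := U.1) (J.ideal U) :=
      J.mem_support_iff_of_mem hx
    have h2 : X.zeroLocus (U := U.1) (J.ideal U : Set Γ(X, U.1)) =
        X.zeroLocus (U := U.1) (s : Set Γ(X, U.1)) := by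
      rw [← hs, Scheme.zeroLocus_span]
    rw [h2] at h1
    simp only [Scheme.mem_zeroLocus_iff] at h1
    change (x ∈ U.1 ∧ ¬ x ∈ J.support) ↔ _
    rw [h1]
    simp [hx]
  · have h1 : ∀ a ∈ s, x ∉ X.basicOpen a := fun a _ h ↦ hx (X.basicOpen_le a h)
    change (x ∈ U.1 ∧ ¬ x ∈ J.support) ↔ _
    simp only [hx, false_and, Set.mem_iUnion, SetLike.mem_coe, exists_prop, false_iff, not_exists,
      not_and]
    exact h1

lemma isCompact_inf_complement {J : X.IdealSheafData} (U : X.affineOpens) (hJ : (J.ideal U).FG) :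
    IsCompact ((U.1 ⊓ complement J : X.Opens) : Set X) := by
  obtain ⟨s, hs⟩ := hJ
  rw [inf_complement_eq_iUnion U hs]
  exact s.isCompact_biUnion fun a _ ↦ (U.2.basicOpen a).isCompact

/-- Restriction of sections, as a ring homomorphism. -/
noncomputable def res {U V : X.Opens} (h : V ≤ U) : Γ(X, U) →+* Γ(X, V) :=
  (X.presheaf.map (homOfLE h).op).hom

lemma res_res {U V W : X.Opens} (h : V ≤ U) (h' : W ≤ V) (x : Γ(X, U)) :
    res h' (res h x) = res (h'.trans h) x := by
  simp only [res, ← CommRingCat.comp_apply, ← X.presheaf.map_comp, ← op_comp, homOfLE_comp]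

lemma res_refl {U : X.Opens} (x : Γ(X, U)) : res le_rfl x = x := by
  change X.presheaf.map (𝟙 _) x = x
  simp

/-- Restriction from an open `U` to the part of `U` away from the closed subscheme `V(J)`. -/
noncomputable abbrev resComplement (J : X.IdealSheafData) (U : X.Opens) :
    Γ(X, U) →+* Γ(X, U ⊓ complement J) :=
  res inf_le_left

lemma isLocalization_inf_complement {J : X.IdealSheafData} (U : X.affineOpens)
    (hJ : (J.ideal U).FG) (r : Γ(X, U.1)) :
    letI := (res (inf_le_inf_right (complement J) (X.basicOpen_le r))).toAlgebra
    IsLocalization.Away (resComplement J U.1 r) Γ(X, X.basicOpen r ⊓ complement J) := by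
  have hle : U.1 ⊓ complement J ≤ U.1 := inf_le_left
  have h := isLocalization_basicOpen_of_qcqs (isCompact_inf_complement U hJ)
    (U.2.isQuasiSeparated.of_subset hle) (res hle r)
  have e : X.basicOpen (res hle r) = X.basicOpen r ⊓ complement J := by
    have : X.basicOpen (res hle r) = (U.1 ⊓ complement J) ⊓ X.basicOpen r :=
      Scheme.basicOpen_res X r (homOfLE hle).op
    rw [this]
    apply le_antisymm
    · exact le_inf inf_le_right (inf_le_left.trans inf_le_right)
    · exact le_inf (inf_le_inf_right _ (X.basicOpen_le r)) inf_le_left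
  have key : ∀ (W : X.Opens) (i : W ≤ U.1 ⊓ complement J) (_ : X.basicOpen (res hle r) = W),
      letI := (res i).toAlgebra
      IsLocalization.Away (res hle r) Γ(X, W) := by
    rintro W i rfl
    exact h
  exact key _ _ e

/-- The ring of sections over an affine open `U` of the affine blowup algebra of `𝒪_X` in `I`
along `J`, as a subring of the ring of sections over the complement of `V(J)` in `U`. -/
noncomputable def affineBlowupSections (I J : X.IdealSheafData) (h : J ≤ I) (U : X.affineOpens) :
    Subring Γ(X, U.1 ⊓ complement J) :=
  affineBlowupSubring (resComplement J U.1) (I.ideal U) (J.ideal U) (h U)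

lemma res_mem_affineBlowupSections {I J : X.IdealSheafData} {h : J ≤ I} {U V : X.affineOpens}
    (hUV : V ≤ U) (f : Γ(X, U.1 ⊓ complement J)) (hf : f ∈ affineBlowupSections I J h U) :
    res (inf_le_inf_right (complement J) hUV) f ∈ affineBlowupSections I J h V := by
  refine map_mem_affineBlowupSubring_of_comp (α := res hUV)
    (β := res (inf_le_inf_right (complement J) hUV)) ?_
    (h U) (h V) (I.map_ideal hUV).le (J.map_ideal hUV).ge hf
  ext x
  simp only [RingHom.comp_apply, res_res]

lemma mem_affineBlowupSections_iff {I J : X.IdealSheafData} {h : J ≤ I} {U : X.affineOpens}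
    {b : Γ(X, U.1)} (hb : J.ideal U = Ideal.span {b}) {f : Γ(X, U.1 ⊓ complement J)} :
    f ∈ affineBlowupSections I J h U ↔
      ∃ n : ℕ, ∃ x ∈ I.ideal U ^ n, resComplement J U.1 x = resComplement J U.1 b ^ n * f := by
  rw [← mem_affineBlowupSubring_span (hb ▸ h U)]
  simp only [affineBlowupSections, hb]

lemma inf_complement_eq_basicOpen {J : X.IdealSheafData} {U : X.affineOpens} {b : Γ(X, U.1)}
    (hb : J.ideal U = Ideal.span {b}) : U.1 ⊓ complement J = X.basicOpen b := by
  ext x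
  have := congr($(inf_complement_eq_iUnion U (s := {b}) (by simpa using hb.symm)))
  simp [this]

/-- The affine blowup algebra of `𝒪_X` in `I` along `J`, on the affine opens of `X`. -/
noncomputable def affineBlowupAlgebra (I J : X.IdealSheafData) (h : J ≤ I) :
    X.AffineZariskiSiteᵒᵖ ⥤ CommRingCat.{u} where
  obj U := .of (affineBlowupSections I J h U.unop)
  map {U V} i := CommRingCat.ofHom ((res (inf_le_inf_right (complement J)
    (Scheme.AffineZariskiSite.toOpens_mono i.unop.le))).restrict
      (affineBlowupSections I J h U.unop) (affineBlowupSections I J h V.unop)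
      (res_mem_affineBlowupSections (Scheme.AffineZariskiSite.toOpens_mono i.unop.le)))
  map_id U := by
    refine CommRingCat.hom_ext (RingHom.ext fun x ↦ Subtype.ext ?_)
    exact res_refl _
  map_comp {U V W} i j := by
    refine CommRingCat.hom_ext (RingHom.ext fun x ↦ Subtype.ext ?_)
    exact (res_res _ _ _).symm

/-- The structure map of the affine blowup algebra. -/
noncomputable def toAffineBlowupAlgebra (I J : X.IdealSheafData) (h : J ≤ I) :
    (Scheme.AffineZariskiSite.toOpensFunctor X).op ⋙ X.presheaf ⟶ affineBlowupAlgebra I J h where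
  app U := CommRingCat.ofHom ((resComplement J U.unop.1).codRestrict
    (affineBlowupSections I J h U.unop) fun a ↦ map_mem_affineBlowupSubring _ _ _ _ a)
  naturality {U V} i := by
    refine CommRingCat.hom_ext (RingHom.ext fun x ↦ Subtype.ext ?_)
    exact (res_res (Scheme.AffineZariskiSite.toOpens_mono i.unop.le) _ x).trans
      (res_res _ _ x).symm

lemma coequifibered_toAffineBlowupAlgebra {I J : X.IdealSheafData} (h : J ≤ I)
    (hJ : IsLocallyPrincipal J) : (toAffineBlowupAlgebra I J h).Coequifibered := by
  rw [Scheme.AffineZariskiSite.coequifibered_iff_forall_isLocalizationAway]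
  intro U r
  let U' : X.affineOpens := U
  let : Algebra Γ(X, U.1 ⊓ complement J) Γ(X, X.basicOpen r ⊓ complement J) :=
    (res (inf_le_inf_right (complement J) (X.basicOpen_le r))).toAlgebra
  have h1 := U.2.isLocalization_basicOpen r
  have h2 : IsLocalization.Away (resComplement J U.1 r) Γ(X, X.basicOpen r ⊓ complement J) :=
    isLocalization_inf_complement U' (hJ.fg U') r
  refine isLocalization_affineBlowupSubring (A := Γ(X, U.1)) (A' := Γ(X, X.basicOpen r))
    (R := Γ(X, U.1 ⊓ complement J)) (R' := Γ(X, X.basicOpen r ⊓ complement J))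
    (φ := resComplement J U.1) (φ' := resComplement J (X.basicOpen r))
    (I := I.ideal U') (J := J.ideal U') (I' := I.ideal (X.affineBasicOpen r))
    (J' := J.ideal (X.affineBasicOpen r)) r ?_ (h U') (hJ.fg U') (h _)
    (I.map_ideal_basicOpen U' r).symm (J.map_ideal_basicOpen U' r).symm
    ((affineBlowupAlgebra I J h).map (homOfLE (U.basicOpen_le r)).op).hom fun _ ↦ rfl
  ext x
  exact (res_res (X.basicOpen_le r) _ x).trans (res_res _ _ x).symm

/-- The dilatation (affine blowup) of `X` in `Z = V(I)` along the locally principal closed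
subscheme `D = V(J)`: the relative spectrum over `X` of the affine blowup algebra. -/
noncomputable def dilatation (I J : X.IdealSheafData) (h : J ≤ I) (hJ : IsLocallyPrincipal J) :
    Scheme.{u} :=
  (Scheme.AffineZariskiSite.relativeGluingData (coequifibered_toAffineBlowupAlgebra h hJ)).glued

/-- The structure morphism from the dilatation to `X`. -/
noncomputable def dilatationHom (I J : X.IdealSheafData) (h : J ≤ I) (hJ : IsLocallyPrincipal J) :
    dilatation I J h hJ ⟶ X :=
  (Scheme.AffineZariskiSite.relativeGluingData (coequifibered_toAffineBlowupAlgebra h hJ)).toBase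


lemma ideal_comap_top_of_isAffine [IsAffine X] [IsAffine Y] (f : X ⟶ Y) (K : Y.IdealSheafData) :
    (K.comap f).ideal ⟨⊤, isAffineOpen_top X⟩ =
      (K.ideal ⟨⊤, isAffineOpen_top Y⟩).map f.appTop.hom := by
  apply le_antisymm
  · let L : X.IdealSheafData :=
      .ofIdealTop ((K.ideal ⟨⊤, isAffineOpen_top Y⟩).map f.appTop.hom)
    have hL : L.ideal ⟨⊤, isAffineOpen_top X⟩ =
      (K.ideal ⟨⊤, isAffineOpen_top Y⟩).map f.appTop.hom := by simp [L]
    rw [← hL]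
    refine Scheme.IdealSheafData.le_map_iff_comap_le.mp
      (Scheme.IdealSheafData.le_of_isAffine ?_) _
    rw [Scheme.IdealSheafData.ideal_map_of_isAffineHom]
    refine Ideal.map_le_iff_le_comap.mp ?_
    exact hL.ge
  · rw [Ideal.map_le_iff_le_comap]
    refine (Scheme.IdealSheafData.le_map_comap K f _).trans ?_
    rw [Scheme.IdealSheafData.ideal_map_of_isAffineHom]
    exact le_rfl

lemma isLocallyPrincipal_of_isOpenImmersion {J : X.IdealSheafData}
    (H : ∀ x : X, ∃ (U : Scheme.{u}) (_ : IsAffine U) (i : U ⟶ X) (_ : IsOpenImmersion i)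
      (b : Γ(U, ⊤)), x ∈ Set.range i ∧
      (J.comap i).ideal ⟨⊤, isAffineOpen_top U⟩ = Ideal.span {b}) : IsLocallyPrincipal J := by
  intro x
  obtain ⟨U, _, i, _, b, hx, hb⟩ := H x
  refine ⟨⟨i ''ᵁ ⊤, (isAffineOpen_top U).image_of_isOpenImmersion i⟩, ?_,
    (i.appIso ⊤).inv.hom b, ?_⟩
  · obtain ⟨y, rfl⟩ := hx
    exact ⟨y, trivial, rfl⟩
  · rw [Scheme.IdealSheafData.ideal_comap_of_isOpenImmersion] at hb
    have hs : Function.Surjective (i.appIso ⊤).inv.hom :=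
      (i.appIso ⊤).symm.commRingCatIsoToRingEquiv.surjective
    have h1 := Ideal.map_comap_of_surjective _ hs
      (J.ideal ⟨i ''ᵁ ⊤, (isAffineOpen_top U).image_of_isOpenImmersion i⟩)
    rw [hb, Ideal.map_span, Set.image_singleton] at h1
    exact h1.symm

lemma IsLocallyPrincipal.comap {K : Y.IdealSheafData} (hK : IsLocallyPrincipal K) (f : X ⟶ Y) :
    IsLocallyPrincipal (K.comap f) := by
  refine isLocallyPrincipal_of_isOpenImmersion fun x ↦ ?_
  obtain ⟨V, hxV, b, hb⟩ := hK (f x)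
  obtain ⟨U, hU, hxU, e⟩ : ∃ U : X.Opens, IsAffineOpen U ∧ x ∈ U ∧ U ≤ f ⁻¹ᵁ V.1 := by
    obtain ⟨_, ⟨U, hU, rfl⟩, hxU, hUV⟩ := X.isBasis_affineOpens.exists_subset_of_mem_open (show x ∈ (f ⁻¹ᵁ V.1 : Set X) from hxV)
      (f ⁻¹ᵁ V.1).2
    exact ⟨U, hU, hxU, hUV⟩
  have : IsAffine V.1.toScheme := V.2
  have : IsAffine U.toScheme := hU
  have h1 : (K.comap V.1.ι).ideal ⟨⊤, isAffineOpen_top V.1.toScheme⟩ =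
      Ideal.span {(V.1.ι.appIso ⊤).hom.hom (res (Scheme.Opens.ι_image_top _).le b)} := by
    rw [Scheme.IdealSheafData.ideal_comap_of_isOpenImmersion]
    have h2 := K.map_ideal (U := ⟨V.1.ι ''ᵁ ⊤,
      (isAffineOpen_top V.1.toScheme).image_of_isOpenImmersion V.1.ι⟩) (V := V)
      (Scheme.Opens.ι_image_top _).le
    rw [← h2, hb, Ideal.map_span, Set.image_singleton]
    have := Ideal.map_symm (V.1.ι.appIso ⊤).symm.commRingCatIsoToRingEquiv
      (I := Ideal.span {(res (Scheme.Opens.ι_image_top V.1).le b)})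
    rw [Ideal.map_span, Set.image_singleton] at this
    exact this.symm
  refine ⟨U, hU, U.ι, inferInstance,
    (f.resLE V.1 U e).appTop.hom
      ((V.1.ι.appIso ⊤).hom.hom (res (Scheme.Opens.ι_image_top _).le b)), ?_, ?_⟩
  · simpa using hxU
  · rw [← Scheme.IdealSheafData.comap_comp, ← Scheme.Hom.resLE_comp_ι f e,
      Scheme.IdealSheafData.comap_comp, ideal_comap_top_of_isAffine, h1, Ideal.map_span,
      Set.image_singleton]

/-- A closed immersion `i : Z ⟶ X` is regular: around every point of `Z`, the ideal of `Z` in `X`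
is generated by a regular sequence. -/
def IsRegularImmersion {Z : Scheme.{u}} (i : Z ⟶ X) : Prop :=
  ∀ z : Z, ∃ U : X.affineOpens, i z ∈ U.1 ∧ ∃ rs : List Γ(X, U.1),
    RingTheory.Sequence.IsRegular Γ(X, U.1) rs ∧ i.ker.ideal U = Ideal.ofList rs

/-- A morphism is quasi-affine if preimages of affine opens are quasi-affine schemes. -/
def IsQuasiAffineHom (f : X ⟶ Y) : Prop :=
  ∀ U : Y.affineOpens, Scheme.IsQuasiAffine (f ⁻¹ᵁ U.1).toScheme

/-- Morphisms of finite presentation. -/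
def IsOfFinitePresentation (f : X ⟶ Y) : Prop :=
  LocallyOfFinitePresentation f ∧ QuasiCompact f ∧ QuasiSeparated f

/-- All scheme-theoretic fibres are connected (in particular non-empty). -/
def HasConnectedFibers (f : X ⟶ Y) : Prop :=
  ∀ y : Y, ConnectedSpace (f.fiber y)

end Schemes

section Neron

variable {S S₀ : Scheme.{u}} (j : S₀ ⟶ S)

/-- `T` belongs to the category of `S`-schemes such that `T ×_S S₀` is an effective Cartier
divisor on `T`. -/
def IsRegularOver [IsClosedImmersion j] (T : Over S) : Prop :=
  IsEffectiveCartierDivisor (pullback.fst T.hom j)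

/-- The ideal sheaf of the closed subscheme `G₀ = G ×_S S₀` of `G`. -/
noncomputable def divisorIdeal (G : Over S) : G.left.IdealSheafData :=
  (pullback.fst G.hom j).ker

variable {j}

/-- The ideal sheaf in `G` of a closed subscheme `i : H ⟶ G₀ = G ×_S S₀`. -/
noncomputable def centerIdeal {G : Over S} {H : Over S₀} (i : H ⟶ (Over.pullback j).obj G) :
    G.left.IdealSheafData :=
  (i.left ≫ pullback.fst G.hom j).ker

lemma divisorIdeal_le_centerIdeal {G : Over S} {H : Over S₀}
    (i : H ⟶ (Over.pullback j).obj G) : divisorIdeal j G ≤ centerIdeal i :=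
  Scheme.Hom.le_ker_comp i.left (pullback.fst G.hom j)

lemma isLocallyPrincipal_divisorIdeal [IsClosedImmersion j] (hj : IsLocallyPrincipal j.ker)
    (G : Over S) : IsLocallyPrincipal (divisorIdeal j G) := by
  rw [divisorIdeal, Scheme.IdealSheafData.ker_fst_of_isClosedImmersion]
  exact hj.comap G.hom

/-- The Néron blowup of `G` in the closed subscheme `i : H ⟶ G₀ = G ×_S S₀` along the locally
principal closed subscheme `j : S₀ ⟶ S`, as an `S`-scheme: the dilatation of `G` in `H`
along `G₀`. -/
noncomputable def neronBlowup [IsClosedImmersion j] (hj : IsLocallyPrincipal j.ker) {G : Over S}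
    {H : Over S₀} (i : H ⟶ (Over.pullback j).obj G) : Over S :=
  Over.mk (dilatationHom (centerIdeal i) (divisorIdeal j G) (divisorIdeal_le_centerIdeal i)
    (isLocallyPrincipal_divisorIdeal hj G) ≫ G.hom)

/-- The canonical morphism from the Néron blowup to `G`. -/
noncomputable def neronBlowupHom [IsClosedImmersion j] (hj : IsLocallyPrincipal j.ker) {G : Over S}
    {H : Over S₀} (i : H ⟶ (Over.pullback j).obj G) : neronBlowup hj i ⟶ G :=
  Over.homMk (dilatationHom (centerIdeal i) (divisorIdeal j G) (divisorIdeal_le_centerIdeal i)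
    (isLocallyPrincipal_divisorIdeal hj G))

/-- For `g : S' ⟶ S` and `S₀' = S' ×_S S₀`, the base change
`H ×_{S₀} S₀' ⟶ (G ×_S S') ×_{S'} S₀'` of `i : H ⟶ G ×_S S₀`; on points it is
`(h, t) ↦ ((i h, t), t)`. -/
noncomputable def baseChangeCenter {S' : Scheme.{u}} (g : S' ⟶ S) {G : Over S} {H : Over S₀}
    (i : H ⟶ (Over.pullback j).obj G) :
    (Over.pullback (pullback.snd g j)).obj H ⟶
      (Over.pullback (pullback.fst g j)).obj ((Over.pullback g).obj G) :=
  Over.homMk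
    (pullback.lift
      (pullback.lift
        (pullback.fst H.hom (pullback.snd g j) ≫ i.left ≫ pullback.fst G.hom j)
        (pullback.snd H.hom (pullback.snd g j) ≫ pullback.fst g j) (by
          have h : i.left ≫ pullback.snd G.hom j = H.hom := Over.w i
          rw [Category.assoc, Category.assoc, Category.assoc, pullback.condition,
            reassoc_of% h, pullback.condition_assoc, pullback.condition]))
      (pullback.snd H.hom (pullback.snd g j)) (pullback.lift_snd _ _ _))
    (pullback.lift_snd _ _ _)

end Neron

end NeronBlowup

open NeronBlowup

/-! On a chart the blowup is a ring `B' = B[I/b]`, determined by four properties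
(`IsAffineBlowupAlgebra`): `b` is regular on `B'`, `b` divides the image of `I`, every element is a
fraction `x / b ^ n` with `x ∈ I ^ n`, and the kernel of `B → B'` is `b`-power torsion. Hence a
`B`-algebra on which `b` is regular and divides `I` receives exactly one map from `B'`. Globally
(`IsDilatation`) a morphism `t : T ⟶ X` along which `J` pulls back to a Cartier ideal lifts,
uniquely, as soon as `I.comap t ≤ J.comap t`. By `exists_factorization_iff` this inequality says
that `t` restricted over `S₀` factors through `H`.

The formal statements follow from uniqueness and existence of lifts. Away from `S₀` the ideal `J` is
the unit ideal, so the inclusion of that open lifts and gives an inverse. For base change, both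
candidates are test objects for each other. For the group law, flat `S`-schemes are `S₀`-regular and
closed under products, so if `𝒢` is flat, the multiplication on `𝒢 × 𝒢` is a lift and the axioms are
uniqueness of lifts (`exists_grpObj_of_lift`).

The other statements rest on the presentation `B[y] / (x i - b * y i)` of `B'` (`BlowupModel`),
valid as soon as `b` is regular on this algebra. That holds when `b, x₁, …, xᵣ` is weakly regular,
because `b` can be moved to the end of the sequence. Modulo `b` the model is `(B / I)[y]`: the
blowup over `S₀` is locally an affine space over `H`. So connected fibres are inherited from `H`,
because the projection of an affine space is open with irreducible fibres. Flatness over `A` can be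
checked modulo the regular element `a`, where `B' / a = (B / I)[y]`, and after inverting it, where
`B'` becomes `B[1/a]`. Over valuation rings flatness is torsion-freeness, and `B'` inherits this
from `B`.

In the smooth case no regular sequence is used. A splitting given by formal smoothness of `H` and
Nakayama's lemma give `xᵢ` which, with `a`, generate `I` locally and have independent differentials
(`exists_generators_of_smooth`). Derivations dual to the `xᵢ` make the model formally smooth, hence
flat, hence `a` is regular on it and it is the blowup. -/

namespace NeronBlowup

/-! ### The affine blowup algebra: universal property and presentation. -/

section AffineBlowupAlgebra

variable {B : Type*} [CommRing B]

/-- `B'` is the affine blowup algebra `B[I/b]`, characterised intrinsically. -/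
structure IsAffineBlowupAlgebra (B' : Type*) [CommRing B'] [Algebra B B'] (I : Ideal B) (b : B) :
    Prop where
  mem_nonZeroDivisors : algebraMap B B' b ∈ nonZeroDivisors B'
  dvd : ∀ x ∈ I, algebraMap B B' b ∣ algebraMap B B' x
  exists_pow_mul : ∀ f : B', ∃ n, ∃ x ∈ I ^ n, algebraMap B B' x = algebraMap B B' b ^ n * f
  exists_pow_mul_eq_zero : ∀ x : B, algebraMap B B' x = 0 → ∃ n, b ^ n * x = 0

lemma pow_dvd_of_mem_pow {R : Type*} [CommRing R] [Algebra B R] {I : Ideal B} {b : B}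
    (h : ∀ x ∈ I, algebraMap B R b ∣ algebraMap B R x) (n : ℕ) {x : B} (hx : x ∈ I ^ n) :
    algebraMap B R b ^ n ∣ algebraMap B R x := by
  have h1 : I.map (algebraMap B R) ≤ Ideal.span {algebraMap B R b} :=
    Ideal.map_le_iff_le_comap.mpr fun x hx ↦ Ideal.mem_span_singleton.mpr (h x hx)
  have h2 := Ideal.pow_right_mono h1 n
  rw [← Ideal.map_pow, Ideal.span_singleton_pow] at h2
  exact Ideal.mem_span_singleton.mp (h2 (Ideal.mem_map_of_mem _ hx))

namespace IsAffineBlowupAlgebra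

variable {B' : Type*} [CommRing B'] [Algebra B B'] {I : Ideal B} {b : B}
  {R : Type*} [CommRing R] [Algebra B R]

lemma algHom_ext (h : IsAffineBlowupAlgebra B' I b) (hb : algebraMap B R b ∈ nonZeroDivisors R)
    (φ ψ : B' →ₐ[B] R) : φ = ψ := by
  ext f
  obtain ⟨n, x, -, e⟩ := h.exists_pow_mul f
  have h1 := congr(φ $e)
  have h2 := congr(ψ $e)
  simp only [map_mul, map_pow, AlgHom.commutes] at h1 h2
  exact (mul_cancel_left_mem_nonZeroDivisors (pow_mem hb n)).mp (h1.symm.trans h2)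

/-- The fraction `x / b ^ n` must go to the unique `r` with `b ^ n * r` the image of `x`. It exists
because `b` divides `I` in `R`; two representations of one fraction differ by `b`-power torsion,
which dies in `R`. -/
lemma nonempty_algHom (h : IsAffineBlowupAlgebra B' I b)
    (hb : algebraMap B R b ∈ nonZeroDivisors R)
    (hI : ∀ x ∈ I, algebraMap B R b ∣ algebraMap B R x) : Nonempty (B' →ₐ[B] R) := by
  have key (f : B') : ∃ r : R, ∀ (n : ℕ) (x : B), algebraMap B B' x = algebraMap B B' b ^ n * f →
      algebraMap B R x = algebraMap B R b ^ n * r := by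
    obtain ⟨n, x, hx, e⟩ := h.exists_pow_mul f
    obtain ⟨r, hr⟩ := pow_dvd_of_mem_pow hI n hx
    refine ⟨r, fun m y hy ↦ ?_⟩
    obtain ⟨k, hk⟩ := h.exists_pow_mul_eq_zero (b ^ m * x - b ^ n * y) (by
      simp only [map_sub, map_mul, map_pow, e, hy]; ring)
    have hk' := congr(algebraMap B R $hk)
    simp only [map_sub, map_mul, map_pow, map_zero, hr] at hk'
    rw [← mul_cancel_left_mem_nonZeroDivisors (pow_mem hb (k + n))]
    linear_combination -hk'
  choose g hg using key
  -- A single representation of `f` suffices to compute `g f`; all the ring axioms are then checked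
  -- on representations.
  have hg' (f : B') (r : R) (n : ℕ) (x : B) (e : algebraMap B B' x = algebraMap B B' b ^ n * f)
      (e' : algebraMap B R x = algebraMap B R b ^ n * r) : g f = r :=
    (mul_cancel_left_mem_nonZeroDivisors (pow_mem hb n)).mp ((hg f n x e).symm.trans e')
  refine ⟨AlgHom.mk ⟨⟨⟨g, ?_⟩, ?_⟩, ?_, ?_⟩ fun x ↦ ?_⟩
  · exact hg' _ _ 0 1 (by simp) (by simp)
  · intro f f'
    obtain ⟨n, x, -, e⟩ := h.exists_pow_mul f
    obtain ⟨m, y, -, e'⟩ := h.exists_pow_mul f'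
    refine hg' _ _ (n + m) (x * y) (by simp only [map_mul, e, e']; ring) ?_
    simp only [map_mul, hg _ _ _ e, hg _ _ _ e']
    ring
  · exact hg' _ _ 0 0 (by simp) (by simp)
  · intro f f'
    obtain ⟨n, x, -, e⟩ := h.exists_pow_mul f
    obtain ⟨m, y, -, e'⟩ := h.exists_pow_mul f'
    refine hg' _ _ (n + m) (b ^ m * x + b ^ n * y)
      (by simp only [map_mul, map_add, map_pow, e, e']; ring) ?_
    simp only [map_mul, map_add, map_pow, hg _ _ _ e, hg _ _ _ e']
    ring
  · exact hg' _ _ 0 x (by simp) (by simp)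

/-- Two affine blowup algebras of the same center are isomorphic. -/
lemma nonempty_algEquiv (h : IsAffineBlowupAlgebra B' I b) (h' : IsAffineBlowupAlgebra R I b) :
    Nonempty (B' ≃ₐ[B] R) := by
  obtain ⟨φ⟩ := h.nonempty_algHom h'.mem_nonZeroDivisors h'.dvd
  obtain ⟨ψ⟩ := h'.nonempty_algHom h.mem_nonZeroDivisors h.dvd
  exact ⟨AlgEquiv.ofAlgHom φ ψ (h'.algHom_ext h'.mem_nonZeroDivisors _ _)
    (h.algHom_ext h.mem_nonZeroDivisors _ _)⟩

/-- The blowup does not change the complement of the divisor: `B'[1/b] = B[1/b]`. -/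
lemma isLocalizationAway_map (h : IsAffineBlowupAlgebra B' I b) {L : Type*} [CommRing L]
    [Algebra B' L] [Algebra B L] [IsScalarTower B B' L]
    [IsLocalization.Away (algebraMap B B' b) L] : IsLocalization.Away b L := by
  refine ⟨⟨?_, fun z ↦ ?_, fun {x y} e ↦ ?_⟩⟩
  · rintro ⟨_, n, rfl⟩
    simp only [map_pow, IsScalarTower.algebraMap_apply B B' L]
    exact (IsLocalization.Away.algebraMap_isUnit (algebraMap B B' b)).pow n
  · obtain ⟨⟨f, _, k, rfl⟩, hf⟩ := IsLocalization.surj (Submonoid.powers (algebraMap B B' b)) z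
    obtain ⟨n, x, -, e⟩ := h.exists_pow_mul f
    refine ⟨⟨x, _, n + k, rfl⟩, ?_⟩
    simp only [map_pow, IsScalarTower.algebraMap_apply B B' L, e, map_mul, ← hf]
    ring
  · rw [IsScalarTower.algebraMap_apply B B' L, IsScalarTower.algebraMap_apply B B' L] at e
    obtain ⟨⟨_, k, rfl⟩, hk⟩ :=
      (IsLocalization.eq_iff_exists (Submonoid.powers (algebraMap B B' b)) L).mp e
    obtain ⟨n, hn⟩ := h.exists_pow_mul_eq_zero (b ^ k * (x - y)) (by
      simp only [map_mul, map_pow, map_sub]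
      linear_combination hk)
    exact ⟨⟨_, n + k, rfl⟩, by linear_combination hn⟩

end IsAffineBlowupAlgebra

/-- The algebra `B[y] / (x i - b * y i)`. -/
abbrev BlowupModel {ι : Type*} (b : B) (x : ι → B) : Type _ :=
  MvPolynomial ι B ⧸ Ideal.span (Set.range fun i ↦
    (MvPolynomial.C (x i) - MvPolynomial.C b * MvPolynomial.X i : MvPolynomial ι B))

namespace BlowupModel

variable {ι : Type*} (b : B) (x : ι → B)

lemma mk_C (y : B) : Ideal.Quotient.mk _ (MvPolynomial.C y) = algebraMap B (BlowupModel b x) y :=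
  rfl

lemma algebraMap_mul_mk_X (i : ι) : algebraMap B (BlowupModel b x) b *
    Ideal.Quotient.mk _ (MvPolynomial.X i) = algebraMap B (BlowupModel b x) (x i) := by
  rw [← mk_C, ← mk_C, ← map_mul, eq_comm, Ideal.Quotient.eq]
  exact Ideal.subset_span ⟨i, rfl⟩

instance finitePresentation [Finite ι] : Algebra.FinitePresentation B (BlowupModel b x) := by
  exact Algebra.FinitePresentation.quotient (Submodule.fg_span (Set.finite_range _))

/-- Regularity of `b` is the only condition that can fail. A polynomial of degree `n` in the `y i`
becomes a fraction with denominator `b ^ n`, and the torsion of the kernel is seen by mapping `y i`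
to `x i / b` in `B[1/b]`. -/
lemma isAffineBlowupAlgebra {I : Ideal B} (hI : I = Ideal.span {b} ⊔ Ideal.span (Set.range x))
    (hb : algebraMap B (BlowupModel b x) b ∈ nonZeroDivisors (BlowupModel b x)) :
    IsAffineBlowupAlgebra (BlowupModel b x) I b where
  mem_nonZeroDivisors := hb
  dvd := by
    have : I ≤ (Ideal.span {algebraMap B (BlowupModel b x) b}).comap (algebraMap B _) := by
      rw [hI, sup_le_iff, Ideal.span_le, Ideal.span_le]
      refine ⟨by simp, ?_⟩
      rintro _ ⟨i, rfl⟩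
      exact Ideal.mem_span_singleton.mpr ⟨_, (algebraMap_mul_mk_X b x i).symm⟩
    exact fun y hy ↦ Ideal.mem_span_singleton.mp (this hy)
  exists_pow_mul f := by
    have hbI : b ∈ I := hI ▸ Ideal.mem_sup_left (Ideal.mem_span_singleton_self b)
    have hxI (i) : x i ∈ I := hI ▸ Ideal.mem_sup_right (Ideal.subset_span ⟨i, rfl⟩)
    obtain ⟨p, rfl⟩ := Ideal.Quotient.mk_surjective f
    induction p using MvPolynomial.induction_on with
    | C c => exact ⟨0, c, by simp, by simp [mk_C]⟩
    | add p q hp hq =>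
      obtain ⟨n, y, hy, e⟩ := hp
      obtain ⟨m, z, hz, e'⟩ := hq
      refine ⟨n + m, y * b ^ m + b ^ n * z, ?_, ?_⟩
      · rw [pow_add]
        exact add_mem (Ideal.mul_mem_mul hy (Ideal.pow_mem_pow hbI m))
          (Ideal.mul_mem_mul (Ideal.pow_mem_pow hbI n) hz)
      · simp only [map_add, map_mul, map_pow, e, e']
        ring
    | mul_X p i hp =>
      obtain ⟨n, y, hy, e⟩ := hp
      refine ⟨n + 1, y * x i, ?_, ?_⟩
      · rw [pow_succ]
        exact Ideal.mul_mem_mul hy (hxI i)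
      · simp only [map_mul, e, ← algebraMap_mul_mk_X b x i]
        ring
  exists_pow_mul_eq_zero y hy := by
    rw [← mk_C, Ideal.Quotient.eq_zero_iff_mem] at hy
    let L := Localization.Away b
    let g : MvPolynomial ι B →ₐ[B] L :=
      MvPolynomial.aeval fun i ↦ algebraMap B L (x i) * IsLocalization.Away.invSelf b
    have hg : Ideal.span (Set.range fun i ↦
        (MvPolynomial.C (x i) - MvPolynomial.C b * MvPolynomial.X i : MvPolynomial ι B)) ≤
        RingHom.ker g := by
      rw [Ideal.span_le]
      rintro _ ⟨i, rfl⟩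
      have : algebraMap B L b * IsLocalization.Away.invSelf b = 1 :=
        IsLocalization.Away.mul_invSelf b
      simp only [SetLike.mem_coe, RingHom.mem_ker, map_sub, map_mul, g, MvPolynomial.aeval_C,
        MvPolynomial.aeval_X]
      linear_combination (- algebraMap B L (x i)) * this
    have h1 := hg hy
    simp only [RingHom.mem_ker, g, MvPolynomial.aeval_C] at h1
    rw [IsLocalization.map_eq_zero_iff (Submonoid.powers b)] at h1
    obtain ⟨⟨_, n, rfl⟩, hn⟩ := h1
    exact ⟨n, hn⟩

/-- Modulo `b` the relation `x i - b * y i` becomes `x i`, so the `y i` are free over `B / I`. This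
describes the exceptional divisor as an affine space over the center. -/
lemma nonempty_quotient_algEquiv {I : Ideal B}
    (hI : I = Ideal.span {b} ⊔ Ideal.span (Set.range x)) :
    Nonempty ((BlowupModel b x ⧸ Ideal.span {algebraMap B (BlowupModel b x) b}) ≃ₐ[B]
      MvPolynomial ι (B ⧸ I)) := by
  have hbI : b ∈ I := hI ▸ Ideal.mem_sup_left (Ideal.mem_span_singleton_self b)
  have hxI (i) : x i ∈ I := hI ▸ Ideal.mem_sup_right (Ideal.subset_span ⟨i, rfl⟩)
  let q : MvPolynomial ι B →ₐ[B] MvPolynomial ι (B ⧸ I) :=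
    MvPolynomial.mapAlgHom (Ideal.Quotient.mkₐ B I)
  have hq (p) : q p = MvPolynomial.map (Ideal.Quotient.mk I) p := rfl
  have hqs : Function.Surjective q :=
    MvPolynomial.map_surjective _ Ideal.Quotient.mk_surjective
  let s : MvPolynomial ι B →ₐ[B] BlowupModel b x ⧸ Ideal.span {algebraMap B (BlowupModel b x) b} :=
    (Ideal.Quotient.mkₐ B _).comp (Ideal.Quotient.mkₐ B _)
  have hs : Function.Surjective s :=
    Ideal.Quotient.mk_surjective.comp Ideal.Quotient.mk_surjective
  -- Both algebras are quotients of `B[y]`, so it is enough to compare the two kernels.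
  have hker : RingHom.ker s = RingHom.ker q := by
    apply le_antisymm
    · intro p hp
      have hp' : Ideal.Quotient.mk _ p ∈ Ideal.span {algebraMap B (BlowupModel b x) b} :=
        Ideal.Quotient.eq_zero_iff_mem.mp hp
      obtain ⟨c, hc⟩ := Ideal.mem_span_singleton.mp hp'
      obtain ⟨c, rfl⟩ := Ideal.Quotient.mk_surjective c
      rw [← mk_C, ← map_mul, Ideal.Quotient.eq] at hc
      have h1 : Ideal.span (Set.range fun i ↦
          (MvPolynomial.C (x i) - MvPolynomial.C b * MvPolynomial.X i : MvPolynomial ι B)) ≤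
          RingHom.ker q := by
        rw [Ideal.span_le]
        rintro _ ⟨i, rfl⟩
        simp only [SetLike.mem_coe, RingHom.mem_ker, hq, map_sub, map_mul, MvPolynomial.map_C,
          Ideal.Quotient.eq_zero_iff_mem.mpr (hxI i), Ideal.Quotient.eq_zero_iff_mem.mpr hbI]
        simp
      have h2 := h1 hc
      simp only [RingHom.mem_ker, map_sub, map_mul, hq, MvPolynomial.map_C,
        Ideal.Quotient.eq_zero_iff_mem.mpr hbI] at h2
      simpa [RingHom.mem_ker, hq] using h2
    · have : RingHom.ker q = I.map MvPolynomial.C := by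
        have := MvPolynomial.ker_map (σ := ι) (Ideal.Quotient.mk I)
        rw [Ideal.mk_ker] at this
        exact this
      rw [this, Ideal.map_le_iff_le_comap, hI, sup_le_iff, Ideal.span_le, Ideal.span_le]
      constructor
      · rintro _ rfl
        exact Ideal.Quotient.eq_zero_iff_mem.mpr (Ideal.mem_span_singleton_self _)
      · rintro _ ⟨i, rfl⟩
        exact Ideal.Quotient.eq_zero_iff_mem.mpr
          (Ideal.mem_span_singleton.mpr ⟨_, (algebraMap_mul_mk_X b x i).symm⟩)
  exact ⟨(Ideal.quotientKerAlgEquivOfSurjective hs).symm.trans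
    ((Ideal.quotientEquivAlgOfEq B hker).trans (Ideal.quotientKerAlgEquivOfSurjective hqs))⟩

end BlowupModel

/-- If `b x = f y`, then regularity of `f` modulo `b` gives `y = b z`, and cancelling `b` gives `x =
f z`. Neither a local ring nor a finiteness condition is needed, since only regularity of `b` on the
quotient is claimed, not that the swapped pair is regular. -/
lemma isSMulRegular_quotSMulTop_swap {R N : Type*} [CommRing R] [AddCommGroup N] [Module R N]
    {b f : R} (hb : IsSMulRegular N b) (hf : IsSMulRegular (QuotSMulTop b N) f) :
    IsSMulRegular (QuotSMulTop f N) b := by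
  rw [isSMulRegular_iff_right_eq_zero_of_smul] at hf ⊢
  intro x hx
  obtain ⟨x, rfl⟩ := Submodule.Quotient.mk_surjective _ x
  rw [← Submodule.Quotient.mk_smul, Submodule.Quotient.mk_eq_zero,
    Submodule.mem_smul_pointwise_iff_exists] at hx
  obtain ⟨y, -, hy⟩ := hx
  have h1 : (Submodule.Quotient.mk y : QuotSMulTop b N) = 0 := by
    apply hf
    rw [← Submodule.Quotient.mk_smul, Submodule.Quotient.mk_eq_zero,
      Submodule.mem_smul_pointwise_iff_exists]
    exact ⟨x, trivial, hy.symm⟩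
  rw [Submodule.Quotient.mk_eq_zero, Submodule.mem_smul_pointwise_iff_exists] at h1
  obtain ⟨z, -, rfl⟩ := h1
  rw [Submodule.Quotient.mk_eq_zero, Submodule.mem_smul_pointwise_iff_exists]
  exact ⟨z, trivial, hb (by simp only [← hy, smul_comm b f z])⟩

open RingTheory.Sequence in
/-- If `b, f₁, …, fₙ` is weakly regular on `M`, then `b` is regular on `M / (f₁, …, fₙ)`. -/
lemma isSMulRegular_quotient_of_isWeaklyRegular_cons {R : Type*} [CommRing R] (b : R)
    (fs : List R) {M : Type*} [AddCommGroup M] [Module R M] (h : IsWeaklyRegular M (b :: fs)) :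
    IsSMulRegular (M ⧸ (Ideal.ofList fs • ⊤ : Submodule R M)) b := by
  induction fs using List.reverseRecOn with
  | nil =>
    have h0 : (Ideal.ofList ([] : List R) • ⊤ : Submodule R M) = ⊥ := by simp
    exact ((Submodule.quotEquivOfEqBot _ h0).isSMulRegular_congr b).mpr
      ((isWeaklyRegular_cons_iff _ _ _).mp h).1
  | append_singleton fs f ih =>
    rw [← List.cons_append, isWeaklyRegular_append_iff, isWeaklyRegular_singleton_iff] at h
    have h1 := ih h.1
    have h2 := ((Submodule.quotOfListConsSMulTopEquivQuotSMulTopOuter M b fs).isSMulRegular_congr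
      f).mp h.2
    have hN : (Ideal.ofList (fs ++ [f]) • ⊤ : Submodule R M) = Ideal.ofList (f :: fs) • ⊤ := by
      congr 1
      simp [sup_comm]
    -- On `M / (fs)` the element `b` is regular by induction, and `f` is regular modulo `b`;
    -- swapping the two moves `b` past `f`.
    refine (((Submodule.quotEquivOfEq _ _ hN).trans
      (Submodule.quotOfListConsSMulTopEquivQuotSMulTopOuter M f fs)).isSMulRegular_congr b).mpr ?_
    exact isSMulRegular_quotSMulTop_swap h1 h2

open RingTheory.Sequence in
-- In `B[y]` the elements `x i` and `F i = x i - b * y i` agree modulo `b`. So `b, F₁, …, Fₙ` is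
-- weakly regular, by flatness of `B[y]`, and moving `b` to the end shows that it is regular on
-- `B[y] / (F)`.
lemma BlowupModel.algebraMap_mem_nonZeroDivisors {b : B} {xs : List B}
    (h : IsWeaklyRegular B (b :: xs)) :
    algebraMap B (BlowupModel b xs.get) b ∈ nonZeroDivisors (BlowupModel b xs.get) := by
  let P := MvPolynomial (Fin xs.length) B
  let F : Fin xs.length → P := fun i ↦
    MvPolynomial.C (xs.get i) - MvPolynomial.C b * MvPolynomial.X i
  have h1 : IsWeaklyRegular P ((b :: xs).map (algebraMap B P)) := h.of_flat
  rw [List.map_cons, isWeaklyRegular_cons_iff'] at h1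
  have h2 : IsWeaklyRegular P (algebraMap B P b :: List.ofFn F) := by
    rw [isWeaklyRegular_cons_iff']
    refine ⟨h1.1, ?_⟩
    convert h1.2 using 1
    refine List.ext_get (by simp) fun n _ _ ↦ ?_
    have hb0 : Ideal.Quotient.mk (Ideal.span {algebraMap B P b}) (MvPolynomial.C b) = 0 :=
      Ideal.Quotient.eq_zero_iff_mem.mpr (Ideal.mem_span_singleton_self _)
    simp only [List.get_eq_getElem, List.getElem_map, List.getElem_ofFn, F, map_sub, map_mul, hb0,
      zero_mul, sub_zero]
    rfl
  have h3 := isSMulRegular_quotient_of_isWeaklyRegular_cons _ _ h2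
  have hF : (Ideal.ofList (List.ofFn F) • ⊤ : Submodule P P) = Ideal.span (Set.range F) := by
    simp [Ideal.ofList, List.mem_ofFn, Set.range]
  rw [hF] at h3
  rw [isSMulRegular_iff_right_eq_zero_of_smul] at h3
  rw [mem_nonZeroDivisors_iff_right]
  exact fun y hy ↦ h3 y ((mul_comm _ _).trans hy)

end AffineBlowupAlgebra

end NeronBlowup

namespace NeronBlowup

/-! ### Flatness modulo a regular element. -/

section Flatness

open scoped TensorProduct

variable {A : Type*} [CommRing A] {a : A}

lemma one_tmul_quotient_eq_zero_iff {N : Type*} [AddCommGroup N] [Module A N] (n : N) :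
    (1 : A ⧸ Ideal.span {a}) ⊗ₜ[A] n = 0 ↔ ∃ n', n = a • n' := by
  rw [← (TensorProduct.quotTensorEquivQuotSMul N (Ideal.span {a})).map_eq_zero_iff]
  have := TensorProduct.quotTensorEquivQuotSMul_mk_tmul (M := N) (Ideal.span {a}) 1 n
  rw [map_one, one_smul] at this
  rw [this, Submodule.Quotient.mk_eq_zero, Submodule.ideal_span_singleton_smul,
    Submodule.mem_smul_pointwise_iff_exists]
  simp [eq_comm]

lemma exists_one_tmul_quotient {N : Type*} [AddCommGroup N] [Module A N]
    (z : (A ⧸ Ideal.span {a}) ⊗[A] N) : ∃ n, z = 1 ⊗ₜ n := by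
  obtain ⟨n, hn⟩ := TensorProduct.mk_surjective A N (A ⧸ Ideal.span {a})
    Ideal.Quotient.mk_surjective z
  exact ⟨n, hn.symm⟩

variable {M : Type*} [AddCommGroup M] [Module A M]

/-- Base change to `S` commutes with tensoring by `M`, so the map becomes `ι.baseChange S` tensored
over `S` with the flat module `S ⊗ M`. -/
lemma baseChange_rTensor_injective {S : Type*} [CommRing S] [Algebra A S]
    [Module.Flat S (S ⊗[A] M)] {K F : Type*} [AddCommGroup K] [Module A K] [AddCommGroup F]
    [Module A F] {ι : K →ₗ[A] F} (hι : Function.Injective (ι.baseChange S)) :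
    Function.Injective ((ι.rTensor M).baseChange S) := by
  have h1 := Module.Flat.rTensor_preserves_injective_linearMap (M := S ⊗[A] M) _ hι
  have h2 : (TensorProduct.AlgebraTensorModule.distribBaseChange A S F M).toLinearMap ∘ₗ
      (ι.rTensor M).baseChange S = (ι.baseChange S).rTensor (S ⊗[A] M) ∘ₗ
        (TensorProduct.AlgebraTensorModule.distribBaseChange A S K M).toLinearMap := by
    ext r m
    simp
  refine Function.Injective.of_comp
    (f := TensorProduct.AlgebraTensorModule.distribBaseChange A S F M) ?_
  have h3 : ⇑(TensorProduct.AlgebraTensorModule.distribBaseChange A S F M) ∘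
      ⇑((ι.rTensor M).baseChange S) = ⇑((ι.baseChange S).rTensor (S ⊗[A] M)) ∘
        ⇑(TensorProduct.AlgebraTensorModule.distribBaseChange A S K M) :=
    funext fun z ↦ LinearMap.congr_fun h2 z
  rw [h3]
  exact h1.comp (LinearEquiv.injective _)

/-- Since `a` is regular on `N`, the map `K → F` stays injective modulo `a`, and by flatness of `M /
aM` so does `K ⊗ M → F ⊗ M`. If `a ξ = 0`, lift `ξ` to `F ⊗ M`; then `a` times the lift comes from
some `ρ` in `K ⊗ M` that vanishes modulo `a`. Writing `ρ = a ρ'` and cancelling `a` on `F ⊗ M` shows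
that the lift itself comes from `K ⊗ M`, so `ξ = 0`. -/
lemma isSMulRegular_tensorProduct_of_exact {K F N : Type*} [AddCommGroup K] [Module A K]
    [AddCommGroup F] [Module A F] [Module.Flat A F] [AddCommGroup N] [Module A N]
    {ι : K →ₗ[A] F} {π : F →ₗ[A] N} (hι : Function.Injective ι) (hπ : Function.Surjective π)
    (hexact : Function.Exact ι π) (hN : IsSMulRegular N a) (hM : IsSMulRegular M a)
    [Module.Flat (A ⧸ Ideal.span {a}) ((A ⧸ Ideal.span {a}) ⊗[A] M)] :
    IsSMulRegular (N ⊗[A] M) a := by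
  rw [isSMulRegular_iff_right_eq_zero_of_smul]
  intro ξ hξ
  have hι' : Function.Injective (ι.baseChange (A ⧸ Ideal.span {a})) := by
    rw [injective_iff_map_eq_zero]
    intro z hz
    obtain ⟨r, rfl⟩ := exists_one_tmul_quotient z
    rw [LinearMap.baseChange_tmul, one_tmul_quotient_eq_zero_iff] at hz
    obtain ⟨f, hf⟩ := hz
    have h0 : π f = 0 := by
      apply hN
      simp only [smul_zero]
      rw [← map_smul, ← hf, hexact.apply_apply_eq_zero]
    obtain ⟨s, rfl⟩ := (hexact f).mp h0
    exact (one_tmul_quotient_eq_zero_iff _).mpr ⟨s, hι (hf.trans (map_smul _ _ _).symm)⟩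
  have hιM := baseChange_rTensor_injective (M := M) hι'
  obtain ⟨ξ', rfl⟩ := LinearMap.rTensor_surjective M hπ ξ
  rw [← map_smul] at hξ
  obtain ⟨ρ, hρ⟩ := (rTensor_exact M hexact hπ _).mp hξ
  have hρ0 : (1 : A ⧸ Ideal.span {a}) ⊗ₜ[A] ρ = 0 := by
    apply hιM
    rw [LinearMap.baseChange_tmul, map_zero]
    exact (one_tmul_quotient_eq_zero_iff _).mpr ⟨ξ', hρ⟩
  obtain ⟨ρ', rfl⟩ := (one_tmul_quotient_eq_zero_iff _).mp hρ0
  rw [map_smul] at hρ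
  rw [← hM.lTensor F hρ]
  exact (rTensor_exact M hexact hπ).apply_apply_eq_zero ρ'

lemma isSMulRegular_tensorProduct {N : Type*} [AddCommGroup N] [Module A N]
    (hN : IsSMulRegular N a) (hM : IsSMulRegular M a)
    [Module.Flat (A ⧸ Ideal.span {a}) ((A ⧸ Ideal.span {a}) ⊗[A] M)] :
    IsSMulRegular (N ⊗[A] M) a :=
  isSMulRegular_tensorProduct_of_exact (F := N →₀ A) (Submodule.subtype_injective _)
    (Finsupp.linearCombination_id_surjective A N) (LinearMap.exact_subtype_ker_map _) hN hM

/-- The map `g` identifies `M / aM` with `Q`, so flatness can be read off `Q`. -/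
lemma flat_tensorProduct_of_surjective {Q : Type*} [AddCommGroup Q] [Module A Q]
    [Module (A ⧸ Ideal.span {a}) Q] [IsScalarTower A (A ⧸ Ideal.span {a}) Q]
    [Module.Flat (A ⧸ Ideal.span {a}) Q] (g : M →ₗ[A] Q) (hg : Function.Surjective g)
    (hker : ∀ m, g m = 0 → ∃ m', m = a • m') :
    Module.Flat (A ⧸ Ideal.span {a}) ((A ⧸ Ideal.span {a}) ⊗[A] M) := by
  refine Module.Flat.of_linearEquiv
    (LinearEquiv.ofBijective (g.liftBaseChange (A ⧸ Ideal.span {a})) ⟨?_, fun q ↦ ?_⟩)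
  · rw [injective_iff_map_eq_zero]
    intro z hz
    obtain ⟨m, rfl⟩ := exists_one_tmul_quotient z
    rw [LinearMap.liftBaseChange_tmul, one_smul] at hz
    exact (one_tmul_quotient_eq_zero_iff _).mpr (hker m hz)
  · obtain ⟨m, rfl⟩ := hg q
    exact ⟨1 ⊗ₜ m, by simp⟩

/-- Flatness can be checked modulo a nonzerodivisor and after inverting it. -/
lemma flat_of_flat_quotient_of_flat_localization (hA : IsSMulRegular A a) (hM : IsSMulRegular M a)
    [Module.Flat (A ⧸ Ideal.span {a}) ((A ⧸ Ideal.span {a}) ⊗[A] M)]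
    {L : Type*} [AddCommGroup L] [Module A L] [Module.Flat A L] (f : M →ₗ[A] L)
    [IsLocalizedModule (Submonoid.powers a) f] : Module.Flat A M := by
  rw [Module.Flat.iff_lTensor_injective']
  intro I
  rw [injective_iff_map_eq_zero]
  intro ξ hξ
  have hI : IsSMulRegular I a := fun x y h ↦ Subtype.ext (hA congr(($h).1))
  have hIM : IsSMulRegular (M ⊗[A] I) a :=
    ((TensorProduct.comm A M I).isSMulRegular_congr a).mpr (isSMulRegular_tensorProduct hI hM)
  -- After inverting `a` the module is flat, so an element of the kernel is killed by a power of
  -- `a`; but `a` is regular on `M ⊗ I`.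
  have h0 : f.rTensor I ξ = 0 := by
    apply Module.Flat.lTensor_preserves_injective_linearMap (M := L) I.subtype
      I.subtype_injective
    rw [map_zero, ← LinearMap.comp_apply, LinearMap.lTensor_comp_rTensor,
      ← LinearMap.rTensor_comp_lTensor, LinearMap.comp_apply, hξ, map_zero]
  have : IsLocalizedModule (Submonoid.powers a) (f.rTensor I) :=
    inferInstanceAs (IsLocalizedModule (Submonoid.powers a)
      (TensorProduct.AlgebraTensorModule.rTensor A I f))
  obtain ⟨⟨_, n, rfl⟩, hn⟩ :=
    (IsLocalizedModule.eq_zero_iff (Submonoid.powers a) (f.rTensor I)).mp h0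
  exact (IsSMulRegular.pow n hIM) (hn.trans (smul_zero _).symm)

end Flatness

/-! ### Flatness of the blowup algebra with a flat center. -/

section BlowupFlatness

variable {A B B' : Type*} [CommRing A] [CommRing B] [CommRing B'] [Algebra A B] [Algebra B B']
  [Algebra A B'] [IsScalarTower A B B'] {a : A} {I : Ideal B} {ι : Type*} {x : ι → B}

/-- If `B` is flat over `A`, the center `B / I` is flat over `A / a`, and the equations of the
blowup algebra `B'` are the obvious ones, then `B'` is flat over `A`. -/
lemma IsAffineBlowupAlgebra.flat (h : IsAffineBlowupAlgebra B' I (algebraMap A B a))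
    (hA : a ∈ nonZeroDivisors A) [Module.Flat A B]
    (hI : I = Ideal.span {algebraMap A B a} ⊔ Ideal.span (Set.range x))
    (hx : algebraMap B (BlowupModel (algebraMap A B a) x) (algebraMap A B a) ∈
      nonZeroDivisors (BlowupModel (algebraMap A B a) x))
    [Algebra (A ⧸ Ideal.span {a}) (B ⧸ I)] [IsScalarTower A (A ⧸ Ideal.span {a}) (B ⧸ I)]
    [Module.Flat (A ⧸ Ideal.span {a}) (B ⧸ I)] :
    Module.Flat A B' := by
  obtain ⟨e⟩ := h.nonempty_algEquiv (BlowupModel.isAffineBlowupAlgebra _ x hI hx)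
  obtain ⟨e'⟩ := BlowupModel.nonempty_quotient_algEquiv (algebraMap A B a) x hI
  have hB' : IsSMulRegular B' a := by
    rw [isSMulRegular_iff_right_eq_zero_of_smul]
    intro y hy
    rw [Algebra.smul_def, IsScalarTower.algebraMap_apply A B B', mul_comm] at hy
    exact (mem_nonZeroDivisors_iff_right.mp h.mem_nonZeroDivisors) y hy
  have hA' : IsSMulRegular A a := by
    rw [isSMulRegular_iff_right_eq_zero_of_smul]
    intro y hy
    exact (mem_nonZeroDivisors_iff_right.mp hA) y ((mul_comm _ _).trans hy)
  -- The reduction of `B'` modulo `a`; its target is a polynomial ring over the flat `A / a`-algebra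
  -- `B / I`.
  let g : B' →ₐ[B] MvPolynomial ι (B ⧸ I) :=
    (e'.toAlgHom.comp (Ideal.Quotient.mkₐ B _)).comp e.toAlgHom
  have hg : Function.Surjective g :=
    e'.surjective.comp (Ideal.Quotient.mk_surjective.comp e.surjective)
  have hker (y : B') (hy : g y = 0) : ∃ z, y = a • z := by
    have h1 : Ideal.Quotient.mk (Ideal.span {algebraMap B (BlowupModel (algebraMap A B a) x)
      (algebraMap A B a)}) (e y) = 0 := e'.injective (hy.trans (map_zero e').symm)
    obtain ⟨z, hz⟩ := Ideal.mem_span_singleton.mp (Ideal.Quotient.eq_zero_iff_mem.mp h1)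
    refine ⟨e.symm z, e.injective ?_⟩
    rw [hz, Algebra.smul_def, IsScalarTower.algebraMap_apply A B B', map_mul, e.commutes,
      e.apply_symm_apply]
  have : Module.Flat (A ⧸ Ideal.span {a}) (MvPolynomial ι (B ⧸ I)) := .trans _ (B ⧸ I) _
  have := flat_tensorProduct_of_surjective (A := A) (a := a) (M := B')
    (Q := MvPolynomial ι (B ⧸ I)) (g.toLinearMap.restrictScalars A) hg hker
  -- Inverting `a` turns `B'` into a localization of the flat `A`-algebra `B`.
  have : IsLocalization.Away (algebraMap A B a)
      (Localization.Away (algebraMap B B' (algebraMap A B a))) := h.isLocalizationAway_map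
  have : Module.Flat B (Localization.Away (algebraMap B B' (algebraMap A B a))) :=
    IsLocalization.flat _ (Submonoid.powers (algebraMap A B a))
  have : Module.Flat A (Localization.Away (algebraMap B B' (algebraMap A B a))) :=
    Module.Flat.trans A B _
  let f : B' →ₐ[A] (Localization.Away (algebraMap B B' (algebraMap A B a))) :=
    IsScalarTower.toAlgHom A B' _
  have : IsLocalizedModule (Submonoid.powers a) f.toLinearMap := by
    have h0 : IsLocalization (Algebra.algebraMapSubmonoid B' (Submonoid.powers a))
        (Localization.Away (algebraMap B B' (algebraMap A B a))) := by
      rw [Algebra.algebraMapSubmonoid_powers, IsScalarTower.algebraMap_apply A B B']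
      infer_instance
    exact isLocalizedModule_iff_isLocalization.mpr h0
  exact flat_of_flat_quotient_of_flat_localization hA' hB' f.toLinearMap

end BlowupFlatness

end NeronBlowup

namespace NeronBlowup

/-! ### Formal smoothness of the model and derivations attached to a smooth center. -/

section BlowupSmooth

variable {A B : Type*} [CommRing A] [CommRing B] [Algebra A B]

/-- The algebra `B[y] / (x i - a * y i)` is formally smooth over `A` if `B` is and the
differentials of the `x i` are part of a basis. -/
lemma BlowupModel.formallySmooth [Algebra.FormallySmooth A B] (a : A) {ι : Type*} [Fintype ι]
    [DecidableEq ι] (x : ι → B) (D : ι → Derivation A B B)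
    (hD : ∀ i j, D j (x i) = if i = j then 1 else 0) :
    Algebra.FormallySmooth A (BlowupModel (algebraMap A B a) x) := by
  rw [Algebra.FormallySmooth.iff_comp_surjective]
  intro R _ _ K hK f
  let mB : B →ₐ[A] BlowupModel (algebraMap A B a) x :=
    IsScalarTower.toAlgHom A B (BlowupModel (algebraMap A B a) x)
  obtain ⟨g, hg⟩ := Algebra.FormallySmooth.comp_surjective A B K hK (f.comp mB)
  have hg' (z : B) : Ideal.Quotient.mk K (g z) = f (mB z) := DFunLike.congr_fun hg z
  choose y hy using fun i ↦ Ideal.Quotient.mk_surjective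
    (f (Ideal.Quotient.mk _ (MvPolynomial.X i)))
  -- The obstruction to extending the lift `g` of `f` on `B` by `X i ↦ y i`. It lies in the
  -- square-zero ideal `K`.
  let δ (i : ι) : R := g (x i) - algebraMap A R a * y i
  have hδ (i : ι) : δ i ∈ K := by
    have ha : Ideal.Quotient.mk K (algebraMap A R a) = f (algebraMap A _ a) :=
      (f.commutes a).symm
    rw [← Ideal.Quotient.eq_zero_iff_mem, map_sub, map_mul, hg', hy, sub_eq_zero, ha, ← map_mul]
    congr 1
    exact (BlowupModel.algebraMap_mul_mk_X (algebraMap A B a) x i).symm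
  have hKK {u v : R} (hu : u ∈ K) (hv : v ∈ K) : u * v = 0 := by
    rw [← Ideal.mem_bot, ← hK, pow_two]
    exact Ideal.mul_mem_mul hu hv
  let S (z : B) : R := ∑ j, δ j * g (D j z)
  have hSK (z : B) : S z ∈ K := sum_mem fun j _ ↦ Ideal.mul_mem_right _ _ (hδ j)
  -- Subtracting the `K`-valued derivation `S` keeps `g` a lift, as `K ^ 2 = 0`. Since the `D j` are
  -- dual to the `x i`, `S (x i) = δ i`, so `g' (x i) = a * y i` and the obstruction is gone.
  let g' : B →ₐ[A] R := AlgHom.ofLinearMap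
    (g.toLinearMap - ∑ j, LinearMap.mulLeft A (δ j) ∘ₗ g.toLinearMap ∘ₗ (D j : B →ₗ[A] B))
    (by simp) (by
      have h (z : B) : (g.toLinearMap - ∑ j, LinearMap.mulLeft A (δ j) ∘ₗ g.toLinearMap ∘ₗ
          (D j : B →ₗ[A] B)) z = g z - S z := by simp [S]
      intro u v
      have h1 : S (u * v) = g u * S v + g v * S u := by
        simp only [S, Derivation.leibniz, smul_eq_mul, map_add, map_mul, Finset.mul_sum,
          ← Finset.sum_add_distrib]
        exact Finset.sum_congr rfl fun _ _ ↦ by ring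
      rw [h, h, h, h1, map_mul]
      linear_combination -hKK (hSK u) (hSK v))
  have hg'S (z : B) : g' z = g z - S z := by simp [g', S]
  let F : MvPolynomial ι B →ₐ[A] R := MvPolynomial.aevalTower g' y
  have hF : Ideal.span (Set.range fun i ↦ (MvPolynomial.C (x i) -
      MvPolynomial.C (algebraMap A B a) * MvPolynomial.X i : MvPolynomial ι B)) ≤
        RingHom.ker F := by
    rw [Ideal.span_le]
    rintro _ ⟨i, rfl⟩
    have h1 : S (x i) = δ i := by simp [S, hD]
    simp only [SetLike.mem_coe, RingHom.mem_ker, F, map_sub, map_mul, MvPolynomial.aevalTower_C,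
      MvPolynomial.aevalTower_X, hg'S, h1, δ]
    have h2 : S (algebraMap A B a) = 0 := by simp [S]
    rw [h2, AlgHom.commutes]
    ring
  refine ⟨Ideal.Quotient.liftₐ _ F hF, ?_⟩
  refine Ideal.Quotient.algHom_ext _ ?_
  have : ∀ p, Ideal.Quotient.mk K (F p) = f (Ideal.Quotient.mk _ p) := by
    intro p
    induction p using MvPolynomial.induction_on with
    | C c =>
      simp only [F, MvPolynomial.aevalTower_C, hg'S, map_sub, hg',
        Ideal.Quotient.eq_zero_iff_mem.mpr (hSK c), sub_zero]
      rfl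
    | add p q hp hq => simp only [map_add, hp, hq]
    | mul_X p i hp => simp only [map_mul, hp, ← hy]; simp [F]
  exact AlgHom.ext this

/-- The defect of a section `σ` of the square-zero extension
`B / (I ^ 2 + a) → B / I`, as a derivation. -/
lemma exists_derivation_of_formallySmooth_quotient {a : A} {I : Ideal B}
    (ha : algebraMap A B a ∈ I)
    [Algebra (A ⧸ Ideal.span {a}) (B ⧸ I)] [IsScalarTower A (A ⧸ Ideal.span {a}) (B ⧸ I)]
    [Algebra.FormallySmooth (A ⧸ Ideal.span {a}) (B ⧸ I)] :
    ∃ D : Derivation A B (B ⧸ (I ^ 2 ⊔ Ideal.span {algebraMap A B a})),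
      (∀ x ∈ I, D x = Ideal.Quotient.mk _ x) ∧
      ∀ z, ∃ x ∈ I, D z = Ideal.Quotient.mk _ x := by
  set N := I ^ 2 ⊔ Ideal.span {algebraMap A B a} with hN
  have hNI : N ≤ I := sup_le (Ideal.pow_le_self two_ne_zero) (by simpa [Ideal.span_le] using ha)
  have hann : ∀ r ∈ Ideal.span {a}, algebraMap A (B ⧸ N) r = 0 := by
    intro r hr
    obtain ⟨c, rfl⟩ := Ideal.mem_span_singleton.mp hr
    rw [IsScalarTower.algebraMap_apply A B (B ⧸ N), map_mul]
    exact Ideal.Quotient.eq_zero_iff_mem.mpr (Ideal.mul_mem_right _ _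
      (Ideal.mem_sup_right (Ideal.mem_span_singleton_self _)))
  let : Algebra (A ⧸ Ideal.span {a}) (B ⧸ N) :=
    (Ideal.Quotient.lift (Ideal.span {a}) (algebraMap A (B ⧸ N)) hann).toAlgebra
  have : IsScalarTower A (A ⧸ Ideal.span {a}) (B ⧸ N) := .of_algebraMap_eq' rfl
  let p : (B ⧸ N) →ₐ[A ⧸ Ideal.span {a}] (B ⧸ I) :=
    AlgHom.extendScalarsOfSurjective (R := A) Ideal.Quotient.mk_surjective
      (Ideal.Quotient.factorₐ A hNI)
  have hp (z : B) : p (Ideal.Quotient.mk N z) = Ideal.Quotient.mk I z := rfl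
  have hps : Function.Surjective p := Ideal.Quotient.factor_surjective hNI
  have hker {z : B ⧸ N} (hz : p z = 0) : ∃ x ∈ I, z = Ideal.Quotient.mk N x := by
    obtain ⟨x, rfl⟩ := Ideal.Quotient.mk_surjective z
    exact ⟨x, Ideal.Quotient.eq_zero_iff_mem.mp hz, rfl⟩
  have hmul {u v : B ⧸ N} (hu : p u = 0) (hv : p v = 0) : u * v = 0 := by
    obtain ⟨x, hx, rfl⟩ := hker hu
    obtain ⟨y, hy, rfl⟩ := hker hv
    rw [← map_mul, Ideal.Quotient.eq_zero_iff_mem]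
    exact Ideal.mem_sup_left (pow_two I ▸ Ideal.mul_mem_mul hx hy)
  have hnil : IsNilpotent (RingHom.ker (p : (B ⧸ N) →+* (B ⧸ I))) := by
    refine ⟨2, ?_⟩
    rw [Ideal.zero_eq_bot, eq_bot_iff, pow_two, Ideal.mul_le]
    exact fun u hu v hv ↦ hmul hu hv
  -- An algebra section of `B / N → B / I`. The derivation is `z ↦ z - σ (z mod I)`: two values have
  -- product zero, which gives the Leibniz rule, and on `I` the second term vanishes.
  let σ := Algebra.FormallySmooth.liftOfSurjective (AlgHom.id (A ⧸ Ideal.span {a}) (B ⧸ I)) p hps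
    hnil
  have hσ (z : B ⧸ I) : p (σ z) = z :=
    Algebra.FormallySmooth.liftOfSurjective_apply _ p hps hnil z
  let L : B →ₗ[A] (B ⧸ N) := (Ideal.Quotient.mkₐ A N).toLinearMap -
    (σ.toLinearMap.restrictScalars A) ∘ₗ (Ideal.Quotient.mkₐ A I).toLinearMap
  have hL (z : B) : L z = Ideal.Quotient.mk N z - σ (Ideal.Quotient.mk I z) := rfl
  have hpL (z : B) : p (L z) = 0 := by rw [hL, map_sub, hp, hσ, sub_self]
  refine ⟨Derivation.mk' L fun u v ↦ ?_, fun x hx ↦ ?_, fun z ↦ hker (hpL z)⟩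
  · have h := hmul (hpL u) (hpL v)
    simp only [hL, Algebra.smul_def, Ideal.Quotient.algebraMap_eq, map_mul] at h ⊢
    linear_combination -h
  · change L x = _
    rw [hL, Ideal.Quotient.eq_zero_iff_mem.mpr hx, map_zero, sub_zero]

/-- Nakayama's lemma in `B_q` gives `I ⊆ N` there; finitely many generators then need only one
denominator. -/
lemma exists_notMem_mul_mem_of_forall {I N : Ideal B} (hI : I.FG) (q : Ideal B) [q.IsPrime]
    (h : ∀ x ∈ I, ∃ s ∉ q, s * x ∈ N ⊔ q * I) : ∃ g ∉ q, ∀ x ∈ I, g * x ∈ N := by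
  let L := Localization.AtPrime q
  have h1 : I.map (algebraMap B L) ≤ N.map (algebraMap B L) := by
    refine Submodule.le_of_le_smul_of_le_jacobson_bot (I := IsLocalRing.maximalIdeal L)
      (hI.map _) (IsLocalRing.maximalIdeal_le_jacobson _) ?_
    rw [Ideal.map_le_iff_le_comap]
    intro x hx
    obtain ⟨s, hs, hsx⟩ := h x hx
    have h2 := Ideal.mem_map_of_mem (algebraMap B L) hsx
    rw [Ideal.map_sup, Ideal.map_mul, Localization.AtPrime.map_eq_maximalIdeal, map_mul] at h2
    exact (Ideal.unit_mul_mem_iff_mem _ (IsLocalization.map_units L (⟨s, hs⟩ : q.primeCompl))).mp h2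
  obtain ⟨S, hS⟩ := hI
  have h3 (x : B) : ∃ g ∉ q, x ∈ S → g * x ∈ N := by
    by_cases hx : x ∈ S
    · have h4 := h1 (Ideal.mem_map_of_mem _ (hS ▸ Ideal.subset_span hx : x ∈ I))
      rw [IsLocalization.algebraMap_mem_map_algebraMap_iff q.primeCompl] at h4
      obtain ⟨m, hm, hmx⟩ := h4
      exact ⟨m, hm, fun _ ↦ hmx⟩
    · exact ⟨1, q.one_notMem, fun h ↦ (hx h).elim⟩
  choose g hg hgx using h3
  refine ⟨∏ x ∈ S, g x, ?_, fun x hx ↦ ?_⟩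
  · rw [Ideal.IsPrime.prod_mem_iff]
    rintro ⟨x, -, hx⟩
    exact hg x hx
  · have : I ≤ (Submodule.comap (LinearMap.mulLeft B (∏ x ∈ S, g x)) N : Ideal B) := by
      rw [← hS]
      refine Submodule.span_le.mpr fun x hx ↦ ?_
      obtain ⟨c, hc⟩ := Finset.dvd_prod_of_mem g hx
      change (∏ x ∈ S, g x) * x ∈ N
      rw [hc, mul_right_comm]
      exact Ideal.mul_mem_right _ _ (hgx x hx)
    exact this hx

end BlowupSmooth

end NeronBlowup

namespace NeronBlowup

/-! ### Local equations of a smooth center, and smoothness of the blowup. -/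

section BlowupSmooth

variable {A B : Type*} [CommRing A] [CommRing B] [Algebra A B]

open scoped TensorProduct

/-- Viewing `κ(q)` as the localization of `B / q` at the complement of `q` lets statements over the
residue field be pulled back to `B` at the cost of denominators outside `q`. -/
lemma isLocalizedModule_residueField (q : Ideal B) [q.IsPrime] :
    IsLocalizedModule q.primeCompl
      (IsScalarTower.toAlgHom B (B ⧸ q) q.ResidueField).toLinearMap := by
  have h : Algebra.algebraMapSubmonoid (B ⧸ q) q.primeCompl = nonZeroDivisors (B ⧸ q) := by
    ext z
    obtain ⟨z, rfl⟩ := Ideal.Quotient.mk_surjective z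
    rw [mem_nonZeroDivisors_iff_ne_zero, ne_eq, Ideal.Quotient.eq_zero_iff_mem]
    constructor
    · rintro ⟨y, hy, e⟩ hz
      exact hy (Ideal.Quotient.eq_zero_iff_mem.mp
        (Eq.trans e (Ideal.Quotient.eq_zero_iff_mem.mpr hz)))
    · exact fun hz ↦ ⟨z, hz, rfl⟩
  have : IsLocalization (Algebra.algebraMapSubmonoid (B ⧸ q) q.primeCompl) q.ResidueField := by
    rw [h]
    infer_instance
  exact isLocalizedModule_iff_isLocalization.mpr this

lemma exists_mul_eq_algebraMap_residueField (q : Ideal B) [q.IsPrime] (c : q.ResidueField) :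
    ∃ s ∉ q, ∃ b : B, algebraMap B q.ResidueField s * c = algebraMap B q.ResidueField b := by
  have := isLocalizedModule_residueField q
  obtain ⟨⟨b, s⟩, h⟩ := IsLocalizedModule.surj q.primeCompl
    (IsScalarTower.toAlgHom B (B ⧸ q) q.ResidueField).toLinearMap c
  obtain ⟨b, rfl⟩ := Ideal.Quotient.mk_surjective b
  exact ⟨s, s.2, b, (Algebra.smul_def _ _).symm.trans h⟩

lemma exists_smul_mem_of_one_tmul_eq_zero (q : Ideal B) [q.IsPrime] {M : Type*} [AddCommGroup M]
    [Module B M] {m : M} (h : (1 : q.ResidueField) ⊗ₜ[B] m = 0) :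
    ∃ s ∉ q, s • m ∈ (q • ⊤ : Submodule B M) := by
  have := isLocalizedModule_residueField q
  have : IsLocalizedModule q.primeCompl
      ((IsScalarTower.toAlgHom B (B ⧸ q) q.ResidueField).toLinearMap.rTensor M) :=
    inferInstanceAs (IsLocalizedModule q.primeCompl (TensorProduct.AlgebraTensorModule.rTensor B M
      (IsScalarTower.toAlgHom B (B ⧸ q) q.ResidueField).toLinearMap))
  have h1 : (IsScalarTower.toAlgHom B (B ⧸ q) q.ResidueField).toLinearMap.rTensor M
      (1 ⊗ₜ m) = 0 := by simpa using h
  obtain ⟨⟨s, hs⟩, e⟩ := (IsLocalizedModule.eq_zero_iff q.primeCompl _).mp h1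
  refine ⟨s, hs, ?_⟩
  have h2 := congr(TensorProduct.quotTensorEquivQuotSMul M q $e)
  rw [Submonoid.mk_smul, ← TensorProduct.tmul_smul, map_zero] at h2
  have h3 := TensorProduct.quotTensorEquivQuotSMul_mk_tmul (M := M) q 1 (s • m)
  rw [map_one, one_smul] at h3
  rw [h3, Submodule.Quotient.mk_eq_zero] at h2
  exact h2

/-- Linear forms over the residue field lift, up to denominators, on finite projective modules. -/
lemma exists_lift_residueField (q : Ideal B) [q.IsPrime] {M : Type*} [AddCommGroup M]
    [Module B M] [Module.Projective B M] [Module.Finite B M] (φ : M →ₗ[B] q.ResidueField) :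
    ∃ s ∉ q, ∃ ψ : M →ₗ[B] B, ∀ m, algebraMap B q.ResidueField (ψ m) =
      algebraMap B q.ResidueField s * φ m := by
  let L := Localization.AtPrime q
  let ρ : L →ₗ[B] q.ResidueField := (IsScalarTower.toAlgHom B L q.ResidueField).toLinearMap
  have hρ : Function.Surjective ρ := IsLocalRing.residue_surjective
  obtain ⟨φ', hφ'⟩ := Module.projective_lifting_property ρ φ hρ
  have : Module.FinitePresentation B M := Module.finitePresentation_of_projective B M
  obtain ⟨ψ, s, hs⟩ := Module.FinitePresentation.exists_lift_of_isLocalizedModule q.primeCompl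
    (Algebra.linearMap B L) φ'
  refine ⟨s, s.2, ψ, fun m ↦ ?_⟩
  have h1 : algebraMap B L (ψ m) = (s : B) • φ' m := LinearMap.congr_fun hs m
  have h2 : ρ (φ' m) = φ m := LinearMap.congr_fun hφ' m
  rw [IsScalarTower.algebraMap_apply B L q.ResidueField, h1, ← h2, ← Algebra.smul_def,
    ← map_smul ρ]
  rfl

/-- Locally, the center of a blowup is cut out by elements with independent differentials. -/
lemma exists_generators_of_smooth [Algebra.FormallySmooth A B] [Algebra.EssFiniteType A B] {a : A}
    {I : Ideal B} (ha : algebraMap A B a ∈ I) (hI : I.FG)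
    [Algebra (A ⧸ Ideal.span {a}) (B ⧸ I)] [IsScalarTower A (A ⧸ Ideal.span {a}) (B ⧸ I)]
    [Algebra.FormallySmooth (A ⧸ Ideal.span {a}) (B ⧸ I)] (q : Ideal B) [q.IsPrime] (hq : I ≤ q) :
    ∃ (n : ℕ) (x : Fin n → B) (D : Fin n → Derivation A B B), (∀ i, x i ∈ I) ∧
      (Matrix.of fun i j ↦ D j (x i)).det ∉ q ∧
      ∃ g ∉ q, ∀ y ∈ I, g * y ∈ Ideal.span {algebraMap A B a} ⊔ Ideal.span (Set.range x) := by
  obtain ⟨D, hD, hDI⟩ := exists_derivation_of_formallySmooth_quotient (B := B) ha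
  let κ := q.ResidueField
  let M := Ω[B⁄A]
  let v (x : I) : κ ⊗[B] M := 1 ⊗ₜ KaehlerDifferential.D A B x
  -- The `x i` are elements of `I` whose differentials form a basis of the span of `dI` in `κ(q) ⊗
  -- Ω`.
  obtain ⟨ι, f, -, hspan, hli⟩ := exists_linearIndependent' κ v
  have : Finite ι := hli.finite
  obtain ⟨n, ⟨e⟩⟩ := Finite.exists_equiv_fin ι
  let w (i : Fin n) : I := f (e.symm i)
  have hwli : LinearIndependent κ (v ∘ w) := hli.comp e.symm e.symm.injective
  have hwspan : Submodule.span κ (Set.range (v ∘ w)) = Submodule.span κ (Set.range v) := by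
    rw [← hspan]
    congr 1
    exact e.symm.surjective.range_comp (v ∘ f)
  -- Coordinate forms of this basis, extended to the whole space. They lift to derivations up to
  -- factors `s j ∉ q`, so the matrix `D j (x i)` is diagonal modulo `q` with diagonal entries the
  -- classes of the `s j`.
  have hφ : ∃ Φ : κ ⊗[B] M →ₗ[κ] (Fin n →₀ κ), ∀ i, Φ (v (w i)) = Finsupp.single i 1 := by
    obtain ⟨Φ, hΦ⟩ := LinearMap.exists_extend hwli.repr
    refine ⟨Φ, fun i ↦ ?_⟩
    have := LinearMap.congr_fun hΦ ⟨v (w i), Submodule.subset_span ⟨i, rfl⟩⟩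
    exact this.trans (hwli.repr_eq_single i _ rfl)
  obtain ⟨Φ, hΦ⟩ := hφ
  let φ (j : Fin n) : M →ₗ[B] κ :=
    ((Finsupp.lapply j ∘ₗ Φ).restrictScalars B) ∘ₗ TensorProduct.mk B κ M 1
  choose s hs ψ hψ using fun j ↦ exists_lift_residueField q (φ j)
  have hψw (i j) : algebraMap B κ (ψ j (KaehlerDifferential.D A B (w i))) =
      if i = j then algebraMap B κ (s j) else 0 := by
    rw [hψ]
    change _ * (Φ (v (w i))) j = _
    rw [hΦ, Finsupp.single_apply, mul_ite, mul_one, mul_zero]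
  refine ⟨n, fun i ↦ w i, fun j ↦ (ψ j).compDer (KaehlerDifferential.D A B), fun i ↦ (w i).2,
    fun hdet ↦ ?_, ?_⟩
  · rw [← Ideal.algebraMap_residueField_eq_zero, RingHom.map_det] at hdet
    have h1 : (algebraMap B κ).mapMatrix (Matrix.of fun i j ↦
        (ψ j).compDer (KaehlerDifferential.D A B) (w i)) =
        Matrix.diagonal fun j ↦ algebraMap B κ (s j) := by
      ext i j
      rw [Matrix.diagonal_apply]
      refine (hψw i j).trans ?_
      split_ifs with h
      · rw [h]
      · rfl
    rw [h1, Matrix.det_diagonal, Finset.prod_eq_zero_iff] at hdet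
    obtain ⟨j, -, hj⟩ := hdet
    exact hs j (Ideal.algebraMap_residueField_eq_zero.mp hj)
  · refine exists_notMem_mul_mem_of_forall hI q fun x hx ↦ ?_
    have h1 : v ⟨x, hx⟩ ∈ Submodule.span κ (Set.range (v ∘ w)) :=
      hwspan ▸ Submodule.subset_span ⟨_, rfl⟩
    obtain ⟨c, hc⟩ := (Submodule.mem_span_range_iff_exists_fun κ).mp h1
    choose t ht b hb using fun i ↦ exists_mul_eq_algebraMap_residueField q (c i)
    have hT (i) : ∃ d, ∏ i, t i = t i * d := Finset.dvd_prod_of_mem t (Finset.mem_univ i)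
    choose d hd using hT
    set T := ∏ i, t i with hTdef
    have hTq : T ∉ q := by
      rw [hTdef, Ideal.IsPrime.prod_mem_iff]
      rintro ⟨i, -, hi⟩
      exact ht i hi
    have hTc (i) : algebraMap B κ T * c i = algebraMap B κ (d i * b i) := by
      rw [map_mul, ← hb, hd i, map_mul]
      ring
    -- The relation between `dx` and the `dwᵢ` over `κ(q)` with denominators cleared by `T`.
    let m : M := T • KaehlerDifferential.D A B x -
      ∑ i, (d i * b i) • KaehlerDifferential.D A B (w i)
    have hm : (1 : κ) ⊗ₜ[B] m = 0 := by
      have h2 (r : B) (z : I) : (1 : κ) ⊗ₜ[B] (r • KaehlerDifferential.D A B z) =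
          algebraMap B κ r • v z := by
        rw [TensorProduct.tmul_smul, algebraMap_smul]
      simp only [m, TensorProduct.tmul_sub, TensorProduct.tmul_sum, h2]
      rw [h2 T ⟨x, hx⟩, ← hc, Finset.smul_sum, sub_eq_zero]
      exact Finset.sum_congr rfl fun i _ ↦ by rw [smul_smul, hTc]; rfl
    obtain ⟨s', hs', hm'⟩ := exists_smul_mem_of_one_tmul_eq_zero q hm
    let δ := D.liftKaehlerDifferential
    have hδ (z : B) : δ (KaehlerDifferential.D A B z) = D z :=
      D.liftKaehlerDifferential_comp_D z
    let π := (I ^ 2 ⊔ Ideal.span {algebraMap A B a}).mkQ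
    -- `δ` takes values in `I / (I ^ 2 + a)` and sends `dx` to the class of `x` for `x ∈ I`. Applied
    -- to `s' • m ∈ q • Ω` it turns the relation between differentials into one between elements of
    -- `I`, modulo `q I + I ^ 2 + (a)`.
    have hδI : (⊤ : Submodule B M).map δ ≤ Submodule.map π I := by
      rw [← KaehlerDifferential.span_range_derivation, Submodule.map_le_iff_le_comap,
        Submodule.span_le]
      rintro _ ⟨z, rfl⟩
      obtain ⟨y, hy, e⟩ := hDI z
      exact ⟨y, hy, e.symm.trans (hδ z).symm⟩
    have h3 : δ (s' • m) ∈ Submodule.map π (q • I) := by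
      rw [Submodule.map_smul'']
      refine Submodule.smul_mono le_rfl hδI ?_
      rw [← Submodule.map_smul'']
      exact ⟨_, hm', rfl⟩
    obtain ⟨z, hz, e⟩ := h3
    have h4 : δ (s' • m) = π (s' * (T * x - ∑ i, d i * b i * w i)) := by
      simp only [m, map_smul, map_sub, map_sum, hδ, hD x hx, fun i ↦ hD (w i) (w i).2]
      rw [← smul_eq_mul s', map_smul, map_sub, map_sum]
      rfl
    have h5 : s' * (T * x - ∑ i, d i * b i * w i) - z ∈ I ^ 2 ⊔ Ideal.span {algebraMap A B a} :=
      (Submodule.Quotient.eq _).mp (h4.symm.trans e.symm)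
    set N := Ideal.span {algebraMap A B a} ⊔ Ideal.span (Set.range fun i ↦ (w i : B)) with hN
    have h6 : I ^ 2 ⊔ Ideal.span {algebraMap A B a} ≤ N ⊔ q * I := by
      refine sup_le ?_ (le_sup_left.trans le_sup_left)
      rw [pow_two]
      exact (Ideal.mul_mono_left hq).trans le_sup_right
    have h7 : s' * ∑ i, d i * b i * w i ∈ N ⊔ q * I := by
      refine Ideal.mul_mem_left _ _ (Ideal.mem_sup_left (Ideal.mem_sup_right ?_))
      exact sum_mem fun i _ ↦ Ideal.mul_mem_left _ _ (Ideal.subset_span ⟨i, rfl⟩)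
    refine ⟨s' * T, Ideal.IsPrime.mul_notMem ‹_› hs' hTq, ?_⟩
    have h8 := add_mem (add_mem (h6 h5) (Ideal.mem_sup_right hz : z ∈ N ⊔ q * I)) h7
    convert h8 using 1
    ring

/-- The blowup of a smooth algebra in a smooth center is smooth, locally around each point of the
center. -/
lemma exists_smooth_blowup [Algebra.Smooth A B] {a : A} (haA : a ∈ nonZeroDivisors A)
    {I : Ideal B} (ha : algebraMap A B a ∈ I)
    [Algebra (A ⧸ Ideal.span {a}) (B ⧸ I)] [IsScalarTower A (A ⧸ Ideal.span {a}) (B ⧸ I)]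
    [Algebra.Smooth (A ⧸ Ideal.span {a}) (B ⧸ I)] (q : Ideal B) [q.IsPrime] (hq : I ≤ q) :
    ∃ h ∉ q, ∀ {T B' : Type*} [CommRing T] [CommRing B'] [Algebra A T] [Algebra B T]
      [IsScalarTower A B T] [IsLocalization.Away h T] [Algebra T B'] [Algebra A B']
      [IsScalarTower A T B'],
      IsAffineBlowupAlgebra B' (I.map (algebraMap B T)) (algebraMap A T a) →
        Algebra.Smooth A B' := by
  have hI : I.FG := by
    have h1 : Algebra.FinitePresentation A (A ⧸ Ideal.span {a}) :=
      Algebra.FinitePresentation.quotient ⟨{a}, by simp⟩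
    have h2 : Algebra.FinitePresentation A (B ⧸ I) :=
      .trans A (A ⧸ Ideal.span {a}) (B ⧸ I)
    have := Algebra.FinitePresentation.ker_fG_of_surjective (Ideal.Quotient.mkₐ A I)
      Ideal.Quotient.mk_surjective
    exact (Ideal.mk_ker (I := I)) ▸ this
  obtain ⟨n, x, D, hx, hdet, g, hg, hgI⟩ := exists_generators_of_smooth (A := A) ha hI q hq
  -- Inverting `g` makes `a` and the `x i` generators of `I`; inverting the determinant allows the
  -- derivations to be normalised to a dual family.
  refine ⟨g * (Matrix.of fun i j ↦ D j (x i)).det, Ideal.IsPrime.mul_notMem ‹_› hg hdet, ?_⟩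
  intro T B' _ _ _ _ _ _ _ _ _ hB'
  have hu := IsLocalization.Away.algebraMap_isUnit (S := T)
    (g * (Matrix.of fun i j ↦ D j (x i)).det)
  rw [map_mul, IsUnit.mul_iff] at hu
  have : Algebra.FormallyEtale B T :=
    Algebra.FormallyEtale.of_isLocalization
      (Submonoid.powers (g * (Matrix.of fun i j ↦ D j (x i)).det))
  have : Algebra.FormallySmooth A T := .comp A B T
  have : Algebra.FinitePresentation B T :=
    IsLocalization.Away.finitePresentation (g * (Matrix.of fun i j ↦ D j (x i)).det)
  have : Algebra.FinitePresentation A T := .trans A B T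
  let x' (i : Fin n) : T := algebraMap B T (x i)
  -- The extension of `D j` to the localization, through `T ⊗ Ω[B/A] ≃ Ω[T/A]`.
  let E (j : Fin n) : Derivation A T T :=
    (((Algebra.linearMap B T ∘ₗ (D j).liftKaehlerDifferential).liftBaseChange T) ∘ₗ
      (KaehlerDifferential.tensorKaehlerEquivOfFormallyEtale A B T).symm.toLinearMap).compDer
      (KaehlerDifferential.D A T)
  have hE (i j) : E j (x' i) = algebraMap B T (D j (x i)) := by
    change LinearMap.liftBaseChange T _ ((KaehlerDifferential.tensorKaehlerEquivOfFormallyEtale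
      A B T).symm (KaehlerDifferential.D A T (algebraMap B T (x i)))) = _
    rw [KaehlerDifferential.tensorKaehlerEquivOfFormallyEtale_symm_D_algebraMap]
    simp
  let G : Matrix (Fin n) (Fin n) T :=
    (algebraMap B T).mapMatrix (Matrix.of fun i j ↦ D j (x i))
  have hG : IsUnit G.det := by
    rw [← RingHom.map_det]
    exact hu.2
  have hD' (i k : Fin n) : (∑ j, G⁻¹ j k • E j) (x' i) = if i = k then 1 else 0 := by
    rw [← Matrix.one_apply, ← Matrix.mul_nonsing_inv G hG, Matrix.mul_apply,
      ← Derivation.coeFnAddMonoidHom_apply, map_sum, Finset.sum_apply]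
    exact Finset.sum_congr rfl fun j _ ↦ by
      rw [Derivation.coeFnAddMonoidHom_apply, Derivation.smul_apply, smul_eq_mul, hE, mul_comm]; rfl
  have : Algebra.FormallySmooth A (BlowupModel (algebraMap A T a) x') :=
    BlowupModel.formallySmooth a x' _ hD'
  have : Algebra.FinitePresentation A (BlowupModel (algebraMap A T a) x') := .trans A T _
  have : Algebra.Smooth A (BlowupModel (algebraMap A T a) x') := ⟨inferInstance, inferInstance⟩
  have hflat : Module.Flat A (BlowupModel (algebraMap A T a) x') := Algebra.Smooth.flat _ _
  -- The model is smooth before it is known to be the blowup; its flatness over `A` supplies the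
  -- regularity of `a` that identifies the two.
  have hnzd : algebraMap T (BlowupModel (algebraMap A T a) x') (algebraMap A T a) ∈
      nonZeroDivisors (BlowupModel (algebraMap A T a) x') := by
    have h1 := Module.Flat.isSMulRegular_of_nonZeroDivisors
      (M := BlowupModel (algebraMap A T a) x') haA
    rw [isSMulRegular_iff_right_eq_zero_of_smul] at h1
    rw [mem_nonZeroDivisors_iff_right]
    intro y hy
    rw [← IsScalarTower.algebraMap_apply, mul_comm, ← Algebra.smul_def] at hy
    exact h1 y hy
  have hI' : I.map (algebraMap B T) =
      Ideal.span {algebraMap A T a} ⊔ Ideal.span (Set.range x') := by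
    have h1 : (Ideal.span {algebraMap A B a} ⊔ Ideal.span (Set.range x)).map (algebraMap B T) =
        Ideal.span {algebraMap A T a} ⊔ Ideal.span (Set.range x') := by
      rw [Ideal.map_sup, Ideal.map_span, Ideal.map_span, Set.image_singleton, ← Set.range_comp,
        ← IsScalarTower.algebraMap_apply]
      rfl
    rw [← h1]
    refine le_antisymm ?_ (Ideal.map_mono (sup_le ?_ ?_))
    · rw [Ideal.map_le_iff_le_comap]
      intro y hy
      have h2 := Ideal.mem_map_of_mem (algebraMap B T) (hgI y hy)
      rw [map_mul] at h2
      exact (Ideal.unit_mul_mem_iff_mem _ hu.1).mp h2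
    · simpa [Ideal.span_le] using ha
    · rw [Ideal.span_le]
      rintro _ ⟨i, rfl⟩
      exact hx i
  obtain ⟨e⟩ := hB'.nonempty_algEquiv (BlowupModel.isAffineBlowupAlgebra _ x' hI' hnzd)
  exact Algebra.Smooth.of_equiv (e.symm.restrictScalars A)

end BlowupSmooth

end NeronBlowup

namespace NeronBlowup

/-! ### Dilatations of schemes on affine charts. -/

section Dilatation

variable {X Y : Scheme.{u}}

lemma isAffineHom_of_forall_specMap {π : Y ⟶ X}
    (H : ∀ U : X.affineOpens, ∃ (R : CommRingCat.{u}) (φ : Γ(X, U.1) ⟶ R) (f : Spec R ⟶ Y)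
      (_ : IsOpenImmersion f), π ⁻¹ᵁ U.1 = f.opensRange ∧
        f ≫ π = Spec.map φ ≫ U.2.fromSpec) : IsAffineHom π := by
  refine ⟨fun U hU ↦ ?_⟩
  obtain ⟨R, φ, f, _, e, -⟩ := H ⟨U, hU⟩
  rw [e]
  exact isAffineOpen_opensRange f

/-- Translates the gluing description of a relative spectrum (an open immersion of `Spec R` onto the
preimage of `U`) into the map on sections. -/
lemma exists_app_eq_comp_iso {π : Y ⟶ X} {U : X.Opens} (hU : IsAffineOpen U) {R : CommRingCat.{u}}
    (φ : Γ(X, U) ⟶ R) (f : Spec R ⟶ Y) [IsOpenImmersion f] (e : π ⁻¹ᵁ U = f.opensRange)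
    (h : f ≫ π = Spec.map φ ≫ hU.fromSpec) :
    ∃ i : R ≅ Γ(Y, π ⁻¹ᵁ U), π.app U = φ ≫ i.hom := by
  have : IsIso (f.app (π ⁻¹ᵁ U)) := Scheme.Hom.isIso_app _ _ (by rw [e])
  have H : f ⁻¹ᵁ (π ⁻¹ᵁ U) = ⊤ := by rw [e]; simp
  have : IsIso (f.appLE (π ⁻¹ᵁ U) ⊤ H.ge) := by
    rw [Scheme.Hom.appLE]
    have : IsIso (homOfLE H.ge) := ⟨homOfLE H.le, rfl, rfl⟩
    infer_instance
  refine ⟨(asIso (f.appLE (π ⁻¹ᵁ U) ⊤ H.ge) ≪≫ Scheme.ΓSpecIso R).symm, ?_⟩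
  have H' : ⊤ ≤ (f ≫ π) ⁻¹ᵁ U := H.ge
  have H'' : ⊤ ≤ (Spec.map φ ≫ hU.fromSpec) ⁻¹ᵁ U := by rwa [← h]
  have H3 : ⊤ ≤ Spec.map φ ⁻¹ᵁ (hU.fromSpec ⁻¹ᵁ U) := H''
  have h1 : (f ≫ π).appLE U ⊤ H' = (Spec.map φ ≫ hU.fromSpec).appLE U ⊤ H'' := by
    simp only [h]
  have h2 : π.app U ≫ f.appLE (π ⁻¹ᵁ U) ⊤ H.ge =
      hU.fromSpec.app U ≫ (Spec.map φ).appLE (hU.fromSpec ⁻¹ᵁ U) ⊤ H3 :=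
    (Scheme.Hom.comp_appLE f π U ⊤ H').symm.trans (h1.trans (Scheme.Hom.comp_appLE _ _ _ _ _))
  rw [hU.fromSpec_app_self, Category.assoc, Scheme.Hom.map_appLE] at h2
  have h3 : (Spec.map φ).appLE ⊤ ⊤ le_rfl = (Spec.map φ).appTop :=
    Scheme.Hom.appLE_eq_app _
  rw [Iso.symm_hom, Iso.eq_comp_inv, Iso.trans_hom, asIso_hom, reassoc_of% h2]
  exact congr((Scheme.ΓSpecIso Γ(X, U)).inv ≫ $h3 ≫ (Scheme.ΓSpecIso R).hom).trans
    (by rw [Scheme.ΓSpecIso_naturality, Iso.inv_hom_id_assoc])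

/-- `φ : B → B'` exhibits `B'` as the affine blowup algebra `B[I/b]`. -/
def _root_.RingHom.IsAffineBlowup {B B' : Type*} [CommRing B] [CommRing B'] (φ : B →+* B')
    (I : Ideal B) (b : B) : Prop :=
  letI := φ.toAlgebra
  IsAffineBlowupAlgebra B' I b

lemma _root_.RingHom.IsAffineBlowup.comp_equiv {B B' B'' : Type*} [CommRing B] [CommRing B']
    [CommRing B''] {φ : B →+* B'} {I : Ideal B} {b : B} (h : φ.IsAffineBlowup I b)
    (e : B' ≃+* B'') : (e.toRingHom.comp φ).IsAffineBlowup I b := by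
  let := φ.toAlgebra
  let := (e.toRingHom.comp φ).toAlgebra
  have h : IsAffineBlowupAlgebra B' I b := h
  have he (x : B) : algebraMap B B'' x = e (algebraMap B B' x) := rfl
  change IsAffineBlowupAlgebra B'' I b
  refine ⟨?_, fun x hx ↦ ?_, fun f ↦ ?_, fun x hx ↦ ?_⟩
  · rw [he]
    exact (MulEquivClass.map_nonZeroDivisors e) ▸ Submonoid.mem_map_of_mem e h.mem_nonZeroDivisors
  · rw [he, he]
    exact map_dvd e (h.dvd x hx)
  · obtain ⟨n, x, hx, hf⟩ := h.exists_pow_mul (e.symm f)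
    refine ⟨n, x, hx, ?_⟩
    rw [he, he, hf]
    simp
  · exact h.exists_pow_mul_eq_zero x (e.injective (by rw [← he, hx, map_zero]))

/-- `π : Y ⟶ X` is the dilatation of `X` in `V(I)` along `V(J)`. -/
structure IsDilatation (π : Y ⟶ X) (I J : X.IdealSheafData) : Prop where
  isAffineHom : IsAffineHom π
  isAffineBlowup : ∀ (U : X.affineOpens) (b : Γ(X, U.1)), J.ideal U = Ideal.span {b} →
    (π.app U.1).hom.IsAffineBlowup (I.ideal U) b

/-- The complement of `V(J)` in `U` is the basic open of `b`, so the subring lies in `Γ(X, U)[1/b]`,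
where `b` is a unit and the kernel of localization is `b`-power torsion. -/
lemma isAffineBlowup_toAffineBlowupAlgebra {I J : X.IdealSheafData} (h : J ≤ I)
    (U : X.affineOpens) (b : Γ(X, U.1)) (hb : J.ideal U = Ideal.span {b}) :
    RingHom.IsAffineBlowup (B := Γ(X, U.1)) (B' := affineBlowupSections I J h U)
      ((resComplement J U.1).codRestrict (affineBlowupSections I J h U)
        fun a ↦ map_mem_affineBlowupSubring _ _ _ _ a) (I.ideal U) b := by
  let φ := (resComplement J U.1).codRestrict (affineBlowupSections I J h U)
        fun a ↦ map_mem_affineBlowupSubring _ _ _ _ a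
  let := φ.toAlgebra
  let := (resComplement J U.1).toAlgebra
  have hφ (a) : ((algebraMap Γ(X, U.1) (affineBlowupSections I J h U) a : _) :
    Γ(X, U.1 ⊓ complement J)) = resComplement J U.1 a := rfl
  have hloc : IsLocalization.Away b Γ(X, U.1 ⊓ complement J) := by
    have key : ∀ (W : X.Opens) (i : W ≤ U.1) (_ : X.basicOpen b = W),
        letI := (res i).toAlgebra
        IsLocalization.Away b Γ(X, W) := by
      rintro W i rfl
      exact U.2.isLocalization_basicOpen b
    exact key _ _ (inf_complement_eq_basicOpen hb).symm
  have hunit : IsUnit (resComplement J U.1 b) :=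
    IsLocalization.Away.algebraMap_isUnit (S := Γ(X, U.1 ⊓ complement J)) b
  change IsAffineBlowupAlgebra (affineBlowupSections I J h U) _ _
  refine ⟨?_, fun x hx ↦ ?_, fun f ↦ ?_, fun x hx ↦ ?_⟩
  · rw [mem_nonZeroDivisors_iff_right]
    intro f hf
    have := congr_arg Subtype.val hf
    refine Subtype.ext ?_
    exact hunit.mul_left_eq_zero.mp this
  · obtain ⟨c, hc⟩ := hunit
    have hm : c⁻¹ * resComplement J U.1 x ∈ affineBlowupSections I J h U := by
      rw [mem_affineBlowupSections_iff hb]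
      refine ⟨1, x, by simpa using hx, ?_⟩
      rw [pow_one, ← hc, Units.mul_inv_cancel_left]
    refine ⟨⟨_, hm⟩, Subtype.ext ?_⟩
    change resComplement J U.1 x = resComplement J U.1 b * _
    rw [← hc, Units.mul_inv_cancel_left]
  · obtain ⟨n, x, hx, e⟩ := (mem_affineBlowupSections_iff hb).mp f.2
    exact ⟨n, x, hx, Subtype.ext e⟩
  · have hx' : algebraMap Γ(X, U.1) Γ(X, U.1 ⊓ complement J) x = 0 := congr_arg Subtype.val hx
    rw [IsLocalization.map_eq_zero_iff (Submonoid.powers b)] at hx'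
    obtain ⟨⟨_, n, rfl⟩, hn⟩ := hx'
    exact ⟨n, hn⟩

/-- The bridge from the construction to its characterisation; the later arguments use only
`IsDilatation`. -/
theorem isDilatation_dilatationHom {I J : X.IdealSheafData} (h : J ≤ I)
    (hJ : IsLocallyPrincipal J) : IsDilatation (dilatationHom I J h hJ) I J := by
  have key (U : X.affineOpens) : ∃ (f : Spec ((affineBlowupAlgebra I J h).obj (.op U)) ⟶
      dilatation I J h hJ) (_ : IsOpenImmersion f),
      dilatationHom I J h hJ ⁻¹ᵁ U.1 = f.opensRange ∧
        f ≫ dilatationHom I J h hJ =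
          Spec.map ((toAffineBlowupAlgebra I J h).app (.op U)) ≫ U.2.fromSpec := by
    have hα := coequifibered_toAffineBlowupAlgebra h hJ
    refine ⟨(Scheme.AffineZariskiSite.relativeGluingData hα).cover.f U,
      (Scheme.AffineZariskiSite.relativeGluingData hα).cover.map_prop U, ?_, ?_⟩
    · simpa using! (Scheme.AffineZariskiSite.relativeGluingData
        hα).toBase_preimage_eq_opensRange_ι U
    · refine ((Scheme.AffineZariskiSite.relativeGluingData hα).ι_toBase U).trans ?_
      exact (Category.assoc (Spec.map ((toAffineBlowupAlgebra I J h).app (.op U)))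
        U.2.isoSpec.inv U.1.ι).trans
          (congr_arg (Spec.map ((toAffineBlowupAlgebra I J h).app (.op U)) ≫ ·) U.2.isoSpec_inv_ι)
  refine ⟨isAffineHom_of_forall_specMap fun U ↦ ?_, fun U b hb ↦ ?_⟩
  · obtain ⟨f, hf, h1, h2⟩ := key U
    exact ⟨_, _, f, hf, h1, h2⟩
  · obtain ⟨f, hf, h1, h2⟩ := key U
    obtain ⟨e, he⟩ := exists_app_eq_comp_iso U.2 _ f h1 h2
    rw [he]
    exact (isAffineBlowup_toAffineBlowupAlgebra h U b hb).comp_equiv e.commRingCatIsoToRingEquiv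

end Dilatation

end NeronBlowup

namespace NeronBlowup

/-! ### Pullback of ideal sheaves on charts, and Cartier ideals. -/

section IdealSheaf

variable {X Y : Scheme.{u}}

lemma ideal_comap_fromSpec (L : X.IdealSheafData) {V : X.Opens} (hV : IsAffineOpen V) :
    (L.comap hV.fromSpec).ideal ⟨⊤, isAffineOpen_top _⟩ =
      (L.ideal ⟨V, hV⟩).map (Scheme.ΓSpecIso Γ(X, V)).inv.hom := by
  have hle : hV.fromSpec ''ᵁ ⊤ ≤ V := by simp
  have hle' : (⊤ : (Spec Γ(X, V)).Opens) ≤ hV.fromSpec ⁻¹ᵁ V := by simp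
  have h1 := L.map_ideal (U := ⟨hV.fromSpec ''ᵁ ⊤,
    (isAffineOpen_top _).image_of_isOpenImmersion _⟩) (V := ⟨V, hV⟩) hle
  rw [Scheme.IdealSheafData.ideal_comap_of_isOpenImmersion, ← h1]
  have h2 : X.presheaf.map (homOfLE hle).op ≫ (hV.fromSpec.appIso ⊤).hom =
      (Scheme.ΓSpecIso Γ(X, V)).inv := by
    rw [Scheme.Hom.appIso_hom', Scheme.Hom.map_appLE]
    have : hV.fromSpec.appLE V ⊤ hle' = hV.fromSpec.app V ≫
      (Spec Γ(X, V)).presheaf.map (homOfLE hle').op := rfl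
    rw [this, hV.fromSpec_app_self, Category.assoc, ← Functor.map_comp,
      Subsingleton.elim ((eqToHom hV.fromSpec_preimage_self).op ≫ (homOfLE hle').op) (𝟙 _)]
    simp
  rw [← h2, CommRingCat.hom_comp, ← Ideal.map_map]
  exact (Ideal.map_symm (hV.fromSpec.appIso ⊤).symm.commRingCatIsoToRingEquiv).symm

/-- Reduces to a morphism of spectra, where the pulled back ideal is the extended ideal. This turns
conditions on ideal sheaves into conditions on ring maps. -/
lemma ideal_comap_eq_map_appLE (f : X ⟶ Y) (K : Y.IdealSheafData) (U : Y.affineOpens)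
    (V : X.affineOpens) (e : V.1 ≤ f ⁻¹ᵁ U.1) :
    (K.comap f).ideal V = (K.ideal U).map (f.appLE U.1 V.1 e).hom := by
  obtain ⟨U, hU⟩ := U
  obtain ⟨V, hV⟩ := V
  have h1 := ideal_comap_fromSpec (K.comap f) hV
  rw [← Scheme.IdealSheafData.comap_comp, ← IsAffineOpen.SpecMap_appLE_fromSpec f hU hV e,
    Scheme.IdealSheafData.comap_comp, ideal_comap_top_of_isAffine, ideal_comap_fromSpec _ hU,
    Ideal.map_map, ← CommRingCat.hom_comp] at h1
  have h2 : (Scheme.ΓSpecIso Γ(Y, U)).inv ≫ (Spec.map (f.appLE U V e)).appTop =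
      f.appLE U V e ≫ (Scheme.ΓSpecIso Γ(X, V)).inv :=
    (Scheme.ΓSpecIso_inv_naturality (f.appLE U V e)).symm
  rw [h2, CommRingCat.hom_comp, ← Ideal.map_map] at h1
  have h3 (I : Ideal Γ(X, V)) : (I.map (Scheme.ΓSpecIso Γ(X, V)).inv.hom).map
      (Scheme.ΓSpecIso Γ(X, V)).hom.hom = I := by
    rw [Ideal.map_map, ← CommRingCat.hom_comp, Iso.inv_hom_id, CommRingCat.hom_id, Ideal.map_id]
  rw [← h3 ((K.comap f).ideal ⟨V, hV⟩), ← h1, h3]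

/-- An ideal sheaf that is locally generated by a nonzerodivisor. -/
def IsCartier (K : X.IdealSheafData) : Prop :=
  ∀ x : X, ∃ U : X.affineOpens, x ∈ U.1 ∧
    ∃ b ∈ nonZeroDivisors Γ(X, U.1), K.ideal U = Ideal.span {b}

lemma exists_affineOpen_le (x : X) {W : X.Opens} (hx : x ∈ W) :
    ∃ U : X.affineOpens, x ∈ U.1 ∧ U.1 ≤ W := by
  obtain ⟨_, ⟨U, hU, rfl⟩, hxU, hUW⟩ :=
    X.isBasis_affineOpens.exists_subset_of_mem_open (show x ∈ (W : Set X) from hx) W.2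
  exact ⟨⟨U, hU⟩, hxU, hUW⟩

lemma _root_.RingHom.Flat.map_mem_nonZeroDivisors {A B : Type*} [CommRing A] [CommRing B]
    {φ : A →+* B} (hφ : φ.Flat) {a : A} (ha : a ∈ nonZeroDivisors A) :
    φ a ∈ nonZeroDivisors B := by
  let := φ.toAlgebra
  have : Module.Flat A B := hφ
  have h1 := Module.Flat.isSMulRegular_of_nonZeroDivisors (M := B) ha
  rw [isSMulRegular_iff_right_eq_zero_of_smul] at h1
  rw [mem_nonZeroDivisors_iff_right]
  intro y hy
  refine h1 y ?_
  rwa [Algebra.smul_def, mul_comm]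

lemma IsCartier.comap_of_flat {K : Y.IdealSheafData} (hK : IsCartier K) (f : X ⟶ Y) [Flat f] :
    IsCartier (K.comap f) := by
  intro x
  obtain ⟨U, hxU, b, hb, hU⟩ := hK (f x)
  obtain ⟨V, hxV, e⟩ := exists_affineOpen_le x (W := f ⁻¹ᵁ U.1) hxU
  refine ⟨V, hxV, (f.appLE U.1 V.1 e).hom b,
    (f.flat_appLE U.2 V.2 e).map_mem_nonZeroDivisors hb, ?_⟩
  rw [ideal_comap_eq_map_appLE f K U V e, hU, Ideal.map_span, Set.image_singleton]

lemma res_mem_nonZeroDivisors {U V : X.affineOpens} (h : V.1 ≤ U.1) {b : Γ(X, U.1)}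
    (hb : b ∈ nonZeroDivisors Γ(X, U.1)) : res h b ∈ nonZeroDivisors Γ(X, V.1) := by
  have h1 := ((𝟙 X : X ⟶ X).flat_appLE U.2 V.2 h).map_mem_nonZeroDivisors hb
  convert! h1 using 1

lemma IsCartier.exists_le {K : X.IdealSheafData} (hK : IsCartier K) (x : X)
    {W : X.Opens} (hx : x ∈ W) : ∃ U : X.affineOpens, x ∈ U.1 ∧ U.1 ≤ W ∧
      ∃ b ∈ nonZeroDivisors Γ(X, U.1), K.ideal U = Ideal.span {b} := by
  obtain ⟨U, hxU, b, hb, hU⟩ := hK x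
  obtain ⟨V, hxV, e⟩ := exists_affineOpen_le x (W := U.1 ⊓ W) ⟨hxU, hx⟩
  refine ⟨V, hxV, e.trans inf_le_right, res (e.trans inf_le_left) b,
    res_mem_nonZeroDivisors _ hb, ?_⟩
  rw [← K.map_ideal (U := V) (V := U) (e.trans inf_le_left), hU, Ideal.map_span,
    Set.image_singleton]
  rfl

lemma eq_zero_of_forall_res_eq_zero {U : X.Opens} (f : Γ(X, U))
    (H : ∀ x ∈ U, ∃ (V : X.Opens) (h : V ≤ U), x ∈ V ∧ res h f = 0) : f = 0 := by
  choose! V hV hx hf using H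
  refine TopCat.Sheaf.eq_of_locally_eq' X.sheaf (fun x : U ↦ V x.1) U
    (fun x ↦ homOfLE (hV x.1 x.2)) (fun x hxU ↦ ?_) _ _ fun x ↦ ?_
  · exact TopologicalSpace.Opens.mem_iSup.mpr ⟨⟨x, hxU⟩, hx x hxU⟩
  · exact (hf x.1 x.2).trans (map_zero (res (hV x.1 x.2))).symm

lemma mem_nonZeroDivisors_of_span_eq {R : Type*} [CommRing R] {b c : R}
    (hc : c ∈ nonZeroDivisors R) (h : Ideal.span {b} = Ideal.span {c}) :
    b ∈ nonZeroDivisors R := by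
  have h1 : b ∣ c := Ideal.mem_span_singleton.mp (h ▸ Ideal.mem_span_singleton_self c)
  obtain ⟨d, rfl⟩ := h1
  exact (mul_mem_nonZeroDivisors.mp hc).1

/-- The definition provides some regular generator near each point. A given generator `b` on `U`
spans the same ideal as these after restriction, so it is locally regular, and a section killed by
`b` vanishes locally. -/
lemma IsCartier.mem_nonZeroDivisors {K : X.IdealSheafData} (hK : IsCartier K) (U : X.affineOpens)
    {b : Γ(X, U.1)} (hb : K.ideal U = Ideal.span {b}) : b ∈ nonZeroDivisors Γ(X, U.1) := by
  rw [mem_nonZeroDivisors_iff_right]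
  intro f hf
  refine eq_zero_of_forall_res_eq_zero f fun x hx ↦ ?_
  obtain ⟨V, hxV, hVU, c, hc, hV⟩ := hK.exists_le x hx
  refine ⟨V.1, hVU, hxV, ?_⟩
  rw [← K.map_ideal (U := V) (V := U) hVU, hb, Ideal.map_span, Set.image_singleton] at hV
  have h1 : res hVU b ∈ nonZeroDivisors Γ(X, V.1) := mem_nonZeroDivisors_of_span_eq hc hV
  refine (mem_nonZeroDivisors_iff_right.mp h1) _ ?_
  rw [← map_mul, hf, map_zero]

lemma le_of_forall_exists_affineOpen {I J : X.IdealSheafData}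
    (H : ∀ x : X, ∃ U : X.affineOpens, x ∈ U.1 ∧ I.ideal U ≤ J.ideal U) : I ≤ J := by
  choose U hx hU using H
  refine Scheme.IdealSheafData.le_of_iSup_eq_top U ?_ hU
  exact eq_top_iff.mpr fun x _ ↦ TopologicalSpace.Opens.mem_iSup.mpr ⟨x, hx x⟩

lemma hom_ext_of_appLE {f g : X ⟶ Y}
    (H : ∀ x : X, ∃ (V : X.affineOpens) (U : Y.affineOpens) (hf : V.1 ≤ f ⁻¹ᵁ U.1)
      (hg : V.1 ≤ g ⁻¹ᵁ U.1), x ∈ V.1 ∧ f.appLE U.1 V.1 hf = g.appLE U.1 V.1 hg) : f = g := by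
  choose V U hf hg hx h using H
  refine Scheme.Cover.hom_ext (X.openCoverOfIsOpenCover (fun x ↦ (V x).1) ?_) _ _ fun x ↦ ?_
  · exact eq_top_iff.mpr fun x _ ↦ TopologicalSpace.Opens.mem_iSup.mpr ⟨x, hx x⟩
  · change (V x).1.ι ≫ f = (V x).1.ι ≫ g
    rw [← cancel_epi (V x).2.isoSpec.inv]
    have h1 := IsAffineOpen.SpecMap_appLE_fromSpec f (U x).2 (V x).2 (hf x)
    rw [h x, IsAffineOpen.SpecMap_appLE_fromSpec g (U x).2 (V x).2 (hg x)] at h1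
    rw [(V x).2.isoSpec_inv_ι_assoc, (V x).2.isoSpec_inv_ι_assoc, h1]

end IdealSheaf

end NeronBlowup

namespace NeronBlowup

/-! ### The universal property of dilatations. -/

section UniversalProperty

lemma _root_.RingHom.IsAffineBlowup.hom_ext {B B' R : Type*} [CommRing B] [CommRing B']
    [CommRing R] {φ : B →+* B'} {I : Ideal B} {b : B} (h : φ.IsAffineBlowup I b) {ψ₁ ψ₂ : B' →+* R}
    (hb : ψ₁ (φ b) ∈ nonZeroDivisors R) (e : ψ₁.comp φ = ψ₂.comp φ) : ψ₁ = ψ₂ := by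
  let := φ.toAlgebra
  let := (ψ₁.comp φ).toAlgebra
  have h : IsAffineBlowupAlgebra B' I b := h
  have := h.algHom_ext (R := R) hb ⟨ψ₁, fun _ ↦ rfl⟩ ⟨ψ₂, fun x ↦ (DFunLike.congr_fun e x).symm⟩
  exact congr_arg AlgHom.toRingHom this

lemma _root_.RingHom.IsAffineBlowup.exists_hom {B B' R : Type*} [CommRing B] [CommRing B']
    [CommRing R] {φ : B →+* B'} {I : Ideal B} {b : B} (h : φ.IsAffineBlowup I b) {ρ : B →+* R}
    (hb : ρ b ∈ nonZeroDivisors R) (hI : I.map ρ ≤ Ideal.span {ρ b}) :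
    ∃ ψ : B' →+* R, ψ.comp φ = ρ := by
  let := φ.toAlgebra
  let := ρ.toAlgebra
  have h : IsAffineBlowupAlgebra B' I b := h
  obtain ⟨ψ⟩ := h.nonempty_algHom (R := R) hb fun x hx ↦
    Ideal.mem_span_singleton.mp (hI (Ideal.mem_map_of_mem ρ hx))
  exact ⟨ψ.toRingHom, RingHom.ext fun x ↦ ψ.commutes x⟩

lemma _root_.RingHom.IsAffineBlowup.mem_nonZeroDivisors {B B' : Type*} [CommRing B] [CommRing B']
    {φ : B →+* B'} {I : Ideal B} {b : B} (h : φ.IsAffineBlowup I b) : φ b ∈ nonZeroDivisors B' :=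
  letI := φ.toAlgebra
  IsAffineBlowupAlgebra.mem_nonZeroDivisors (B' := B') h

lemma _root_.RingHom.IsAffineBlowup.map_le {B B' : Type*} [CommRing B] [CommRing B']
    {φ : B →+* B'} {I : Ideal B} {b : B} (h : φ.IsAffineBlowup I b) :
    I.map φ ≤ Ideal.span {φ b} :=
  letI := φ.toAlgebra
  Ideal.map_le_iff_le_comap.mpr fun x hx ↦ Ideal.mem_span_singleton.mpr
    (IsAffineBlowupAlgebra.dvd (B' := B') h x hx)

variable {X Y T : Scheme.{u}} {π : Y ⟶ X} {I J : X.IdealSheafData}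

lemma IsDilatation.exists_chart (h : IsDilatation π I J) (hJ : IsLocallyPrincipal J) (y : Y) :
    ∃ (U : X.affineOpens) (V : Y.affineOpens), V.1 = π ⁻¹ᵁ U.1 ∧ y ∈ V.1 ∧
      ∃ b : Γ(X, U.1), J.ideal U = Ideal.span {b} := by
  have := h.isAffineHom
  obtain ⟨U, hU, b, hb⟩ := hJ (π y)
  exact ⟨U, ⟨π ⁻¹ᵁ U.1, U.2.preimage π⟩, rfl, hU, b, hb⟩

lemma appLE_preimage (f : Y ⟶ X) (U : X.Opens) : f.appLE U (f ⁻¹ᵁ U) le_rfl = f.app U :=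
  Scheme.Hom.appLE_eq_app _

theorem IsDilatation.isCartier_comap (h : IsDilatation π I J) (hJ : IsLocallyPrincipal J) :
    IsCartier (J.comap π) := by
  intro y
  obtain ⟨U, ⟨_, hV⟩, rfl, hy, b, hb⟩ := h.exists_chart hJ y
  refine ⟨⟨_, hV⟩, hy, (π.app U.1).hom b, (h.isAffineBlowup U b hb).mem_nonZeroDivisors, ?_⟩
  rw [ideal_comap_eq_map_appLE π J U ⟨_, hV⟩ le_rfl, appLE_preimage, hb, Ideal.map_span,
    Set.image_singleton]

theorem IsDilatation.comap_le (h : IsDilatation π I J) (hJ : IsLocallyPrincipal J) :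
    I.comap π ≤ J.comap π := by
  refine le_of_forall_exists_affineOpen fun y ↦ ?_
  obtain ⟨U, ⟨_, hV⟩, rfl, hy, b, hb⟩ := h.exists_chart hJ y
  refine ⟨⟨_, hV⟩, hy, ?_⟩
  rw [ideal_comap_eq_map_appLE π J U ⟨_, hV⟩ le_rfl,
    ideal_comap_eq_map_appLE π I U ⟨_, hV⟩ le_rfl, appLE_preimage, hb, Ideal.map_span,
    Set.image_singleton]
  exact (h.isAffineBlowup U b hb).map_le

lemma IsCartier.appLE_mem_nonZeroDivisors {t : T ⟶ X} (hT : IsCartier (J.comap t))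
    {U : X.affineOpens} {b : Γ(X, U.1)} (hb : J.ideal U = Ideal.span {b}) (W : T.affineOpens)
    (e : W.1 ≤ t ⁻¹ᵁ U.1) : (t.appLE U.1 W.1 e).hom b ∈ nonZeroDivisors Γ(T, W.1) := by
  refine hT.mem_nonZeroDivisors W ?_
  rw [ideal_comap_eq_map_appLE t J U W e, hb, Ideal.map_span, Set.image_singleton]

theorem IsDilatation.hom_ext (h : IsDilatation π I J) (hJ : IsLocallyPrincipal J)
    {t₁ t₂ : T ⟶ Y} (hT : IsCartier (J.comap (t₁ ≫ π))) (e : t₁ ≫ π = t₂ ≫ π) : t₁ = t₂ := by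
  refine hom_ext_of_appLE fun x ↦ ?_
  have := h.isAffineHom
  obtain ⟨U, hxU, b, hb⟩ := hJ ((t₁ ≫ π) x)
  obtain ⟨W, hxW, hW⟩ := exists_affineOpen_le x (W := (t₁ ≫ π) ⁻¹ᵁ U.1) hxU
  have hW' : W.1 ≤ (t₂ ≫ π) ⁻¹ᵁ U.1 := e ▸ hW
  refine ⟨W, ⟨π ⁻¹ᵁ U.1, U.2.preimage π⟩, hW, hW', hxW, CommRingCat.hom_ext ?_⟩
  have h1 : (t₁ ≫ π).appLE U.1 W.1 hW = π.app U.1 ≫ t₁.appLE (π ⁻¹ᵁ U.1) W.1 hW :=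
    Scheme.Hom.comp_appLE _ _ _ _ _
  have h2 : (t₂ ≫ π).appLE U.1 W.1 hW' = π.app U.1 ≫ t₂.appLE (π ⁻¹ᵁ U.1) W.1 hW' :=
    Scheme.Hom.comp_appLE _ _ _ _ _
  have h3 : (t₁ ≫ π).appLE U.1 W.1 hW = (t₂ ≫ π).appLE U.1 W.1 hW' := by simp only [e]
  refine (h.isAffineBlowup U b hb).hom_ext ?_ ?_
  · have := hT.appLE_mem_nonZeroDivisors hb W hW
    rwa [h1] at this
  · rw [← CommRingCat.hom_comp, ← CommRingCat.hom_comp, ← h1, ← h2, h3]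

/-- On an affine `W` mapping into a chart the Cartier condition makes `b` regular and the inclusion
of ideals makes `b` divide `I`, so the ring-level universal property applies. -/
lemma IsDilatation.exists_local_lift (h : IsDilatation π I J) {t : T ⟶ X}
    (hT : IsCartier (J.comap t)) (hle : I.comap t ≤ J.comap t)
    {U : X.affineOpens} {b : Γ(X, U.1)} (hb : J.ideal U = Ideal.span {b}) (W : T.affineOpens)
    (e : W.1 ≤ t ⁻¹ᵁ U.1) : ∃ f : W.1.toScheme ⟶ Y, f ≫ π = W.1.ι ≫ t := by
  have := h.isAffineHom
  have h1 := hle W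
  rw [ideal_comap_eq_map_appLE t J U W e, ideal_comap_eq_map_appLE t I U W e, hb, Ideal.map_span,
    Set.image_singleton] at h1
  obtain ⟨ψ, hψ⟩ := (h.isAffineBlowup U b hb).exists_hom (hT.appLE_mem_nonZeroDivisors hb W e) h1
  refine ⟨W.2.isoSpec.hom ≫ Spec.map (CommRingCat.ofHom ψ) ≫ (U.2.preimage π).fromSpec, ?_⟩
  have h2 := IsAffineOpen.SpecMap_appLE_fromSpec π U.2 (U.2.preimage π) le_rfl
  rw [appLE_preimage] at h2
  have h3 := IsAffineOpen.SpecMap_appLE_fromSpec t U.2 W.2 e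
  have h4 : π.app U.1 ≫ CommRingCat.ofHom ψ = t.appLE U.1 W.1 e := CommRingCat.hom_ext hψ
  rw [Category.assoc, Category.assoc, ← h2, ← Spec.map_comp_assoc, h4, h3]
  simp [IsAffineOpen.fromSpec]

theorem IsDilatation.exists_lift (h : IsDilatation π I J) (hJ : IsLocallyPrincipal J) {t : T ⟶ X}
    (hT : IsCartier (J.comap t)) (hle : I.comap t ≤ J.comap t) : ∃ t' : T ⟶ Y, t' ≫ π = t := by
  have key (x : T) : ∃ (W : T.affineOpens) (f : W.1.toScheme ⟶ Y), x ∈ W.1 ∧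
      f ≫ π = W.1.ι ≫ t := by
    obtain ⟨U, hxU, b, hb⟩ := hJ (t x)
    obtain ⟨W, hxW, hW⟩ := exists_affineOpen_le x (W := t ⁻¹ᵁ U.1) hxU
    obtain ⟨f, hf⟩ := h.exists_local_lift hT hle hb W hW
    exact ⟨W, f, hxW, hf⟩
  choose W f hx hf using key
  let 𝒰 : T.OpenCover := T.openCoverOfIsOpenCover (fun x ↦ (W x).1)
    (eq_top_iff.mpr fun x _ ↦ TopologicalSpace.Opens.mem_iSup.mpr ⟨x, hx x⟩)
  -- The overlap is open in `T`, so `J` is still Cartier on it and uniqueness of lifts applies.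
  have hcompat (x y : T) : pullback.fst (W x).1.ι (W y).1.ι ≫ f x = pullback.snd _ _ ≫ f y := by
    refine h.hom_ext hJ ?_ ?_
    · rw [Category.assoc, hf, ← Category.assoc, Scheme.IdealSheafData.comap_comp]
      exact hT.comap_of_flat _
    · rw [Category.assoc, Category.assoc, hf, hf, pullback.condition_assoc]
  refine ⟨Scheme.Cover.glueMorphisms 𝒰 f hcompat, ?_⟩
  refine Scheme.Cover.hom_ext 𝒰 _ _ fun x ↦ ?_
  rw [← Category.assoc]
  exact (congr_arg (· ≫ π) (Scheme.Cover.ι_glueMorphisms 𝒰 f hcompat x)).trans (hf x)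

end UniversalProperty

end NeronBlowup

namespace NeronBlowup

/-! ### Transport of a group structure along a representable subfunctor. -/

section GroupObject

open MonoidalCategory CartesianMonoidalCategory MonObj

variable {C D : Type*} [Category* C] [Category* D] [CartesianMonoidalCategory C]
  [CartesianMonoidalCategory D]

/-- If `π : N ⟶ G` represents, among a class of test objects containing `N` and closed under
finite products, the subfunctor of those `t : T ⟶ G` for which `F.map t` factors through the
subgroup `H` of `F.obj G`, then `N` is a group object and `π` is a homomorphism. -/
theorem exists_grpObj_of_lift (F : C ⥤ D) [F.Monoidal] {N G : C} [GrpObj G] {H : D} [GrpObj H]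
    (i : H ⟶ F.obj G) [IsMonHom i] (π : N ⟶ G) (Q : C → Prop) (h1 : Q (𝟙_ C)) (hN : Q N)
    (hmul : ∀ X Y, Q X → Q Y → Q (X ⊗ Y))
    (p : F.obj N ⟶ H) (hp : p ≫ i = F.map π)
    (hext : ∀ T, Q T → ∀ f g : T ⟶ N, f ≫ π = g ≫ π → f = g)
    (hlift : ∀ T, Q T → ∀ (t : T ⟶ G) (t₀ : F.obj T ⟶ H), t₀ ≫ i = F.map t →
      ∃ t' : T ⟶ N, t' ≫ π = t) :
    ∃ _ : GrpObj N, IsMonHom π := by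
  -- The product in `G` of the two universal points of `N`. Its image under `F` lies in `H`, because
  -- it is the product in `H` of the two composites with `p`.
  obtain ⟨m, hm⟩ := hlift (N ⊗ N) (hmul _ _ hN hN) ((fst N N ≫ π) * (snd N N ≫ π))
    ((F.map (fst N N) ≫ p) * (F.map (snd N N) ≫ p)) (by
      rw [MonObj.mul_comp, Functor.map_mul, Category.assoc, Category.assoc, hp, F.map_comp,
        F.map_comp])
  obtain ⟨e, he⟩ := hlift (𝟙_ C) h1 1 1 (by rw [MonObj.one_comp, Functor.map_one])
  obtain ⟨v, hv⟩ := hlift N hN π⁻¹ p⁻¹ (by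
    have h2 : p⁻¹ ≫ i = (p ≫ i)⁻¹ := map_inv (IsMonHom.monoidHom i (F.obj N)) p
    have h3 : F.map π⁻¹ = (F.map π)⁻¹ := map_inv F.homMonoidHom π
    rw [h2, h3, hp])
  -- Each axiom is an equality of two maps into `N` from an allowed test object; by `hext` it may be
  -- checked after composing with `π`, where it is the axiom of `G`.
  let M : MonObj N :=
    { one := e
      mul := m
      one_mul := hext _ (hmul _ _ h1 hN) _ _ (by
        simp [hm, MonObj.comp_mul, he, leftUnitor_hom])
      mul_one := hext _ (hmul _ _ hN h1) _ _ (by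
        simp [hm, MonObj.comp_mul, he, rightUnitor_hom])
      mul_assoc := hext _ (hmul _ _ (hmul _ _ hN hN) hN) _ _ (by
        simp [hm, MonObj.comp_mul, _root_.mul_assoc]) }
  refine ⟨{ inv := v, left_inv := hext _ hN _ _ ?_, right_inv := hext _ hN _ _ ?_ }, ⟨?_, ?_⟩⟩
  · change (lift v (𝟙 N) ≫ m) ≫ π = (toUnit N ≫ e) ≫ π
    simp [hm, MonObj.comp_mul, he, hv]
  · change (lift (𝟙 N) v ≫ m) ≫ π = (toUnit N ≫ e) ≫ π
    simp [hm, MonObj.comp_mul, he, hv]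
  · change e ≫ π = _
    rw [he, MonObj.one_eq_one]
  · change m ≫ π = _
    rw [hm, MonObj.mul_eq_mul, MonObj.comp_mul]
    simp

end GroupObject

end NeronBlowup

namespace NeronBlowup

/-! ### Universal property, base change and group law of the Néron blowup. -/

section Neron

variable {S S₀ : Scheme.{u}} {j : S₀ ⟶ S} {G : Over S} {H : Over S₀}

lemma pullback_map_left_fst {T : Over S} (t : T ⟶ G) :
    ((Over.pullback j).map t).left ≫ pullback.fst G.hom j = pullback.fst T.hom j ≫ t.left :=
  pullback.lift_fst _ _ _

/-- The new center, as a subscheme of `G ×_S S'`, is the preimage of the old one. Hence the ideal of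
the new center is the pulled back ideal (`centerIdeal_baseChangeCenter`). -/
lemma isPullback_baseChangeCenter {S' : Scheme.{u}} (g : S' ⟶ S)
    (i : H ⟶ (Over.pullback j).obj G) :
    IsPullback (pullback.fst H.hom (pullback.snd g j))
      ((baseChangeCenter g i).left ≫
        pullback.fst ((Over.pullback g).obj G).hom (pullback.fst g j))
      (i.left ≫ pullback.fst G.hom j) (pullback.fst G.hom g) := by
  have h1 : (baseChangeCenter g i).left ≫
      pullback.fst ((Over.pullback g).obj G).hom (pullback.fst g j) = pullback.lift
        (pullback.fst H.hom (pullback.snd g j) ≫ i.left ≫ pullback.fst G.hom j)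
        (pullback.snd H.hom (pullback.snd g j) ≫ pullback.fst g j) (by
          have h : i.left ≫ pullback.snd G.hom j = H.hom := Over.w i
          rw [Category.assoc, Category.assoc, Category.assoc, pullback.condition,
            reassoc_of% h, pullback.condition_assoc, pullback.condition]) :=
    pullback.lift_fst _ _ _
  have hH : (i.left ≫ pullback.fst G.hom j) ≫ G.hom = H.hom ≫ j := by
    have h : i.left ≫ pullback.snd G.hom j = H.hom := Over.w i
    rw [Category.assoc, pullback.condition, reassoc_of% h]
  have h2 : IsPullback (pullback.fst H.hom (pullback.snd g j))
      (pullback.snd H.hom (pullback.snd g j) ≫ pullback.fst g j) (H.hom ≫ j) g :=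
    ((IsPullback.of_hasPullback H.hom (pullback.snd g j)).flip.paste_horiz
      (IsPullback.of_hasPullback g j)).flip
  refine (IsPullback.of_right (h₁₂ := pullback.snd G.hom g) (h₂₂ := G.hom) (v₁₃ := g) ?_ ?_
    (IsPullback.of_hasPullback G.hom g).flip).flip
  · rw [h1, pullback.lift_snd, hH]
    exact h2.flip
  · rw [h1, pullback.lift_fst]

variable [IsClosedImmersion j]

lemma divisorIdeal_eq_comap_hom (G : Over S) : divisorIdeal j G = j.ker.comap G.hom :=
  Scheme.IdealSheafData.ker_fst_of_isClosedImmersion _ _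

lemma comap_divisorIdeal {T : Over S} (t : T ⟶ G) :
    (divisorIdeal j G).comap t.left = divisorIdeal j T := by
  rw [divisorIdeal_eq_comap_hom, divisorIdeal_eq_comap_hom,
    ← Scheme.IdealSheafData.comap_comp, Over.w]

/-- The restriction of `t` over `S₀` factors through `H` if and only if the pulled back ideal
of `H` is contained in the ideal of `T ×_S S₀`. -/
theorem exists_factorization_iff (i : H ⟶ (Over.pullback j).obj G) [IsClosedImmersion i.left]
    {T : Over S} (t : T ⟶ G) :
    (∃ t₀ : (Over.pullback j).obj T ⟶ H, t₀ ≫ i = (Over.pullback j).map t) ↔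
      (centerIdeal i).comap t.left ≤ divisorIdeal j T := by
  rw [← Scheme.IdealSheafData.le_map_iff_comap_le, divisorIdeal,
    Scheme.IdealSheafData.map_ker, centerIdeal]
  constructor
  · rintro ⟨t₀, ht₀⟩
    rw [← pullback_map_left_fst, ← ht₀, Over.comp_left, Category.assoc]
    exact Scheme.Hom.le_ker_comp t₀.left (i.left ≫ pullback.fst G.hom j)
  · intro h
    have hi : i.left ≫ pullback.snd G.hom j = H.hom := Over.w i
    let l := IsClosedImmersion.lift (i.left ≫ pullback.fst G.hom j)
      (pullback.fst T.hom j ≫ t.left) h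
    have hl : l ≫ i.left ≫ pullback.fst G.hom j = pullback.fst T.hom j ≫ t.left :=
      IsClosedImmersion.lift_fac _ _ h
    refine ⟨Over.homMk l ?_, ?_⟩
    · change l ≫ H.hom = pullback.snd T.hom j
      have h1 := congr($hl ≫ G.hom)
      rw [Category.assoc, Category.assoc, Category.assoc, Over.w t] at h1
      rw [← cancel_mono j, ← hi, Category.assoc, Category.assoc, ← pullback.condition,
        ← pullback.condition, h1]
    · refine Over.OverMorphism.ext (pullback.hom_ext ?_ ?_)
      · rw [pullback_map_left_fst]
        simpa using hl
      · exact (Over.w _).trans (Over.w _).symm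

lemma isRegularOver_iff {T : Over S} : IsRegularOver j T ↔ IsCartier (divisorIdeal j T) := Iff.rfl

lemma isRegularOver_of_flat (hj : IsEffectiveCartierDivisor j) (T : Over S) [Flat T.hom] :
    IsRegularOver j T := by
  rw [isRegularOver_iff, divisorIdeal_eq_comap_hom]
  exact IsCartier.comap_of_flat hj T.hom

variable (hj : IsLocallyPrincipal j.ker) (i : H ⟶ (Over.pullback j).obj G)

theorem isDilatation_neronBlowupHom : IsDilatation (neronBlowupHom hj i).left (centerIdeal i)
    (divisorIdeal j G) :=
  isDilatation_dilatationHom _ (isLocallyPrincipal_divisorIdeal hj G)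

theorem isRegularOver_neronBlowup : IsRegularOver j (neronBlowup hj i) := by
  rw [isRegularOver_iff, ← comap_divisorIdeal (neronBlowupHom hj i)]
  exact (isDilatation_neronBlowupHom hj i).isCartier_comap (isLocallyPrincipal_divisorIdeal hj G)

theorem exists_neronBlowup_restriction [IsClosedImmersion i.left] :
    ∃ p : (Over.pullback j).obj (neronBlowup hj i) ⟶ H,
      p ≫ i = (Over.pullback j).map (neronBlowupHom hj i) := by
  rw [exists_factorization_iff, ← comap_divisorIdeal (neronBlowupHom hj i)]
  exact (isDilatation_neronBlowupHom hj i).comap_le (isLocallyPrincipal_divisorIdeal hj G)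

theorem neronBlowup_hom_ext {T : Over S} (hT : IsRegularOver j T)
    {f g : T ⟶ neronBlowup hj i} (e : f ≫ neronBlowupHom hj i = g ≫ neronBlowupHom hj i) :
    f = g := by
  refine Over.OverMorphism.ext ((isDilatation_neronBlowupHom hj i).hom_ext
    (isLocallyPrincipal_divisorIdeal hj G) ?_ (congr_arg (fun x ↦ x.left) e))
  rw [← Over.comp_left, comap_divisorIdeal]
  exact hT

theorem exists_neronBlowup_lift_of_le {T : Over S} (hT : IsRegularOver j T) (t : T ⟶ G)
    (h : (centerIdeal i).comap t.left ≤ divisorIdeal j T) :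
    ∃ t' : T ⟶ neronBlowup hj i, t' ≫ neronBlowupHom hj i = t := by
  have hT' := hT
  rw [isRegularOver_iff, ← comap_divisorIdeal t] at hT'
  rw [← comap_divisorIdeal t] at h
  obtain ⟨t', ht'⟩ := (isDilatation_neronBlowupHom hj i).exists_lift
    (isLocallyPrincipal_divisorIdeal hj G) hT' h
  refine ⟨Over.homMk t' ?_, Over.OverMorphism.ext ht'⟩
  rw [← Over.w (neronBlowupHom hj i), reassoc_of% ht', Over.w t]

theorem exists_neronBlowup_lift_iff [IsClosedImmersion i.left] {T : Over S}
    (hT : IsRegularOver j T) (t : T ⟶ G) :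
    (∃ t₀ : (Over.pullback j).obj T ⟶ H, t₀ ≫ i = (Over.pullback j).map t) ↔
      ∃! t' : T ⟶ neronBlowup hj i, t' ≫ neronBlowupHom hj i = t := by
  constructor
  · intro h
    obtain ⟨t', ht'⟩ := exists_neronBlowup_lift_of_le hj i hT t
      ((exists_factorization_iff i t).mp h)
    exact ⟨t', ht', fun s hs ↦ neronBlowup_hom_ext hj i hT (hs.trans ht'.symm)⟩
  · rintro ⟨t', ht', -⟩
    obtain ⟨p, hp⟩ := exists_neronBlowup_restriction hj i
    exact ⟨(Over.pullback j).map t' ≫ p, by rw [Category.assoc, hp, ← Functor.map_comp, ht']⟩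

instance : IsAffineHom (neronBlowupHom hj i).left :=
  (isDilatation_neronBlowupHom hj i).isAffineHom

lemma isCartier_top {X : Scheme.{u}} : IsCartier (⊤ : X.IdealSheafData) := fun x ↦
  let ⟨U, hx, _⟩ := exists_affineOpen_le x (W := ⊤) trivial
  ⟨U, hx, 1, one_mem _, by simp⟩

/-- On `V` the ideal `J` is the unit ideal, which is Cartier and contains every ideal. So the
inclusion of `V` lifts to `Y`, and uniqueness of lifts makes this lift inverse to `π`. -/
theorem IsDilatation.isIso_morphismRestrict {X Y : Scheme.{u}} {π : Y ⟶ X}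
    {I J : X.IdealSheafData} (h : IsDilatation π I J) (hJ : IsLocallyPrincipal J) (V : X.Opens)
    (hV : Disjoint (V : Set X) (J.support : Set X)) : IsIso (π ∣_ V) := by
  have htop : J.comap V.ι = ⊤ := by
    rw [← Scheme.IdealSheafData.support_eq_bot_iff, Scheme.IdealSheafData.support_comap]
    refine TopologicalSpace.Closeds.ext ?_
    refine Set.eq_empty_of_forall_notMem fun x hx ↦ ?_
    exact Set.disjoint_left.mp hV x.2 hx
  obtain ⟨s, hs⟩ := h.exists_lift hJ (t := V.ι) (htop ▸ isCartier_top) (htop ▸ le_top)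
  have hsV : Set.range s ⊆ (π ⁻¹ᵁ V : Y.Opens) := by
    rintro _ ⟨x, rfl⟩
    change π (s x) ∈ V
    rw [← Scheme.Hom.comp_apply, hs]
    exact x.2
  let s' : V.toScheme ⟶ (π ⁻¹ᵁ V).toScheme :=
    IsOpenImmersion.lift (π ⁻¹ᵁ V).ι s (by simpa using hsV)
  have hs' : s' ≫ (π ⁻¹ᵁ V).ι = s := IsOpenImmersion.lift_fac _ _ _
  have h1 : (π ∣_ V) ≫ V.ι = (π ⁻¹ᵁ V).ι ≫ π := morphismRestrict_ι π V
  refine ⟨s', ?_, ?_⟩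
  · rw [← cancel_mono (π ⁻¹ᵁ V).ι]
    refine h.hom_ext hJ ?_ ?_
    · rw [Category.assoc, Category.assoc, reassoc_of% hs', hs, h1,
        Scheme.IdealSheafData.comap_comp]
      exact (h.isCartier_comap hJ).comap_of_flat _
    · rw [Category.assoc, Category.assoc, reassoc_of% hs', hs, h1, Category.id_comp]
  · rw [← cancel_mono V.ι, Category.assoc, h1, reassoc_of% hs', hs, Category.id_comp]

theorem isIso_neronBlowupHom_morphismRestrict (U : S.Opens)
    (hU : Disjoint (U : Set S) (Set.range j)) :
    IsIso ((neronBlowupHom hj i).left ∣_ (G.hom ⁻¹ᵁ U)) := by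
  refine (isDilatation_neronBlowupHom hj i).isIso_morphismRestrict
    (isLocallyPrincipal_divisorIdeal hj G) _ ?_
  rw [Set.disjoint_left]
  intro x hx hx'
  refine Set.disjoint_left.mp hU hx ?_
  rw [divisorIdeal_eq_comap_hom, Scheme.IdealSheafData.support_comap] at hx'
  have : G.hom x ∈ (j.ker.support : Set S) := hx'
  rwa [Scheme.Hom.support_ker, j.isClosedEmbedding.isClosed_range.closure_eq] at this

theorem isAffineHom_neronBlowup (h : IsAffineHom G.hom) : IsAffineHom (neronBlowup hj i).hom := by
  rw [← Over.w (neronBlowupHom hj i)]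
  infer_instance

theorem isQuasiAffineHom_neronBlowup (h : IsQuasiAffineHom G.hom) :
    IsQuasiAffineHom (neronBlowup hj i).hom := by
  intro U
  have := h U
  rw [← Over.w (neronBlowupHom hj i)]
  have : IsAffineHom ((neronBlowupHom hj i).left ∣_ (G.hom ⁻¹ᵁ U.1)) :=
    MorphismProperty.of_isPullback (isPullback_morphismRestrict _ _).flip inferInstance
  have h2 := Scheme.IsQuasiAffine.of_isAffineHom ((neronBlowupHom hj i).left ∣_ (G.hom ⁻¹ᵁ U.1))
  exact h2

open MonoidalCategory CartesianMonoidalCategory in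
theorem exists_grpObj_neronBlowup (hj : IsEffectiveCartierDivisor j) [GrpObj G] [GrpObj H]
    [IsMonHom i] [IsClosedImmersion i.left]
    (hflat : Flat (neronBlowup hj.isLocallyPrincipal i).hom) :
    ∃ _ : GrpObj (neronBlowup hj.isLocallyPrincipal i),
      IsMonHom (neronBlowupHom hj.isLocallyPrincipal i) := by
  obtain ⟨p, hp⟩ := exists_neronBlowup_restriction hj.isLocallyPrincipal i
  -- Flat schemes are the test class: they are `S₀`-regular and, unlike `S₀`-regular schemes in
  -- general, stable under fibre products over `S`.
  refine exists_grpObj_of_lift (Over.pullback j) i (neronBlowupHom hj.isLocallyPrincipal i)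
    (fun T ↦ Flat T.hom) ?_ hflat ?_ p hp ?_ ?_
  · exact (inferInstance : Flat (𝟙 S))
  · intro X Y hX hY
    rw [Over.tensorObj_hom]
    infer_instance
  · intro T hT f g e
    exact neronBlowup_hom_ext _ _ (isRegularOver_of_flat hj T) e
  · intro T hT t t₀ e
    exact ((exists_neronBlowup_lift_iff hj.isLocallyPrincipal i
      (isRegularOver_of_flat hj T) t).mp ⟨t₀, e⟩).exists

lemma centerIdeal_baseChangeCenter [IsClosedImmersion i.left] {S' : Scheme.{u}} (g : S' ⟶ S) :
    centerIdeal (baseChangeCenter g i) = (centerIdeal i).comap (pullback.fst G.hom g) := by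
  have h := isPullback_baseChangeCenter g i
  rw [centerIdeal, centerIdeal, ← Scheme.IdealSheafData.ker_fst_of_isClosedImmersion,
    ← h.flip.isoPullback_hom_fst, Scheme.Hom.ker_comp_of_isIso]

lemma divisorIdeal_pullback {S' : Scheme.{u}} (g : S' ⟶ S) (T : Over S) :
    divisorIdeal (pullback.fst g j) ((Over.pullback g).obj T) =
      (divisorIdeal j T).comap (pullback.fst T.hom g) := by
  rw [divisorIdeal_eq_comap_hom, divisorIdeal_eq_comap_hom,
    Scheme.IdealSheafData.ker_fst_of_isClosedImmersion, ← Scheme.IdealSheafData.comap_comp,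
    ← Scheme.IdealSheafData.comap_comp, pullback.condition]
  rfl

/-- An `S'`-scheme has the same divisor when regarded as an `S`-scheme, so regularity over `S₀'` and
over `S₀` agree and test objects can be moved between the two bases. -/
lemma divisorIdeal_map {S' : Scheme.{u}} (g : S' ⟶ S) (T : Over S') :
    divisorIdeal (pullback.fst g j) T = divisorIdeal j ((Over.map g).obj T) := by
  rw [divisorIdeal_eq_comap_hom, divisorIdeal_eq_comap_hom,
    Scheme.IdealSheafData.ker_fst_of_isClosedImmersion, ← Scheme.IdealSheafData.comap_comp]
  rfl

theorem exists_neronBlowup_baseChange_iso [IsClosedImmersion i.left]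
    (hflat : Flat (neronBlowup hj i).hom) {S' : Scheme.{u}} (g : S' ⟶ S)
    (hg : IsEffectiveCartierDivisor (pullback.fst g j)) :
    ∃ e : (Over.pullback g).obj (neronBlowup hj i) ≅
        neronBlowup hg.isLocallyPrincipal (baseChangeCenter g i),
      e.hom ≫ neronBlowupHom hg.isLocallyPrincipal (baseChangeCenter g i) =
        (Over.pullback g).map (neronBlowupHom hj i) := by
  set N := neronBlowup hj i with hN
  set N' := neronBlowup hg.isLocallyPrincipal (baseChangeCenter g i) with hN'
  let π : N ⟶ G := neronBlowupHom hj i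
  let π' : N' ⟶ (Over.pullback g).obj G :=
    neronBlowupHom hg.isLocallyPrincipal (baseChangeCenter g i)
  have hflat' : Flat ((Over.pullback g).obj N).hom :=
    (inferInstance : Flat (pullback.snd N.hom g))
  have hreg := isRegularOver_of_flat hg ((Over.pullback g).obj N)
  have hreg' : IsRegularOver (pullback.fst g j) N' := isRegularOver_neronBlowup _ _
  have hle := (isDilatation_neronBlowupHom hj i).comap_le (isLocallyPrincipal_divisorIdeal hj G)
  have hle' := (isDilatation_neronBlowupHom hg.isLocallyPrincipal
    (baseChangeCenter g i)).comap_le (isLocallyPrincipal_divisorIdeal hg.isLocallyPrincipal _)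
  -- Flatness of `N` enters here: it makes the base change of `N` an `S₀'`-regular test object for
  -- `N'`.
  obtain ⟨a, ha⟩ := exists_neronBlowup_lift_of_le hg.isLocallyPrincipal (baseChangeCenter g i)
    hreg ((Over.pullback g).map π) (by
      rw [centerIdeal_baseChangeCenter, ← Scheme.IdealSheafData.comap_comp,
        pullback_map_left_fst, Scheme.IdealSheafData.comap_comp, divisorIdeal_pullback]
      refine Scheme.IdealSheafData.comap_mono _ (hle.trans ?_)
      rw [comap_divisorIdeal])
  let adj := Over.mapPullbackAdj g
  -- In the other direction `N'` is regarded as an `S`-scheme and lifted to `N`; the adjoint of this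
  -- lift is the map into the base change of `N`.
  obtain ⟨b, hb⟩ := exists_neronBlowup_lift_of_le hj i (T := (Over.map g).obj N')
    (by rw [isRegularOver_iff, ← divisorIdeal_map]; exact hreg')
    ((adj.homEquiv _ _).symm π') (by
      have h1 : ((adj.homEquiv _ _).symm π').left = π'.left ≫ pullback.fst G.hom g := rfl
      rw [h1, Scheme.IdealSheafData.comap_comp, ← centerIdeal_baseChangeCenter,
        ← divisorIdeal_map, ← comap_divisorIdeal π']
      exact hle')
  let b' : N' ⟶ (Over.pullback g).obj N := adj.homEquiv _ _ b
  have hb' : b' ≫ (Over.pullback g).map π = π' := by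
    have h1 := congr(adj.homEquiv _ _ $hb)
    rw [Equiv.apply_symm_apply] at h1
    rw [← h1]
    exact (adj.homEquiv_naturality_right b π).symm
  refine ⟨⟨a, b', ?_, ?_⟩, ha⟩
  · apply (adj.homEquiv _ _).symm.injective
    refine neronBlowup_hom_ext hj i ?_ ?_
    · rw [isRegularOver_iff, ← divisorIdeal_map]
      exact hreg
    · rw [← adj.homEquiv_naturality_right_symm, ← adj.homEquiv_naturality_right_symm,
        Category.assoc, hb', Category.id_comp, ha]
  · refine neronBlowup_hom_ext _ _ hreg' ?_
    rw [Category.assoc, ha, Category.id_comp]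
    exact hb'

end Neron

end NeronBlowup

namespace NeronBlowup

/-! ### Further algebra: unit center, valuation rings, lifting weakly regular sequences. -/

section RingHom

variable {A B B' : Type*} [CommRing A] [CommRing B] [CommRing B']

lemma IsAffineBlowupAlgebra.isLocalizationAway_of_top [Algebra B B'] {b : B}
    (h : IsAffineBlowupAlgebra B' ⊤ b) : IsLocalization.Away b B' := by
  have hu : IsUnit (algebraMap B B' b) :=
    isUnit_of_dvd_one (by simpa using h.dvd 1 trivial)
  have : IsLocalization.Away (algebraMap B B' b) B' :=
    IsLocalization.away_of_isUnit_of_bijective _ hu Function.bijective_id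
  exact h.isLocalizationAway_map

/-- Over a valuation ring flat means torsion-free. If `c₀` kills `f` in the localization of `B'`,
then multiplying `f` by a power of `b` moves the relation into `B` up to `b`-power torsion. There
`c₀` is regular by flatness, and the powers of `b` cancel again in `B'`. -/
lemma IsAffineBlowupAlgebra.flat_of_valuationRing [Algebra A B] [Algebra B B'] [Algebra A B']
    [IsScalarTower A B B'] [Module.Flat A B] {I : Ideal B} {b : B}
    (h : IsAffineBlowupAlgebra B' I b) (hA : ∀ (p : Ideal A) [p.IsMaximal],
      ∃ _ : IsDomain (Localization.AtPrime p), ValuationRing (Localization.AtPrime p)) :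
    Module.Flat A B' := by
  refine Module.flat_of_localized_maximal _ fun p _ ↦ ?_
  obtain ⟨_, _⟩ := hA p
  suffices Module.Flat (Localization.AtPrime p) (LocalizedModule p.primeCompl B') from
    .trans A (Localization.AtPrime p) _
  rw [Module.Flat.flat_iff_torsion_eq_bot_of_isBezout, eq_bot_iff]
  rintro m ⟨⟨c, hc⟩, hm⟩
  replace hm : c • m = 0 := hm
  obtain ⟨⟨c₀, s⟩, hs⟩ := IsLocalization.surj p.primeCompl c
  replace hs : c * algebraMap A _ s.1 = algebraMap A _ c₀ := hs
  obtain ⟨⟨f, t⟩, ht⟩ := IsLocalizedModule.surj p.primeCompl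
    (LocalizedModule.mkLinearMap p.primeCompl B') m
  replace ht : t.1 • m = LocalizedModule.mkLinearMap p.primeCompl B' f := ht
  have hc₀ : algebraMap A (Localization.AtPrime p) c₀ ∈ nonZeroDivisors _ := by
    rw [← hs]
    exact mul_mem hc (IsLocalization.map_units _ s).mem_nonZeroDivisors
  have hm' : LocalizedModule.mkLinearMap p.primeCompl B' (c₀ • f) = 0 := by
    rw [map_smul, ← ht, smul_comm, ← algebraMap_smul (Localization.AtPrime p) c₀ m, ← hs, mul_comm,
      mul_smul, hm, smul_zero, smul_zero]
  rw [IsLocalizedModule.eq_zero_iff p.primeCompl] at hm'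
  obtain ⟨⟨v, hv⟩, hvf⟩ := hm'
  replace hvf : v • c₀ • f = 0 := hvf
  obtain ⟨n, x, -, hx⟩ := h.exists_pow_mul f
  obtain ⟨k, hk⟩ := h.exists_pow_mul_eq_zero (algebraMap A B (v * c₀) * x) (by
    rw [map_mul, hx, ← IsScalarTower.algebraMap_apply, mul_left_comm, ← Algebra.smul_def,
      mul_smul, hvf, mul_zero])
  have hreg := Module.Flat.isSMulRegular_of_nonZeroDivisors
    (M := LocalizedModule p.primeCompl B) hc₀
  have h1 : LocalizedModule.mkLinearMap p.primeCompl B (b ^ k * x) = 0 := by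
    refine isSMulRegular_iff_right_eq_zero_of_smul.mp hreg _ ?_
    rw [algebraMap_smul, ← map_smul, IsLocalizedModule.eq_zero_iff p.primeCompl]
    refine ⟨⟨v, hv⟩, ?_⟩
    change v • c₀ • (b ^ k * x) = 0
    rw [← mul_smul, Algebra.smul_def, ← hk]
    ring
  rw [IsLocalizedModule.eq_zero_iff p.primeCompl] at h1
  obtain ⟨w, hwx⟩ := h1
  have h2 : w • f = 0 := by
    replace hwx : w.1 • (b ^ k * x) = 0 := hwx
    have h3 := congr(algebraMap B B' $hwx)
    rw [Algebra.smul_def, map_mul, map_mul, map_pow, map_zero, hx,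
      ← IsScalarTower.algebraMap_apply A B B'] at h3
    change w.1 • f = 0
    refine (mul_left_mem_nonZeroDivisors_eq_zero_iff
      (pow_mem h.mem_nonZeroDivisors (k + n))).mp ?_
    rw [← h3, Algebra.smul_def]
    ring
  have h3 : LocalizedModule.mkLinearMap p.primeCompl B' f = 0 :=
    (IsLocalizedModule.eq_zero_iff p.primeCompl _).mpr ⟨w, h2⟩
  rw [h3] at ht
  exact (Submodule.mem_bot _).mpr (IsLocalizedModule.smul_injective
    (LocalizedModule.mkLinearMap p.primeCompl B') t (ht.trans (smul_zero t).symm))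

open RingTheory.Sequence Pointwise in
/-- Weakly regular sequences lift along a surjection whose kernel is generated by a
nonzerodivisor. -/
lemma isWeaklyRegular_cons_of_surjective {R : Type*} [CommRing R] {p : B →+* R}
    (hp : Function.Surjective p) {b : B} (hb : b ∈ nonZeroDivisors B)
    (hker : RingHom.ker p = Ideal.span {b}) {xs : List B} (h : IsWeaklyRegular R (xs.map p)) :
    IsWeaklyRegular B (b :: xs) := by
  let := p.toAlgebra
  rw [isWeaklyRegular_cons_iff]
  refine ⟨?_, ?_⟩
  · rw [isSMulRegular_iff_right_eq_zero_of_smul]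
    intro y hy
    exact (mem_nonZeroDivisors_iff_right.mp hb) y (by rw [mul_comm]; exact hy)
  · have h1 : (b • (⊤ : Submodule B B)) = LinearMap.ker (Algebra.linearMap B R) := by
      ext y
      rw [Submodule.mem_smul_pointwise_iff_exists, LinearMap.mem_ker, Algebra.linearMap_apply]
      change _ ↔ y ∈ RingHom.ker p
      rw [hker, Ideal.mem_span_singleton']
      exact ⟨fun ⟨c, _, hc⟩ ↦ ⟨c, by rw [mul_comm]; exact hc⟩,
        fun ⟨c, hc⟩ ↦ ⟨c, trivial, by rw [← hc, mul_comm]; rfl⟩⟩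
    let e : QuotSMulTop b B ≃ₗ[B] R := (Submodule.quotEquivOfEq _ _ h1).trans
      ((Algebra.linearMap B R).quotKerEquivOfSurjective hp)
    rw [e.isWeaklyRegular_congr]
    exact (isWeaklyRegular_map_algebraMap_iff R R xs).mp h

lemma Ideal.ofList_eq_span_range_get (xs : List B) :
    Ideal.ofList xs = Ideal.span (Set.range xs.get) := by
  rw [Set.range_list_get]

/-- Allows a property of `H ⟶ S₀`, known for rings of sections of `H` and `S₀`, to be used for the
quotient map `A / a → B / I`. -/
lemma RingHom.quotientMap_of_respectsIso {A R B C : Type u} [CommRing A] [CommRing R] [CommRing B]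
    [CommRing C] {Q : ∀ {R S : Type u} [CommRing R] [CommRing S], (R →+* S) → Prop}
    (hQ : RingHom.RespectsIso Q) {p : A →+* R} (hp : Function.Surjective p) {q : B →+* C}
    (hq : Function.Surjective q) {f : A →+* B} {g : R →+* C} (e : g.comp p = q.comp f)
    (hg : Q g) {𝔞 : Ideal A} (h𝔞 : 𝔞 = RingHom.ker p) {I : Ideal B} (hI : I = RingHom.ker q)
    (hle : 𝔞 ≤ I.comap f) : Q (Ideal.quotientMap I f hle) := by
  subst h𝔞 hI
  have h1 := hQ.2 _ (RingHom.quotientKerEquivOfSurjective hp)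
    (hQ.1 g (RingHom.quotientKerEquivOfSurjective hq).symm hg)
  convert! h1
  refine Ideal.Quotient.ringHom_ext (RingHom.ext fun x ↦ ?_)
  apply (RingHom.quotientKerEquivOfSurjective hq).injective
  have h2 : g (p x) = q (f x) := DFunLike.congr_fun e x
  simpa using h2.symm

end RingHom

/-! ### Charts of the Néron blowup and local equations of a regular center. -/

section Charts

variable {S S₀ : Scheme.{u}} {j : S₀ ⟶ S} {G : Over S} {H : Over S₀}

/-- Some section of `I` does not vanish at `x`; it is a unit on its basic open. -/
lemma exists_opens_ideal_eq_top {X : Scheme.{u}} (I : X.IdealSheafData) {x : X}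
    (hx : x ∉ I.support) : ∃ O : X.Opens, x ∈ O ∧ ∀ U : X.affineOpens, U.1 ≤ O → I.ideal U = ⊤ := by
  obtain ⟨U, hxU, -⟩ := exists_affineOpen_le x (W := ⊤) trivial
  rw [Scheme.IdealSheafData.mem_support_iff_of_mem hxU, Scheme.mem_zeroLocus_iff] at hx
  push Not at hx
  obtain ⟨f, hf, hxf⟩ := hx
  refine ⟨X.basicOpen f, hxf, fun V hV ↦ ?_⟩
  have hVU : V.1 ≤ U.1 := hV.trans (X.basicOpen_le f)
  refine Ideal.eq_top_of_isUnit_mem _ (I.ideal_le_comap_ideal (U := V) (V := U) hVU hf) ?_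
  have h1 : IsUnit (res (X.basicOpen_le f) f) := RingedSpace.isUnit_res_basicOpen X.toRingedSpace f
  have h2 := h1.map (res hV)
  rwa [res_res] at h2

/-- A property of ring homomorphisms that is local on source and target passes to the Néron blowup
if it holds for affine blowup algebras of arbitrarily chosen charts. -/
theorem neronBlowup_of_forall_chart [IsClosedImmersion j] {P : MorphismProperty Scheme.{u}}
    {Q : ∀ {R S : Type u} [CommRing R] [CommRing S], (R →+* S) → Prop}
    [HasRingHomProperty P Q] (hQ : RingHom.StableUnderCompositionWithLocalizationAwaySource Q)
    (hj : IsLocallyPrincipal j.ker) (i : H ⟶ (Over.pullback j).obj G)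
    (h : ∀ x : G.left, ∃ (W : S.affineOpens) (U : G.left.affineOpens) (e : U.1 ≤ G.hom ⁻¹ᵁ W.1)
      (b : Γ(G.left, U.1)), x ∈ U.1 ∧ (divisorIdeal j G).ideal U = Ideal.span {b} ∧
        ∀ (B' : Type u) [CommRing B'] (φ : Γ(G.left, U.1) →+* B'),
          φ.IsAffineBlowup ((centerIdeal i).ideal U) b → Q (φ.comp (G.hom.appLE W.1 U.1 e).hom)) :
    P (neronBlowup hj i).hom := by
  rw [HasRingHomProperty.iff_exists_appLE (P := P) hQ]
  intro y
  have hπ := isDilatation_neronBlowupHom hj i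
  obtain ⟨W, U, e, b, hxU, hb, hU⟩ := h ((neronBlowupHom hj i).left y)
  refine ⟨W, ⟨(neronBlowupHom hj i).left ⁻¹ᵁ U.1, U.2.preimage _⟩, hxU, ?_, ?_⟩
  · rw [← Over.w (neronBlowupHom hj i)]
    exact fun z hz ↦ e hz
  · have h1 := hU _ _ (hπ.isAffineBlowup U b hb)
    have h2 : G.hom.appLE W.1 U.1 e ≫ (neronBlowupHom hj i).left.app U.1 =
        ((neronBlowupHom hj i).left ≫ G.hom).appLE W.1 ((neronBlowupHom hj i).left ⁻¹ᵁ U.1)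
          (fun z hz ↦ e hz) := by
      rw [← appLE_preimage, Scheme.Hom.appLE_comp_appLE]
    rw [← CommRingCat.hom_comp, h2] at h1
    exact h1

lemma mem_support_centerIdeal_iff [IsClosedImmersion j] (i : H ⟶ (Over.pullback j).obj G)
    [IsClosedImmersion i.left] {x : G.left} : x ∈ (centerIdeal i).support ↔
      x ∈ Set.range (i.left ≫ pullback.fst G.hom j) := by
  rw [← SetLike.mem_coe, centerIdeal, Scheme.Hom.support_ker,
    (i.left ≫ pullback.fst G.hom j).isClosedEmbedding.isClosed_range.closure_eq]

open RingTheory.Sequence in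
/-- Around a point of `Z`, the ideal of `Z` in `X` is generated by an equation of the Cartier
divisor `P` followed by a weakly regular sequence. -/
lemma IsRegularImmersion.exists_opens_isWeaklyRegular {X P Z : Scheme.{u}} {k : Z ⟶ P}
    [IsClosedImmersion k] (hk : IsRegularImmersion k) (p : P ⟶ X) [IsClosedImmersion p] {x : X}
    (hx : x ∈ Set.range (k ≫ p)) : ∃ O : X.Opens, x ∈ O ∧
      ∀ U : X.affineOpens, U.1 ≤ O → ∀ b ∈ nonZeroDivisors Γ(X, U.1),
        p.ker.ideal U = Ideal.span {b} → ∃ xs : List Γ(X, U.1),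
          IsWeaklyRegular Γ(X, U.1) (b :: xs) ∧
            (k ≫ p).ker.ideal U = Ideal.span {b} ⊔ Ideal.span (Set.range xs.get) := by
  obtain ⟨z, rfl⟩ := hx
  obtain ⟨U₀, hz, rs, hrs, hU₀⟩ := hk z
  -- The regular sequence lives on an open of the divisor `P`; this open is cut out by an open `O`
  -- of `X`.
  obtain ⟨O, hO, hOU⟩ := p.isClosedEmbedding.isInducing.isOpen_iff.mp U₀.1.2
  refine ⟨⟨O, hO⟩, ?_, fun U hU b hb hbU ↦ ?_⟩
  · have : k z ∈ p ⁻¹' O := hOU ▸ hz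
    simpa using! this
  have hle : p ⁻¹ᵁ U.1 ≤ U₀.1 := fun y hy ↦ by
    have : y ∈ p ⁻¹' O := hU hy
    rwa [hOU] at this
  have haff : IsAffineOpen (p ⁻¹ᵁ U.1) := U.2.preimage p
  have hsurj : Function.Surjective (p.app U.1).hom := p.app_surjective U.1 U.2
  have hker : RingHom.ker (p.app U.1).hom = Ideal.span {b} := by
    rw [← hbU, Scheme.Hom.ker_apply]
  have hflat : (res (X := P) hle).Flat := by
    have h1 := (𝟙 (P) : _ ⟶ _).flat_appLE U₀.2 haff hle
    convert! h1 using 1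
  -- Only weak regularity survives restriction: a smaller open may miss `Z`, so that the sequence
  -- generates the unit ideal.
  have hrs' : IsWeaklyRegular Γ(P, p ⁻¹ᵁ U.1) (rs.map (res hle)) := by
    let := (res (X := P) hle).toAlgebra
    have : Module.Flat Γ(P, U₀.1) Γ(P, p ⁻¹ᵁ U.1) := hflat
    exact hrs.toIsWeaklyRegular.of_flat
  -- Arbitrary lifts to `X` will do, since `b` generates the kernel of restriction to `P` and is put
  -- in front.
  obtain ⟨xs, hxs⟩ := List.map_surjective_iff.mpr hsurj (rs.map (res hle))
  rw [← hxs] at hrs'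
  refine ⟨xs, isWeaklyRegular_cons_of_surjective hsurj hb hker hrs', ?_⟩
  have h1 := k.ker.map_ideal (U := ⟨p ⁻¹ᵁ U.1, haff⟩) (V := U₀) hle
  rw [hU₀] at h1
  have h2 : (Ideal.ofList rs).map (res (X := P) hle) =
      (Ideal.ofList xs).map (p.app U.1).hom := by
    rw [Ideal.map_ofList, Ideal.map_ofList, hxs]
  have h3 : (k ≫ p).ker.ideal U =
      (k.ker.ideal ⟨p ⁻¹ᵁ U.1, haff⟩).comap (p.app U.1).hom := by
    rw [← Scheme.IdealSheafData.map_ker]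
    exact Scheme.IdealSheafData.ideal_map_of_isAffineHom _ p U
  rw [h3, ← h1, ← Ideal.ofList_eq_span_range_get]
  refine (congr_arg _ h2).trans ?_
  rw [Ideal.comap_map_of_surjective _ hsurj, sup_comm, ← hker]
  rfl

open RingTheory.Sequence in
lemma exists_opens_isWeaklyRegular [IsClosedImmersion j] (i : H ⟶ (Over.pullback j).obj G)
    [IsClosedImmersion i.left] (hi : IsRegularImmersion i.left) {x : G.left}
    (hx : x ∈ (centerIdeal i).support) : ∃ O : G.left.Opens, x ∈ O ∧
      ∀ U : G.left.affineOpens, U.1 ≤ O → ∀ b ∈ nonZeroDivisors Γ(G.left, U.1),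
        (divisorIdeal j G).ideal U = Ideal.span {b} → ∃ xs : List Γ(G.left, U.1),
          IsWeaklyRegular Γ(G.left, U.1) (b :: xs) ∧
            (centerIdeal i).ideal U = Ideal.span {b} ⊔ Ideal.span (Set.range xs.get) :=
  hi.exists_opens_isWeaklyRegular (pullback.fst G.hom j) ((mem_support_centerIdeal_iff i).mp hx)

end Charts

end NeronBlowup

namespace NeronBlowup

/-! ### Finite presentation, flatness and smoothness over `S`. -/

section Properties

variable {S S₀ : Scheme.{u}} {j : S₀ ⟶ S} [IsClosedImmersion j] {G : Over S} {H : Over S₀}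

lemma divisorIdeal_ideal_eq_span {W : S.affineOpens} {a : Γ(S, W.1)}
    (ha : j.ker.ideal W = Ideal.span {a}) {U : G.left.affineOpens} (e : U.1 ≤ G.hom ⁻¹ᵁ W.1) :
    (divisorIdeal j G).ideal U = Ideal.span {(G.hom.appLE W.1 U.1 e).hom a} := by
  rw [divisorIdeal_eq_comap_hom, ideal_comap_eq_map_appLE G.hom j.ker W U e, ha, Ideal.map_span,
    Set.image_singleton]

/-- To transfer a property of `G ⟶ S` to its Néron blowup it suffices to consider charts around
points of `H`. -/
theorem neronBlowup_of_forall_support_chart {P : MorphismProperty Scheme.{u}}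
    {Q : ∀ {R S : Type u} [CommRing R] [CommRing S], (R →+* S) → Prop}
    [HasRingHomProperty P Q] (hcomp : RingHom.StableUnderComposition Q)
    (hloc : RingHom.HoldsForLocalizationAway Q) (hG : P G.hom)
    (hj : IsEffectiveCartierDivisor j) (i : H ⟶ (Over.pullback j).obj G)
    (h : ∀ x ∈ (centerIdeal i).support, ∀ (W : S.affineOpens), G.hom x ∈ W.1 →
      ∀ a ∈ nonZeroDivisors Γ(S, W.1), j.ker.ideal W = Ideal.span {a} →
      ∃ (U : G.left.affineOpens) (e : U.1 ≤ G.hom ⁻¹ᵁ W.1), x ∈ U.1 ∧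
        ∀ (B' : Type u) [CommRing B'] (φ : Γ(G.left, U.1) →+* B'),
          φ.IsAffineBlowup ((centerIdeal i).ideal U) ((G.hom.appLE W.1 U.1 e).hom a) →
            Q (φ.comp (G.hom.appLE W.1 U.1 e).hom)) :
    P (neronBlowup hj.isLocallyPrincipal i).hom := by
  refine neronBlowup_of_forall_chart
    (hcomp.stableUnderCompositionWithLocalizationAway hloc).1 _ i fun x ↦ ?_
  obtain ⟨W, hW, a, ha, haW⟩ := hj (G.hom x)
  by_cases hx : x ∈ (centerIdeal i).support
  · obtain ⟨U, e, hxU, hU⟩ := h x hx W hW a ha haW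
    exact ⟨W, U, e, _, hxU, divisorIdeal_ideal_eq_span haW e, hU⟩
  · obtain ⟨O, hxO, hO⟩ := exists_opens_ideal_eq_top _ hx
    obtain ⟨U, hxU, hUO⟩ := exists_affineOpen_le x (W := O ⊓ G.hom ⁻¹ᵁ W.1) ⟨hxO, hW⟩
    have e : U.1 ≤ G.hom ⁻¹ᵁ W.1 := hUO.trans inf_le_right
    refine ⟨W, U, e, _, hxU, divisorIdeal_ideal_eq_span haW e, fun B' _ φ hφ ↦ ?_⟩
    -- Away from the center `I` is the unit ideal, and the blowup is just the localization at the
    -- equation of the divisor.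
    rw [hO U (hUO.trans inf_le_left)] at hφ
    refine hcomp _ _ (HasRingHomProperty.iff_appLE.mp hG W U e) ?_
    let := φ.toAlgebra
    have : IsLocalization.Away _ B' := IsAffineBlowupAlgebra.isLocalizationAway_of_top hφ
    exact hloc B' ((G.hom.appLE W.1 U.1 e).hom a)

theorem locallyOfFinitePresentation_neronBlowup (hj : IsEffectiveCartierDivisor j)
    (i : H ⟶ (Over.pullback j).obj G) [IsClosedImmersion i.left] (hreg : IsRegularOver j G)
    (hi : IsRegularImmersion i.left) (hG : LocallyOfFinitePresentation G.hom) :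
    LocallyOfFinitePresentation (neronBlowup hj.isLocallyPrincipal i).hom := by
  refine neronBlowup_of_forall_support_chart RingHom.finitePresentation_stableUnderComposition
    RingHom.finitePresentation_holdsForLocalizationAway hG hj i fun x hx W hW a ha haW ↦ ?_
  obtain ⟨O, hxO, hO⟩ := exists_opens_isWeaklyRegular i hi hx
  obtain ⟨U, hxU, hUO⟩ := exists_affineOpen_le x (W := O ⊓ G.hom ⁻¹ᵁ W.1) ⟨hxO, hW⟩
  have e : U.1 ≤ G.hom ⁻¹ᵁ W.1 := hUO.trans inf_le_right
  have hb := divisorIdeal_ideal_eq_span haW e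
  obtain ⟨xs, hxs, hI⟩ :=
    hO U (hUO.trans inf_le_left) _ (IsCartier.mem_nonZeroDivisors hreg U hb) hb
  refine ⟨U, e, hxU, fun B' _ φ hφ ↦ ?_⟩
  refine RingHom.finitePresentation_stableUnderComposition _ _
    (HasRingHomProperty.iff_appLE.mp hG W U e) ?_
  let := φ.toAlgebra
  obtain ⟨ψ⟩ := (BlowupModel.isAffineBlowupAlgebra _ _ hI
    (BlowupModel.algebraMap_mem_nonZeroDivisors hxs)).nonempty_algEquiv
    (show IsAffineBlowupAlgebra B' _ _ from hφ)
  exact Algebra.FinitePresentation.equiv ψ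

theorem isOfFinitePresentation_neronBlowup (hj : IsEffectiveCartierDivisor j)
    (i : H ⟶ (Over.pullback j).obj G) [IsClosedImmersion i.left] (hreg : IsRegularOver j G)
    (hi : IsRegularImmersion i.left) (hG : IsOfFinitePresentation G.hom) :
    IsOfFinitePresentation (neronBlowup hj.isLocallyPrincipal i).hom := by
  obtain ⟨h1, _, _⟩ := hG
  refine ⟨locallyOfFinitePresentation_neronBlowup hj i hreg hi h1, ?_, ?_⟩
  · rw [← Over.w (neronBlowupHom hj.isLocallyPrincipal i)]
    infer_instance
  · rw [← Over.w (neronBlowupHom hj.isLocallyPrincipal i)]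
    infer_instance

/-- On charts `H ⟶ S₀` is the ring map `A / a → B / I`; this is how hypotheses on `H` reach the
algebraic lemmas. -/
lemma exists_quotientMap_of_property {P : MorphismProperty Scheme.{u}}
    {Q : ∀ {R S : Type u} [CommRing R] [CommRing S], (R →+* S) → Prop}
    [HasRingHomProperty P Q] (i : H ⟶ (Over.pullback j).obj G) [IsClosedImmersion i.left]
    (hH : P H.hom) {W : S.affineOpens} {a : Γ(S, W.1)} (ha : j.ker.ideal W = Ideal.span {a})
    {U : G.left.affineOpens} (e : U.1 ≤ G.hom ⁻¹ᵁ W.1) :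
    ∃ hle : Ideal.span {a} ≤ ((centerIdeal i).ideal U).comap (G.hom.appLE W.1 U.1 e).hom,
      Q (Ideal.quotientMap ((centerIdeal i).ideal U) (G.hom.appLE W.1 U.1 e).hom hle) := by
  let c : H.left ⟶ G.left := i.left ≫ pullback.fst G.hom j
  have hc : c ≫ G.hom = H.hom ≫ j := by
    have h : i.left ≫ pullback.snd G.hom j = H.hom := Over.w i
    rw [Category.assoc, pullback.condition, reassoc_of% h]
  have hle : Ideal.span {a} ≤ ((centerIdeal i).ideal U).comap (G.hom.appLE W.1 U.1 e).hom := by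
    rw [← Ideal.map_le_iff_le_comap, Ideal.map_span, Set.image_singleton,
      ← divisorIdeal_ideal_eq_span ha e]
    exact divisorIdeal_le_centerIdeal i U
  refine ⟨hle, ?_⟩
  have hle' : c ⁻¹ᵁ U.1 ≤ H.hom ⁻¹ᵁ (j ⁻¹ᵁ W.1) := fun z hz ↦ by
    have h1 : (c ≫ G.hom) z ∈ W.1 := e hz
    rwa [hc] at h1
  have hcomm : j.app W.1 ≫ H.hom.appLE (j ⁻¹ᵁ W.1) (c ⁻¹ᵁ U.1) hle' =
      G.hom.appLE W.1 U.1 e ≫ c.app U.1 := by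
    rw [← appLE_preimage j, ← appLE_preimage c, Scheme.Hom.appLE_comp_appLE,
      Scheme.Hom.appLE_comp_appLE]
    simp only [hc]
  refine RingHom.quotientMap_of_respectsIso
    (HasRingHomProperty.isLocal_ringHomProperty P).respectsIso
    (j.app_surjective W.1 W.2) (c.app_surjective U.1 U.2) (congr_arg CommRingCat.Hom.hom hcomm)
    (HasRingHomProperty.iff_appLE.mp hH ⟨j ⁻¹ᵁ W.1, W.2.preimage j⟩
      ⟨c ⁻¹ᵁ U.1, U.2.preimage c⟩ hle') ?_ ?_ hle
  · rw [← ha, Scheme.Hom.ker_apply]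
  · exact Scheme.Hom.ker_apply c U

theorem flat_neronBlowup_of_isRegularImmersion (hj : IsEffectiveCartierDivisor j)
    (i : H ⟶ (Over.pullback j).obj G) [IsClosedImmersion i.left] (hi : IsRegularImmersion i.left)
    (hG : Flat G.hom) (hH : Flat H.hom) : Flat (neronBlowup hj.isLocallyPrincipal i).hom := by
  refine neronBlowup_of_forall_support_chart RingHom.Flat.stableUnderComposition
    RingHom.Flat.holdsForLocalizationAway hG hj i fun x hx W hW a ha haW ↦ ?_
  obtain ⟨O, hxO, hO⟩ := exists_opens_isWeaklyRegular i hi hx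
  obtain ⟨U, hxU, hUO⟩ := exists_affineOpen_le x (W := O ⊓ G.hom ⁻¹ᵁ W.1) ⟨hxO, hW⟩
  have e : U.1 ≤ G.hom ⁻¹ᵁ W.1 := hUO.trans inf_le_right
  obtain ⟨hle, hq⟩ := exists_quotientMap_of_property i hH haW e
  have hf := HasRingHomProperty.iff_appLE.mp hG W U e
  obtain ⟨xs, hxs, hI⟩ := hO U (hUO.trans inf_le_left) _ (hf.map_mem_nonZeroDivisors ha)
    (divisorIdeal_ideal_eq_span haW e)
  refine ⟨U, e, hxU, fun B' _ φ hφ ↦ ?_⟩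
  let := φ.toAlgebra
  let := (G.hom.appLE W.1 U.1 e).hom.toAlgebra
  let := (φ.comp (G.hom.appLE W.1 U.1 e).hom).toAlgebra
  let := (Ideal.quotientMap ((centerIdeal i).ideal U) (G.hom.appLE W.1 U.1 e).hom hle).toAlgebra
  have : IsScalarTower Γ(S, W.1) Γ(G.left, U.1) B' := .of_algebraMap_eq' rfl
  have : IsScalarTower Γ(S, W.1) (Γ(S, W.1) ⧸ Ideal.span {a})
    (Γ(G.left, U.1) ⧸ (centerIdeal i).ideal U) := .of_algebraMap_eq' rfl
  have : Module.Flat Γ(S, W.1) Γ(G.left, U.1) := hf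
  have : Module.Flat (Γ(S, W.1) ⧸ Ideal.span {a})
    (Γ(G.left, U.1) ⧸ (centerIdeal i).ideal U) := hq
  have h : IsAffineBlowupAlgebra B' ((centerIdeal i).ideal U)
    (algebraMap Γ(S, W.1) Γ(G.left, U.1) a) := hφ
  exact h.flat ha hI (BlowupModel.algebraMap_mem_nonZeroDivisors hxs)

/-- Localizations of the ring of an affine open at primes are stalks of `S`. -/
lemma exists_valuationRing_localization {S : Scheme.{u}}
    (hS : ∀ s : S, ∃ _ : IsDomain (S.presheaf.stalk s), ValuationRing (S.presheaf.stalk s))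
    {W : S.Opens} (hW : IsAffineOpen W) (p : Ideal Γ(S, W)) [p.IsPrime] :
    ∃ _ : IsDomain (Localization.AtPrime p), ValuationRing (Localization.AtPrime p) := by
  let y : PrimeSpectrum Γ(S, W) := ⟨p, inferInstance⟩
  have hy : hW.fromSpec y ∈ W := by
    have := hW.fromSpec_preimage_self
    have h1 : y ∈ hW.fromSpec ⁻¹ᵁ W := this ▸ trivial
    exact h1
  let := TopCat.Presheaf.algebra_section_stalk S.presheaf (⟨hW.fromSpec y, hy⟩ : W)
  have : IsLocalization.AtPrime (S.presheaf.stalk (hW.fromSpec y)) p :=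
    hW.isLocalization_stalk' y hy
  obtain ⟨_, _⟩ := hS (hW.fromSpec y)
  let e := IsLocalization.algEquiv p.primeCompl (S.presheaf.stalk (hW.fromSpec y))
    (Localization.AtPrime p)
  have h1 : IsDomain (Localization.AtPrime p) := e.symm.toMulEquiv.isDomain _
  exact ⟨h1, Function.Surjective.valuationRing e.toRingEquiv.toRingHom e.surjective⟩

theorem flat_neronBlowup_of_valuationRing (hj : IsEffectiveCartierDivisor j)
    (i : H ⟶ (Over.pullback j).obj G) (hG : Flat G.hom)
    (hS : ∀ s : S, ∃ _ : IsDomain (S.presheaf.stalk s), ValuationRing (S.presheaf.stalk s)) :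
    Flat (neronBlowup hj.isLocallyPrincipal i).hom := by
  refine neronBlowup_of_forall_chart
    (RingHom.Flat.stableUnderComposition.stableUnderCompositionWithLocalizationAway
    RingHom.Flat.holdsForLocalizationAway).1 _ i fun x ↦ ?_
  obtain ⟨W, hW, a, ha, haW⟩ := hj (G.hom x)
  obtain ⟨U, hxU, e⟩ := exists_affineOpen_le x (W := G.hom ⁻¹ᵁ W.1) hW
  refine ⟨W, U, e, _, hxU, divisorIdeal_ideal_eq_span haW e, fun B' _ φ hφ ↦ ?_⟩
  let := φ.toAlgebra
  let := (G.hom.appLE W.1 U.1 e).hom.toAlgebra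
  let := (φ.comp (G.hom.appLE W.1 U.1 e).hom).toAlgebra
  have : IsScalarTower Γ(S, W.1) Γ(G.left, U.1) B' := .of_algebraMap_eq' rfl
  have : Module.Flat Γ(S, W.1) Γ(G.left, U.1) := HasRingHomProperty.iff_appLE.mp hG W U e
  have h : IsAffineBlowupAlgebra B' ((centerIdeal i).ideal U)
    (algebraMap Γ(S, W.1) Γ(G.left, U.1) a) := hφ
  exact h.flat_of_valuationRing fun p _ ↦ exists_valuationRing_localization hS W.2 p

lemma mem_primeIdealOf_asIdeal_iff {X : Scheme.{u}} {U : X.Opens} (hU : IsAffineOpen U) (x : U)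
    (f : Γ(X, U)) : f ∈ (hU.primeIdealOf x).asIdeal ↔ x.1 ∉ X.basicOpen f := by
  have h : hU.primeIdealOf x ∈ hU.fromSpec ⁻¹ᵁ X.basicOpen f ↔
      hU.primeIdealOf x ∈ PrimeSpectrum.basicOpen f := by
    rw [hU.fromSpec_preimage_basicOpen]
    rfl
  have h' : x.1 ∈ X.basicOpen f ↔ f ∉ (hU.primeIdealOf x).asIdeal := by
    rw [← PrimeSpectrum.mem_basicOpen, ← h, ← SetLike.mem_coe]
    conv_lhs => rw [← hU.fromSpec_primeIdealOf x]
    rfl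
  rw [h', not_not]

theorem smooth_neronBlowup (hj : IsEffectiveCartierDivisor j)
    (i : H ⟶ (Over.pullback j).obj G) [IsClosedImmersion i.left]
    (hG : Smooth G.hom) (hH : Smooth H.hom) : Smooth (neronBlowup hj.isLocallyPrincipal i).hom := by
  refine neronBlowup_of_forall_support_chart RingHom.Smooth.stableUnderComposition
    RingHom.Smooth.holdsForLocalizationAway hG hj i fun x hx W hW a ha haW ↦ ?_
  obtain ⟨U, hxU, e⟩ := exists_affineOpen_le x (W := G.hom ⁻¹ᵁ W.1) hW
  obtain ⟨hle, hq⟩ := exists_quotientMap_of_property i hH haW e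
  have hf := HasRingHomProperty.iff_appLE.mp hG W U e
  let := (G.hom.appLE W.1 U.1 e).hom.toAlgebra
  let := (Ideal.quotientMap ((centerIdeal i).ideal U) (G.hom.appLE W.1 U.1 e).hom hle).toAlgebra
  have : IsScalarTower Γ(S, W.1) (Γ(S, W.1) ⧸ Ideal.span {a})
    (Γ(G.left, U.1) ⧸ (centerIdeal i).ideal U) := .of_algebraMap_eq' rfl
  have : Algebra.Smooth Γ(S, W.1) Γ(G.left, U.1) := hf
  have : Algebra.Smooth (Γ(S, W.1) ⧸ Ideal.span {a})
    (Γ(G.left, U.1) ⧸ (centerIdeal i).ideal U) := hq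
  have haI : algebraMap Γ(S, W.1) Γ(G.left, U.1) a ∈ (centerIdeal i).ideal U :=
    hle (Ideal.mem_span_singleton_self a)
  have hqI : (centerIdeal i).ideal U ≤ (U.2.primeIdealOf ⟨x, hxU⟩).asIdeal := by
    rw [Scheme.IdealSheafData.mem_support_iff_of_mem hxU, Scheme.mem_zeroLocus_iff] at hx
    exact fun f hf ↦ (mem_primeIdealOf_asIdeal_iff U.2 ⟨x, hxU⟩ f).mpr (hx f hf)
  -- Good generators of the center exist only near `x`, so the chart is shrunk to the basic open of
  -- `h`.
  obtain ⟨h, hh, key⟩ := exists_smooth_blowup (A := Γ(S, W.1)) ha haI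
    (U.2.primeIdealOf ⟨x, hxU⟩).asIdeal hqI
  have hle' : (G.left.basicOpen h) ≤ G.hom ⁻¹ᵁ W.1 := (G.left.basicOpen_le h).trans e
  refine ⟨G.left.affineBasicOpen h, hle', ?_, fun B' _ φ hφ ↦ ?_⟩
  · exact not_not.mp (mt (mem_primeIdealOf_asIdeal_iff U.2 ⟨x, hxU⟩ h).mpr hh)
  let := (res (G.left.basicOpen_le h)).toAlgebra
  let : Algebra Γ(S, W.1) Γ(G.left, G.left.basicOpen h) :=
    (G.hom.appLE W.1 (G.left.basicOpen h) hle').hom.toAlgebra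
  let : Algebra Γ(G.left, G.left.basicOpen h) B' := φ.toAlgebra
  let : Algebra Γ(S, W.1) B' :=
    (φ.comp (G.hom.appLE W.1 (G.left.basicOpen h) hle').hom).toAlgebra
  have : IsScalarTower Γ(S, W.1) Γ(G.left, G.left.basicOpen h) B' := .of_algebraMap_eq' rfl
  have : IsScalarTower Γ(S, W.1) Γ(G.left, U.1) Γ(G.left, G.left.basicOpen h) := by
    refine .of_algebraMap_eq' ?_
    exact congr_arg CommRingCat.Hom.hom
      (G.hom.appLE_map e (homOfLE (G.left.basicOpen_le h)).op).symm
  have : IsLocalization.Away h Γ(G.left, G.left.basicOpen h) := U.2.isLocalization_basicOpen h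
  have hI := (centerIdeal i).map_ideal_basicOpen U h
  refine key (T := Γ(G.left, G.left.basicOpen h)) (B' := B') ?_
  have h1 : (((centerIdeal i).ideal U).map (algebraMap Γ(G.left, U.1)
    Γ(G.left, G.left.basicOpen h))) = (centerIdeal i).ideal (G.left.affineBasicOpen h) := hI
  rw [h1]
  exact hφ

end Properties

end NeronBlowup

namespace NeronBlowup

/-! ### Connectedness of preimages, and fibres of affine spaces. -/

section Topology

open Topology

variable {X Y : Type*} [TopologicalSpace X] [TopologicalSpace Y] {f : Y → X}

/-- The preimage of a preconnected set under a map that is open over it and has connected fibres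
over it. -/
lemma isPreconnected_preimage_of_nhdsWithin_le_map {E : Set X} (hE : IsPreconnected E)
    (hf : ∀ y, f y ∈ E → 𝓝[E] (f y) ≤ Filter.map f (𝓝 y))
    (hfib : ∀ x ∈ E, _root_.IsConnected (f ⁻¹' {x})) : IsPreconnected (f ⁻¹' E) := by
  rintro u v hu hv huv ⟨y, hyE, hyu⟩ ⟨z, hzE, hzv⟩
  have key (w : Set Y) (hw : IsOpen w) (x : X) (hx : x ∈ E) (h : (f ⁻¹' {x} ∩ w).Nonempty) :
      ∃ O, IsOpen O ∧ x ∈ O ∧ O ∩ E ⊆ f '' w := by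
    obtain ⟨y, rfl, hy⟩ := h
    exact mem_nhdsWithin.mp (hf y hx (Filter.image_mem_map (hw.mem_nhds hy)))
  -- Within `E`, `o w` is exactly the set of points whose fibre meets `w`. Thus `o u` and `o v`
  -- cover `E`, and a common point in `E` has a connected fibre meeting both `u` and `v`.
  let o (w : Set Y) : Set X := ⋃₀ {O | IsOpen O ∧ O ∩ E ⊆ f '' w}
  have ho (w : Set Y) : IsOpen (o w) := isOpen_sUnion fun O hO ↦ hO.1
  have mem_o {w : Set Y} (hw : IsOpen w) {x : X} (hx : x ∈ E) (h : (f ⁻¹' {x} ∩ w).Nonempty) :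
      x ∈ o w := by
    obtain ⟨O, hO, hxO, hOw⟩ := key w hw x hx h
    exact ⟨O, ⟨hO, hOw⟩, hxO⟩
  have of_mem_o {w : Set Y} {x : X} (hx : x ∈ E) (h : x ∈ o w) : (f ⁻¹' {x} ∩ w).Nonempty := by
    obtain ⟨O, ⟨hO, hOw⟩, hxO⟩ := h
    obtain ⟨y, hy, hyx⟩ := hOw ⟨hxO, hx⟩
    exact ⟨y, hyx, hy⟩
  have hfE (x) (hx : x ∈ E) : f ⁻¹' {x} ⊆ f ⁻¹' E := Set.preimage_mono (by simpa using hx)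
  obtain ⟨x, hx, hxu, hxv⟩ := hE (o u) (o v) (ho u) (ho v) (fun x hx ↦ by
      obtain ⟨y, hy⟩ := (hfib x hx).nonempty
      exact (huv (hfE x hx hy)).imp (fun h ↦ mem_o hu hx ⟨y, hy, h⟩) fun h ↦ mem_o hv hx ⟨y, hy, h⟩)
    ⟨f y, hyE, mem_o hu hyE ⟨y, rfl, hyu⟩⟩ ⟨f z, hzE, mem_o hv hzE ⟨z, rfl, hzv⟩⟩
  exact ((hfib x hx).isPreconnected u v hu hv ((hfE x hx).trans huv) (of_mem_o hx hxu)
    (of_mem_o hx hxv)).mono (Set.inter_subset_inter_left _ (hfE x hx))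

variable {Q R : Type*} [TopologicalSpace Q] [TopologicalSpace R] {g : Q → Y} {k : Q → R}
  {h : R → X}

/-- Openness of `f` over the subspace `range h` is inherited from the open map `k`, here the
projection of an affine space. -/
lemma nhdsWithin_range_le_map (hg : Continuous g) (hk : IsOpenMap k) (hh : IsInducing h)
    (comm : f ∘ g = h ∘ k) (q : Q) : 𝓝[Set.range h] (f (g q)) ≤ Filter.map f (𝓝 (g q)) := by
  calc 𝓝[Set.range h] (f (g q)) = 𝓝[Set.range h] (h (k q)) := by
        rw [show f (g q) = h (k q) from congr_fun comm q]
    _ = Filter.map h (𝓝 (k q)) := (hh.map_nhds_eq _).symm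
    _ ≤ Filter.map h (Filter.map k (𝓝 q)) := Filter.map_mono (hk.nhds_le q)
    _ = Filter.map f (Filter.map g (𝓝 q)) := by
        rw [Filter.map_map, Filter.map_map, comm]
    _ ≤ Filter.map f (𝓝 (g q)) := Filter.map_mono (hg.tendsto q)

end Topology

lemma isConnected_preimage_singleton_of_comm {X Y Q R : Type*} [TopologicalSpace Y]
    [TopologicalSpace Q] {f : Y → X} {g : Q → Y} {k : Q → R} {h : R → X}
    (hg : Continuous g) (hh : Function.Injective h)
    (comm : f ∘ g = h ∘ k) (hfg : f ⁻¹' Set.range h ⊆ Set.range g) (r : R)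
    (hr : _root_.IsConnected (k ⁻¹' {r})) : _root_.IsConnected (f ⁻¹' {h r}) := by
  convert! hr.image g hg.continuousOn
  ext y
  have comm' (q) : f (g q) = h (k q) := congr_fun comm q
  constructor
  · rintro (hy : f y = h r)
    obtain ⟨q, rfl⟩ := hfg ⟨r, hy.symm⟩
    exact ⟨q, hh ((comm' q).symm.trans hy), rfl⟩
  · rintro ⟨q, rfl, rfl⟩
    exact comm' q

/-- The fibre has a generic point: the extension of `p` to the polynomial ring is prime, lies over
`p` and is contained in every prime over `p`. Connectedness follows as the fibre lies in the closure
of this point. -/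
lemma isConnected_preimage_comap_C {R σ : Type*} [CommRing R] (p : PrimeSpectrum R) :
    _root_.IsConnected (PrimeSpectrum.comap (MvPolynomial.C (R := R) (σ := σ)) ⁻¹' {p}) := by
  have hker : RingHom.ker (MvPolynomial.map (σ := σ) (Ideal.Quotient.mk p.asIdeal)) =
      p.asIdeal.map MvPolynomial.C := by
    rw [MvPolynomial.ker_map, Ideal.mk_ker]
  let ξ : PrimeSpectrum (MvPolynomial σ R) := ⟨_, hker ▸ RingHom.ker_isPrime _⟩
  have hξ : PrimeSpectrum.comap (MvPolynomial.C (R := R) (σ := σ)) ξ = p := by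
    refine PrimeSpectrum.ext (Ideal.ext fun r ↦ ?_)
    change MvPolynomial.C r ∈ p.asIdeal.map MvPolynomial.C ↔ r ∈ p.asIdeal
    rw [← hker, RingHom.mem_ker, MvPolynomial.map_C,
      map_eq_zero_iff _ (MvPolynomial.C_injective _ _),
      Ideal.Quotient.eq_zero_iff_mem]
  refine isConnected_singleton.subset_closure (Set.singleton_subset_iff.mpr hξ) ?_
  rintro q rfl
  rw [← specializes_iff_mem_closure, ← PrimeSpectrum.le_iff_specializes]
  exact Ideal.map_comap_le

/-! ### Connected fibres of the Néron blowup over `S₀`. -/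

section ConnectedFibres

open Topology

variable {S S₀ : Scheme.{u}} {j : S₀ ⟶ S} [IsClosedImmersion j] {G : Over S} {H : Over S₀}

/-- Over a chart on which `I` is generated by a weakly regular sequence starting with an equation
`b` of the divisor, the dilatation restricts to an affine space over the center. -/
lemma IsDilatation.exists_comm_affineSpace {X Y : Scheme.{u}} {π : Y ⟶ X} {I J : X.IdealSheafData}
    (hπ : IsDilatation π I J) (U : X.affineOpens) {b : Γ(X, U.1)} (hb : J.ideal U = Ideal.span {b})
    {xs : List Γ(X, U.1)} (hxs : RingTheory.Sequence.IsWeaklyRegular Γ(X, U.1) (b :: xs))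
    (hI : I.ideal U = Ideal.span {b} ⊔ Ideal.span (Set.range xs.get)) :
    ∃ (g : PrimeSpectrum (MvPolynomial (Fin xs.length) (Γ(X, U.1) ⧸ I.ideal U)) → Y)
      (h : PrimeSpectrum (Γ(X, U.1) ⧸ I.ideal U) → X), Continuous g ∧ IsEmbedding h ∧
        π ∘ g = h ∘ PrimeSpectrum.comap MvPolynomial.C ∧ Set.range h = (I.support : Set X) ∩ U.1 ∧
        π ⁻¹' Set.range h ⊆ Set.range g := by
  have := hπ.isAffineHom
  have hU : IsAffineOpen U.1 := U.2
  have hV := hU.preimage π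
  let := (π.app U.1).hom.toAlgebra
  obtain ⟨ψ⟩ := (BlowupModel.isAffineBlowupAlgebra _ _ hI
    (BlowupModel.algebraMap_mem_nonZeroDivisors hxs)).nonempty_algEquiv
    (show IsAffineBlowupAlgebra Γ(Y, π ⁻¹ᵁ U.1) _ _ from hπ.isAffineBlowup U b hb)
  obtain ⟨e⟩ := BlowupModel.nonempty_quotient_algEquiv b xs.get hI
  let γ : Γ(Y, π ⁻¹ᵁ U.1) →ₐ[Γ(X, U.1)]
      MvPolynomial (Fin xs.length) (Γ(X, U.1) ⧸ I.ideal U) :=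
    (e.toAlgHom.comp (Ideal.Quotient.mkₐ _ _)).comp ψ.symm.toAlgHom
  have hγ : Function.Surjective γ :=
    (e.surjective.comp Ideal.Quotient.mk_surjective).comp ψ.symm.surjective
  -- Thus `γ` embeds the affine space over the center as the zero locus of `b` in the chart of `Y`.
  -- Points over `V(I)` lie there because `b ∈ I`, which gives the last inclusion.
  have hkerγ : RingHom.ker γ = Ideal.span {(π.app U.1).hom b} := by
    have h1 : ψ.symm ((π.app U.1).hom b) = algebraMap _ _ b := ψ.symm.commutes b
    ext y
    change e (Ideal.Quotient.mk _ (ψ.symm y)) = 0 ↔ _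
    rw [map_eq_zero_iff _ e.injective, Ideal.Quotient.eq_zero_iff_mem, Ideal.mem_span_singleton,
      Ideal.mem_span_singleton, ← h1, map_dvd_iff]
  have hcomm : γ.toRingHom.comp (π.app U.1).hom =
      MvPolynomial.C.comp (Ideal.Quotient.mk (I.ideal U)) := γ.comp_algebraMap
  have hmk := PrimeSpectrum.isClosedEmbedding_comap_of_surjective _ _
    (Ideal.Quotient.mk_surjective (I := I.ideal U))
  have hrange : Set.range (PrimeSpectrum.comap (Ideal.Quotient.mk (I.ideal U))) =
      PrimeSpectrum.zeroLocus (I.ideal U) := by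
    rw [range_comap_of_surjective _ _ Ideal.Quotient.mk_surjective, Ideal.mk_ker]
  let oX : PrimeSpectrum Γ(X, U.1) → X := hU.fromSpec
  let oY : PrimeSpectrum Γ(Y, π ⁻¹ᵁ U.1) → Y := hV.fromSpec
  have hoX : IsOpenEmbedding oX := hU.fromSpec.isOpenEmbedding
  have hoY : IsOpenEmbedding oY := hV.fromSpec.isOpenEmbedding
  have hsq (p) : π (oY p) = oX (PrimeSpectrum.comap (π.app U.1).hom p) := by
    have := hU.SpecMap_appLE_fromSpec π hV le_rfl
    rw [← Scheme.Hom.app_eq_appLE] at this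
    exact congr($this.symm p)
  refine ⟨oY ∘ PrimeSpectrum.comap γ.toRingHom,
    oX ∘ PrimeSpectrum.comap (Ideal.Quotient.mk (I.ideal U)),
    hoY.continuous.comp (PrimeSpectrum.continuous_comap _),
    hoX.isEmbedding.comp hmk.isEmbedding, ?_, ?_, ?_⟩
  · funext p
    change π (oY (PrimeSpectrum.comap γ.toRingHom p)) = oX
      (PrimeSpectrum.comap (Ideal.Quotient.mk (I.ideal U)) (PrimeSpectrum.comap MvPolynomial.C p))
    rw [hsq, ← PrimeSpectrum.comap_comp_apply, ← PrimeSpectrum.comap_comp_apply, hcomm]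
  · rw [Set.range_comp, hrange, I.coe_support_inter]
    exact hU.fromSpec_image_zeroLocus _
  · rintro y hy
    rw [Set.range_comp, hrange] at hy
    obtain ⟨q, hq, hqy⟩ := hy
    have hyV : y ∈ Set.range oY := by
      refine hV.range_fromSpec.ge ?_
      change π y ∈ U.1
      rw [← hqy]
      exact hU.range_fromSpec.le ⟨q, rfl⟩
    obtain ⟨p, rfl⟩ := hyV
    rw [hsq] at hqy
    have hpq := hoX.injective hqy
    subst hpq
    rw [Set.range_comp, range_comap_of_surjective _ _ hγ]
    refine ⟨p, ?_, rfl⟩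
    have h1 : RingHom.ker γ.toRingHom = Ideal.span {(π.app U.1).hom b} := hkerγ
    rw [h1, PrimeSpectrum.zeroLocus_span, PrimeSpectrum.mem_zeroLocus, Set.singleton_subset_iff]
    exact hq (hI ▸ Ideal.mem_sup_left (Ideal.mem_span_singleton_self b))

theorem hasConnectedFibers_neronBlowup (hj : IsEffectiveCartierDivisor j)
    (i : H ⟶ (Over.pullback j).obj G) [IsClosedImmersion i.left] (hreg : IsRegularOver j G)
    (hi : IsRegularImmersion i.left) (hH : HasConnectedFibers H.hom) :
    HasConnectedFibers
      ((Over.pullback j).obj (neronBlowup hj.isLocallyPrincipal i)).hom := by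
  intro s
  have hs := hH s
  let N := neronBlowup hj.isLocallyPrincipal i
  let π : N ⟶ G := neronBlowupHom hj.isLocallyPrincipal i
  let c : H.left ⟶ G.left := i.left ≫ pullback.fst G.hom j
  have hc (z : H.left) : G.hom (c z) = j (H.hom z) := by
    have h : i.left ≫ pullback.snd G.hom j = H.hom := Over.w i
    have : c ≫ G.hom = H.hom ≫ j := by
      rw [Category.assoc, pullback.condition, reassoc_of% h]
    exact congr($this z)
  have hπ : IsDilatation π.left (centerIdeal i) (divisorIdeal j G) :=
    isDilatation_neronBlowupHom hj.isLocallyPrincipal i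
  -- The fibre of `H` over `s`, seen in `G`. The fibre of the blowup over `s` is homeomorphic to the
  -- preimage of `E`, so it suffices to show this preimage connected.
  let E : Set G.left := c '' (H.hom ⁻¹' {s})
  have hsupp : ((centerIdeal i).support : Set G.left) = Set.range c :=
    Set.ext fun x ↦ mem_support_centerIdeal_iff i
  have hE : _root_.IsConnected E := by
    refine IsConnected.image ?_ _ c.continuous.continuousOn
    rw [isConnected_iff_connectedSpace]
    exact (H.hom.fiberHomeo s).surjective.connectedSpace (H.hom.fiberHomeo s).continuous
  -- the local structure of `π` over the support of the center
  have key (x : G.left) (hx : x ∈ E) : _root_.IsConnected (π.left ⁻¹' {x}) ∧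
      ∀ y, π.left y = x → 𝓝[E] x ≤ Filter.map π.left (𝓝 y) := by
    have hxc : x ∈ ((centerIdeal i).support : Set G.left) :=
      hsupp ▸ Set.image_subset_range _ _ hx
    obtain ⟨O, hxO, hO⟩ := exists_opens_isWeaklyRegular i hi hxc
    obtain ⟨W, hW, a, ha, haW⟩ := hj (G.hom x)
    obtain ⟨U, hxU, hUO⟩ := exists_affineOpen_le x (W := O ⊓ G.hom ⁻¹ᵁ W.1) ⟨hxO, hW⟩
    have e : U.1 ≤ G.hom ⁻¹ᵁ W.1 := hUO.trans inf_le_right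
    have hb := divisorIdeal_ideal_eq_span haW e
    obtain ⟨xs, hxs, hI⟩ :=
      hO U (hUO.trans inf_le_left) _ (IsCartier.mem_nonZeroDivisors hreg U hb) hb
    obtain ⟨g, h, hg, hh, hgh, hrange, hpre⟩ := hπ.exists_comm_affineSpace U hb hxs hI
    have hxh : x ∈ Set.range h := hrange ▸ ⟨hxc, hxU⟩
    refine ⟨?_, ?_⟩
    · obtain ⟨r, rfl⟩ := hxh
      exact isConnected_preimage_singleton_of_comm hg hh.injective hgh hpre r
        (isConnected_preimage_comap_C r)
    · rintro y rfl
      obtain ⟨q, rfl⟩ := hpre hxh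
      refine le_trans ?_
        (nhdsWithin_range_le_map hg MvPolynomial.isOpenMap_comap_C hh.isInducing hgh q)
      -- The chart gives openness only over the part of the center in `U`; near the point this is
      -- the whole center, which contains `E`.
      have hU : (U.1 : Set G.left) ∈ 𝓝[((centerIdeal i).support : Set G.left)] (π.left (g q)) :=
        mem_nhdsWithin_of_mem_nhds (U.1.2.mem_nhds hxU)
      rw [hrange, nhdsWithin_inter_of_mem' hU]
      exact nhdsWithin_mono _ (hsupp ▸ Set.image_subset_range _ _)
  have hpre : _root_.IsConnected (π.left ⁻¹' E) := by
    refine ⟨?_, isPreconnected_preimage_of_nhdsWithin_le_map hE.isPreconnected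
      (fun y hy ↦ (key _ hy).2 y rfl) fun x hx ↦ (key x hx).1⟩
    obtain ⟨x, hx⟩ := hE.nonempty
    obtain ⟨y, rfl⟩ := (key x hx).1.nonempty
    exact ⟨y, hx⟩
  let f₁ := pullback.fst N.hom j
  let f₂ := pullback.snd N.hom j
  -- One inclusion holds because the blowup maps `S₀`-fibres into `H`, the other because a point
  -- over `E` lies over `j s`.
  have himg : f₁ '' (f₂ ⁻¹' {s}) = π.left ⁻¹' E := by
    obtain ⟨p, hp⟩ := exists_neronBlowup_restriction hj.isLocallyPrincipal i
    ext n
    constructor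
    · rintro ⟨z, rfl, rfl⟩
      refine ⟨p.left z, ?_, ?_⟩
      · have : p.left ≫ H.hom = f₂ := Over.w p
        exact congr($this z)
      · have h1 : p.left ≫ i.left = pullback.lift (f₁ ≫ π.left) f₂ _ :=
          congr_arg CommaMorphism.left hp
        have : p.left ≫ c = f₁ ≫ π.left := by
          rw [← Category.assoc, h1, pullback.lift_fst]
        exact congr($this z)
    · rintro ⟨z, hz, hzn⟩
      have hn : N.hom n = j s := by
        rw [← hz, ← hc, hzn, ← Over.w π]
        rfl
      have hn' : n ∈ Set.range f₁ := by
        rw [Scheme.Pullback.range_fst]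
        exact ⟨s, hn.symm⟩
      obtain ⟨w, rfl⟩ := hn'
      refine ⟨w, j.isClosedEmbedding.injective ?_, rfl⟩
      rw [← hn]
      have : f₁ ≫ N.hom = f₂ ≫ j := pullback.condition
      exact congr($this.symm w)
  have hf₂ : _root_.IsConnected (f₂ ⁻¹' {s}) := by
    refine ⟨?_, f₁.isClosedEmbedding.isInducing.isPreconnected_image.mp
      (himg ▸ hpre.isPreconnected)⟩
    exact Set.image_nonempty.mp (himg ▸ hpre.nonempty)
  rw [isConnected_iff_connectedSpace] at hf₂
  exact (f₂.fiberHomeo s).symm.surjective.connectedSpace (f₂.fiberHomeo s).symm.continuous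

end ConnectedFibres

end NeronBlowup

theorem mainTheorem1
    {S S₀ : Scheme.{u}} (j : S₀ ⟶ S) [IsClosedImmersion j]
    (hj : IsEffectiveCartierDivisor j)
    (G : Over S) [GrpObj G] (H : Over S₀) [GrpObj H]
    (i : H ⟶ (Over.pullback j).obj G) [IsMonHom i] [IsClosedImmersion i.left] :
    -- the universal property of the Néron blowup
    (IsRegularOver j (neronBlowup hj.isLocallyPrincipal i) ∧
      (∀ T : Over S, IsRegularOver j T → ∀ t : T ⟶ G,
        (∃ t₀ : (Over.pullback j).obj T ⟶ H, t₀ ≫ i = (Over.pullback j).map t) ↔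
          ∃! t' : T ⟶ neronBlowup hj.isLocallyPrincipal i,
            t' ≫ neronBlowupHom hj.isLocallyPrincipal i = t)) ∧
    -- the canonical morphism to `G` is affine, an isomorphism away from `S₀`, and factors through `H`
    -- over `S₀`
    (IsAffineHom (neronBlowupHom hj.isLocallyPrincipal i).left ∧
      (∀ U : S.Opens, Disjoint (U : Set S) (Set.range j) →
        IsIso ((neronBlowupHom hj.isLocallyPrincipal i).left ∣_ (G.hom ⁻¹ᵁ U))) ∧
      (∃ p : (Over.pullback j).obj (neronBlowup hj.isLocallyPrincipal i) ⟶ H,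
        p ≫ i = (Over.pullback j).map (neronBlowupHom hj.isLocallyPrincipal i))) ∧
    -- affineness and quasi-affineness over `S`
    ((IsAffineHom G.hom → IsAffineHom (neronBlowup hj.isLocallyPrincipal i).hom) ∧
      (IsQuasiAffineHom G.hom → IsQuasiAffineHom (neronBlowup hj.isLocallyPrincipal i).hom)) ∧
    -- finite presentation
    (IsRegularOver j G → IsRegularImmersion i.left →
      (LocallyOfFinitePresentation G.hom →
        LocallyOfFinitePresentation (neronBlowup hj.isLocallyPrincipal i).hom) ∧
      (IsOfFinitePresentation G.hom →
        IsOfFinitePresentation (neronBlowup hj.isLocallyPrincipal i).hom)) ∧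
    -- connected fibres
    (IsRegularOver j G → IsRegularImmersion i.left →
      HasConnectedFibers H.hom →
      HasConnectedFibers ((Over.pullback j).obj (neronBlowup hj.isLocallyPrincipal i)).hom) ∧
    -- flatness
    (Flat G.hom →
      ((IsRegularImmersion i.left ∧ Flat H.hom ∧
          IsLocallyNoetherian S ∧ IsLocallyNoetherian G.left) ∨
        (IsRegularImmersion i.left ∧ Flat H.hom ∧
          LocallyOfFinitePresentation G.hom) ∨
        (∀ s : S, ∃ _ : IsDomain (S.presheaf.stalk s), ValuationRing (S.presheaf.stalk s))) →
      Flat (neronBlowup hj.isLocallyPrincipal i).hom) ∧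
    -- smoothness
    (Smooth G.hom → Smooth H.hom → Smooth (neronBlowup hj.isLocallyPrincipal i).hom) ∧
    -- base change
    (Flat (neronBlowup hj.isLocallyPrincipal i).hom → ∀ {S' : Scheme.{u}} (g : S' ⟶ S)
      (hg : IsEffectiveCartierDivisor (pullback.fst g j)),
      ∃ e : (Over.pullback g).obj (neronBlowup hj.isLocallyPrincipal i) ≅
          neronBlowup hg.isLocallyPrincipal (baseChangeCenter g i),
        e.hom ≫ neronBlowupHom hg.isLocallyPrincipal (baseChangeCenter g i) =
          (Over.pullback g).map (neronBlowupHom hj.isLocallyPrincipal i)) ∧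
    -- group structure
    (Flat (neronBlowup hj.isLocallyPrincipal i).hom →
      ∃ _ : GrpObj (neronBlowup hj.isLocallyPrincipal i),
        IsMonHom (neronBlowupHom hj.isLocallyPrincipal i)) := by
  refine ⟨⟨isRegularOver_neronBlowup _ i, fun T hT t ↦ exists_neronBlowup_lift_iff _ i hT t⟩,
    ⟨inferInstance, fun U hU ↦ isIso_neronBlowupHom_morphismRestrict _ i U hU,
      exists_neronBlowup_restriction _ i⟩,
    ⟨isAffineHom_neronBlowup _ i, isQuasiAffineHom_neronBlowup _ i⟩,
    fun hreg hi ↦ ⟨locallyOfFinitePresentation_neronBlowup hj i hreg hi,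
      isOfFinitePresentation_neronBlowup hj i hreg hi⟩,
    fun hreg hi hH ↦ hasConnectedFibers_neronBlowup hj i hreg hi hH, fun hG h ↦ ?_,
    smooth_neronBlowup hj i, fun hflat _ g hg ↦ exists_neronBlowup_baseChange_iso _ i hflat g hg,
    exists_grpObj_neronBlowup i hj⟩
  obtain ⟨hi, hH, -, -⟩ | ⟨hi, hH, -⟩ | hS := h
  · exact flat_neronBlowup_of_isRegularImmersion hj i hi hG hH
  · exact flat_neronBlowup_of_isRegularImmersion hj i hi hG hH
  · exact flat_neronBlowup_of_valuationRing hj i hG hS
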